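/- Setting. Let $A,S$ be real analytic and real valued on $\mathbb R$ with $A,S,S'\in L^1(\mathbb R)$ and $A(x),S'(x)\to0$ as $x\to\pm\infty$, extending holomorphically to a simply connected open neighbourhood $\Omega_0\subset\mathbb C$ of $\mathbb R$. For $\epsilon>0$ let $$\mathfrak D_\epsilon=\begin{bmatrix}-\frac{\epsilon}{i}\frac{d}{dx}&\omega\\-\omega^*&\frac{\epsilon}{i}\frac{d}{dx}\end{bmatrix},\qquad \omega=-iA\,e^{iS/\epsilon},$$ on $L^2(\mathbb R;\mathbb C^2)$. Put $g_\pm(x,\lambda)=\mp[\lambda+\frac12S'(x)\pm iA(x)]$ and $V_0=g_+g_-=-(\lambda+\frac12S')^2-A^2$. Turning points are the zeros of $V_0(\cdot,\lambda)$; a phase is a function $z$ with $(z')^2=V_0$, i.e. $z(x,\lambda,\alpha)=i\int_\alpha^x\sqrt{-V_0(t,\lambda)}\,dt$; a path is progressive if it meets no turning point and $\operatorname{Re}z$ is strictly monotone along it. Contour. Let $\lambda_0\in\mathbb C\setminus\mathbb R$ lie on an asymptotic spectral arc: there is a simple contour $C=C^-\cup C^0\cup C^+$ in $\Omega_0$,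 coinciding with $\mathbb R$ near $\pm\infty$, such that $C^0$ joins two simple turning points $\alpha_0=x_-(\lambda_0)$ and $\beta_0=x_+(\lambda_0)$ with $\operatorname{Re}z(x,\lambda_0,\alpha_0)=0$ on $C^0$ (a Stokes line), and $C^-$ (from $\alpha_0$ to $-\infty$) and $C^+$ (from $\beta_0$ to $+\infty$) are progressive. Assume (H1) $C^0$ contains no turning point other than $\alpha_0,\beta_0$. Three Stokes lines leave $\alpha_0$, one of them $C^0$; $C^-$ leaves $\alpha_0$ inside the sector between the other two (within a closed subsector), and $C^+$ leaves $\beta_0$ likewise. Let $\alpha(\lambda),\beta(\lambda)$ be the turning points continuing $\alpha_0,\beta_0$ to $\lambda$ near $\lambda_0$. Cut a neighbourhood of $C$ by an arc from $\alpha$ to its boundary leaving $\alpha$ on the left of $C$, in the closed sector between $C^0$ and the Stokes line following it anti-clockwise around $\alpha$, and by an arc from $\beta$ to the boundary on the right of $C$, in the closed sector between $C^0$ and the Stokes line following it anti-clockwise around $\beta$ (the cuts are straight segments translated with $\alpha,\beta$, and the cut neighbourhood $D_\lambda$ is connected and free of turning points). On $D_\lambda$ let $z(\cdot,\lambda,\alpha)$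 be the branch with limit $0$ at $\alpha$ and $\operatorname{Re}z\to-\infty$ as $x\to-\infty$; let $z(\beta,\lambda,\alpha)$ be its limit at $\beta$, put $z(\cdot,\lambda,\beta)=z(\cdot,\lambda,\alpha)-z(\beta,\lambda,\alpha)$, and let $H=(g_- /g_+)^{1/4}$ with $H^2=z'/g_+$. Exact WKB solutions. For a base point $x_0\in D_\lambda$ and a phase $z$ let, near $x_0$, $w_0^\pm=1$, $w^\pm_{2n+1}(x)=\int_{x_0}^{x}e^{\pm2(z(y)-z(x))/\epsilon}\frac{H'(y)}{H(y)}w^\pm_{2n}(y)\,dy$, $w^\pm_{2n+2}(x)=\int_{x_0}^x\frac{H'(y)}{H(y)}w^\pm_{2n+1}(y)\,dy$, $w^\pm_{\rm even}=\sum_{n\ge0} w^\pm_{2n}$, $w^\pm_{\rm odd}=\sum_{n\ge0} w^\pm_{2n+1}$, and let $\mathbf u^\pm$ be the solution in $\Omega_0$ of the (holomorphically extended) system $\mathfrak D_\epsilon\mathbf u=\lambda\mathbf u$ that equals, near $x_0$, $$e^{\pm z/\epsilon}\begin{bmatrix}e^{iS/2\epsilon}&0\\0&e^{-iS/2\epsilon}\end{bmatrix}\begin{bmatrix}1&1\\-1&1\end{bmatrix}\begin{bmatrix}H^{-1}&H^{-1}\\iH&-iH\end{bmatrix}\begin{bmatrix}0&1\\1&0\end{bmatrix}^{\frac{1\pm1}2}\begin{bmatrix}w^\pm_{\rm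 even}\\w^\pm_{\rm odd}\end{bmatrix}.$$ For the base point $\mp\infty$ the symbol $(w_{\rm even},w_{\rm odd})$ is instead required to tend to $(1,0)$ at that end of $\mathbb R$. Let $x_1$ (resp. $x_2$) be a point of $D_{\lambda_0}$ that can be joined in $D_{\lambda_0}$ to a point of $C^0\setminus\{\alpha_0,\beta_0\}$ by a path along which $\operatorname{Re}z(\cdot,\lambda_0,\alpha_0)$ strictly decreases (resp. increases); these points lie on the right (resp. left) of $C^0$. Let $\mathbf u_0^\alpha=\mathbf u^+$ with phase $z(\cdot,\lambda,\alpha)$ and base point $-\infty$, $\mathbf u_0^\beta=\mathbf u^-$ with phase $z(\cdot,\lambda,\beta)$ and base point $+\infty$; and for $\kappa\in\{\alpha,\beta\}$, with phase $z(\cdot,\lambda,\kappa)$, let $\mathbf u_1^\kappa=\mathbf u^-$ with base point $x_1$ and $\mathbf u_2^\kappa=\mathbf u^+$ with base point $x_2$. Write $\mathcal W[\mathbf f,\mathbf g]=\det[\mathbf f\ \mathbf g]$, and let $\delta(\alpha_0,\beta_0)=-1$ if the same one of $g_+(\cdot,\lambda_0),g_-(\cdot,\lambda_0)$ vanishes at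 $\alpha_0$ and at $\beta_0$, and $\delta(\alpha_0,\beta_0)=1$ otherwise. Theorem. There are a neighbourhood $U$ of $\lambda_0$ and constants $\epsilon_0>0$, $M$ such that for all $\lambda\in U$ and $0<\epsilon<\epsilon_0$ the Wronskians $\mathcal W[\mathbf u_2^\alpha,\mathbf u_0^\alpha]$ and $\mathcal W[\mathbf u_0^\beta,\mathbf u_1^\beta]$ do not vanish, and with $$m=m(\lambda,\epsilon)=\frac{\mathcal W[\mathbf u_0^\alpha,\mathbf u_1^\alpha]\,\mathcal W[\mathbf u_2^\beta,\mathbf u_0^\beta]}{\mathcal W[\mathbf u_2^\alpha,\mathbf u_0^\alpha]\,\mathcal W[\mathbf u_0^\beta,\mathbf u_1^\beta]}$$ one has: $\lambda$ is an eigenvalue of $\mathfrak D_\epsilon$ if and only if $m\,e^{2z(\beta,\lambda,\alpha)/\epsilon}=1$; and $|m-\delta(\alpha_0,\beta_0)|\le M\epsilon$. -/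

import Mathlib

open Set Filter Topology MeasureTheory Complex
open scoped Matrix

namespace ZakharovShabat

noncomputable section

/-! ### The Zakharov-Shabat operator -/

/-- Standing assumptions on the amplitude `A` and the phase `S`: they are real valued and integrable
on the real line, so is `S'`, both `A` and `S'` tend to `0` at infinity, and `A`, `S` extend
holomorphically to a simply connected open neighbourhood `Ω` of the real axis. -/
structure IsPotential (A S : ℂ → ℂ) (Ω : Set ℂ) : Prop where
  isOpen : IsOpen Ω
  simplyConnected : SimplyConnectedSpace Ω
  real_mem : ∀ x : ℝ, (x : ℂ) ∈ Ω
  holo_A : DifferentiableOn ℂ A Ω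
  holo_S : DifferentiableOn ℂ S Ω
  real_A : ∀ x : ℝ, (A x).im = 0
  real_S : ∀ x : ℝ, (S x).im = 0
  int_A : Integrable (fun x : ℝ => A x)
  int_S : Integrable (fun x : ℝ => S x)
  int_S' : Integrable (fun x : ℝ => deriv S x)
  zero_A : Tendsto (fun x : ℝ => A x) (cocompact ℝ) (𝓝 0)
  zero_S' : Tendsto (fun x : ℝ => deriv S x) (cocompact ℝ) (𝓝 0)

/-- The complex potential `ω(x, ε) = -i A(x) exp(i S(x) / ε)`. -/
def potential (A S : ℂ → ℂ) (ε : ℝ) (x : ℂ) : ℂ := -I * A x * exp (I * S x / ε)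

/-- The holomorphic function `i A(x) exp(-i S(x) / ε)`, which on the real axis is the complex
conjugate of `potential`. -/
def potentialConj (A S : ℂ → ℂ) (ε : ℝ) (x : ℂ) : ℂ := I * A x * exp (-I * S x / ε)

/-- The operator `𝔇_ε`, acting on functions from `ℝ` to `ℂ²`. -/
def zsOperator (A S : ℂ → ℂ) (ε : ℝ) (u : ℝ → Fin 2 → ℂ) (x : ℝ) : Fin 2 → ℂ :=
  ![-(ε / I) * deriv (fun y => u y 0) x + potential A S ε x * u x 1,
    -(starRingEnd ℂ (potential A S ε x)) * u x 0 + (ε / I) * deriv (fun y => u y 1) x]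

/-- `lam` is an eigenvalue of `𝔇_ε` on `L²(ℝ; ℂ²)`. -/
def IsEigenvalue (A S : ℂ → ℂ) (ε : ℝ) (lam : ℂ) : Prop :=
  ∃ u : ℝ → Fin 2 → ℂ, u ≠ 0 ∧ Differentiable ℝ u ∧ (∀ j, MemLp (fun x => u x j) 2) ∧
    ∀ x, zsOperator A S ε u x = lam • u x

/-- The matrix `K(x, lam, ε)` of the first order system `(ε / i) u' = K u`, which is equivalent to
`𝔇_ε u = lam u`. -/
def systemMatrix (A S : ℂ → ℂ) (ε : ℝ) (lam x : ℂ) : Matrix (Fin 2) (Fin 2) ℂ :=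
  !![-lam, potential A S ε x; potentialConj A S ε x, lam]

/-- `u` is a holomorphic solution of `(ε / i) u' = K u` in `Ω`. -/
def IsSolution (A S : ℂ → ℂ) (Ω : Set ℂ) (ε : ℝ) (lam : ℂ) (u : ℂ → Fin 2 → ℂ) : Prop :=
  DifferentiableOn ℂ u Ω ∧
    ∀ x ∈ Ω, ((ε : ℂ) / I) • deriv u x = systemMatrix A S ε lam x *ᵥ u x

/-- The determinant `𝒲[u, v]` of two `ℂ²`-valued functions, at the point `x`. -/
def wronskian (u v : ℂ → Fin 2 → ℂ) (x : ℂ) : ℂ :=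
  (!![u x 0, v x 0; u x 1, v x 1] : Matrix (Fin 2) (Fin 2) ℂ).det

/-! ### Turning points, phases, admissible contours -/

def gPlus (A S : ℂ → ℂ) (lam x : ℂ) : ℂ := -(lam + deriv S x / 2 + I * A x)

def gMinus (A S : ℂ → ℂ) (lam x : ℂ) : ℂ := lam + deriv S x / 2 - I * A x

/-- `V₀ = g₋ g₊ = -(lam + S' / 2)² - A²`. -/
def V0 (A S : ℂ → ℂ) (lam x : ℂ) : ℂ := -(lam + deriv S x / 2) ^ 2 - A x ^ 2

theorem V0_eq (A S : ℂ → ℂ) (lam x : ℂ) :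
    V0 A S lam x = gMinus A S lam x * gPlus A S lam x := by
  unfold V0 gMinus gPlus
  linear_combination (-(A x) ^ 2) * I_sq

/-- `p` is a simple turning point, i.e. a simple zero of `V`. -/
def IsSimpleTurningPoint (V : ℂ → ℂ) (p : ℂ) : Prop := V p = 0 ∧ deriv V p ≠ 0

/-- `ζ` is the function `z = i ∫ √(-V)` along the path `γ`, up to an additive constant and with some
branch of the root: a continuous function of the parameter that, away from the zeros of `V`, is
locally of the form `F ∘ γ` with `F` holomorphic and `(F')² = V`. -/
def IsPhaseAlong (V : ℂ → ℂ) (γ : ℝ → ℂ) (J : Set ℝ) (ζ : ℝ → ℂ) : Prop :=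
  ContinuousOn ζ J ∧ ∀ t ∈ J, V (γ t) ≠ 0 →
    ∃ F : ℂ → ℂ, AnalyticAt ℂ F (γ t) ∧ (∀ᶠ x in 𝓝 (γ t), deriv F x ^ 2 = V x) ∧
      ∀ᶠ s in 𝓝[J] t, ζ s = F (γ s)

/-- A progressive path: it meets no turning point, and `Re z` is strictly monotone along it. -/
def IsProgressive (V : ℂ → ℂ) (γ : ℝ → ℂ) (J : Set ℝ) : Prop :=
  (∀ t ∈ J, V (γ t) ≠ 0) ∧ ∃ ζ : ℝ → ℂ, IsPhaseAlong V γ J ζ ∧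
    (StrictMonoOn (fun t => (ζ t).re) J ∨ StrictAntiOn (fun t => (ζ t).re) J)

/-- A path along which `Re z` (normalised to vanish at the initial point) vanishes identically. -/
def IsStokesLine (V : ℂ → ℂ) (γ : ℝ → ℂ) (J : Set ℝ) : Prop :=
  ∃ ζ : ℝ → ℂ, IsPhaseAlong V γ J ζ ∧ ∀ t ∈ J, (ζ t).re = 0

/-- `c : ℝ → ℂ` parametrises an admissible contour `C = C⁻ ∪ C⁰ ∪ C⁺` for `lam`, where `C⁻`, `C⁰`,
`C⁺` are the parts with parameters `t < a`, `a ≤ t ≤ b`, `b < t`, and `x₋ = c a`, `x₊ = c b`. As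
`Ω` is simply connected, `V₀` is holomorphic in the region enclosed by `C` and the real axis. -/
structure IsAdmissibleContour (A S : ℂ → ℂ) (Ω : Set ℂ) (lam : ℂ) (c : ℝ → ℂ) (a b : ℝ) :
    Prop where
  lt : a < b
  continuous : Continuous c
  injective : Function.Injective c
  mem : ∀ t, c t ∈ Ω
  turning_left : IsSimpleTurningPoint (V0 A S lam) (c a)
  turning_right : IsSimpleTurningPoint (V0 A S lam) (c b)
  progressive_left : IsProgressive (V0 A S lam) c (Iio a)
  progressive_right : IsProgressive (V0 A S lam) c (Ioi b)
  stokes : IsStokesLine (V0 A S lam) c (Icc a b)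
  real_left : ∀ᶠ t in atBot, c t = t
  real_right : ∀ᶠ t in atTop, c t = t

/-! ### Exact WKB solutions -/

/-- The superscript `±` of a WKB solution. -/
inductive WKBSign
  | plus
  | minus

/-- The sign as a number. -/
def WKBSign.val : WKBSign → ℂ
  | .plus => 1
  | .minus => -1

/-- The matrix `!![0, 1; 1, 0]` to the power `(1 ± 1) / 2`. -/
def WKBSign.swap : WKBSign → Matrix (Fin 2) (Fin 2) ℂ
  | .plus => !![0, 1; 1, 0]
  | .minus => 1

/-- The operator `f ↦ ∫ e^{± 2 (ζ - z) / ε} ℋ f dζ`, written in the variable `x` (where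
`ℋ dζ = d log H`) and along the segment from `x₀` to `x`. -/
def opI (z H : ℂ → ℂ) (σ : WKBSign) (ε : ℝ) (x₀ : ℂ) (f : ℂ → ℂ) (x : ℂ) : ℂ :=
  ∫ s in (0 : ℝ)..1,
    exp (σ.val * 2 * (z (x₀ + s * (x - x₀)) - z x) / ε) *
      logDeriv H (x₀ + s * (x - x₀)) * f (x₀ + s * (x - x₀)) * (x - x₀)

/-- The operator `f ↦ ∫ ℋ f dζ`, along the segment from `x₀` to `x`. -/
def opJ (H : ℂ → ℂ) (x₀ : ℂ) (f : ℂ → ℂ) (x : ℂ) : ℂ :=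
  ∫ s in (0 : ℝ)..1,
    logDeriv H (x₀ + s * (x - x₀)) * f (x₀ + s * (x - x₀)) * (x - x₀)

/-- The terms `w₀ = 1`, `w₂ₙ₊₁ = I[w₂ₙ]`, `w₂ₙ₊₂ = J[w₂ₙ₊₁]` of the symbol with base point `x₀`, as
functions of `x` near `x₀`. -/
def symbolTerm (z H : ℂ → ℂ) (σ : WKBSign) (ε : ℝ) (x₀ : ℂ) : ℕ → ℂ → ℂ
  | 0 => fun _ => 1
  | n + 1 =>
      if Even n then opI z H σ ε x₀ (symbolTerm z H σ ε x₀ n)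
      else opJ H x₀ (symbolTerm z H σ ε x₀ n)

def wEven (z H : ℂ → ℂ) (σ : WKBSign) (ε : ℝ) (x₀ x : ℂ) : ℂ :=
  ∑' n : ℕ, symbolTerm z H σ ε x₀ (2 * n) x

def wOdd (z H : ℂ → ℂ) (σ : WKBSign) (ε : ℝ) (x₀ x : ℂ) : ℂ :=
  ∑' n : ℕ, symbolTerm z H σ ε x₀ (2 * n + 1) x

/-- The matrix `Q(x, lam, ε)`. -/
def matrixQ (S H : ℂ → ℂ) (ε : ℝ) (x : ℂ) : Matrix (Fin 2) (Fin 2) ℂ :=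
  !![exp (I * S x / (2 * ε)), 0; 0, exp (-I * S x / (2 * ε))] *
    !![1, 1; -1, 1] * !![(H x)⁻¹, (H x)⁻¹; I * H x, -I * H x]

/-- The vector `e^{± z(x) / ε} Q(x) [0 1; 1 0]^{(1 ± 1) / 2} (we, wo)ᵀ`. -/
def wkbVector (S z H : ℂ → ℂ) (σ : WKBSign) (ε : ℝ) (we wo x : ℂ) : Fin 2 → ℂ :=
  exp (σ.val * z x / ε) • ((matrixQ S H ε x * σ.swap) *ᵥ ![we, wo])

/-- `u` is the exact WKB solution `u^±` with phase `z` and symbol base point `x₀`, continued to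
`Ω` as a solution of the system. -/
def IsExactWKB (A S : ℂ → ℂ) (Ω : Set ℂ) (ε : ℝ) (lam : ℂ) (z H : ℂ → ℂ) (σ : WKBSign) (x₀ : ℂ)
    (u : ℂ → Fin 2 → ℂ) : Prop :=
  IsSolution A S Ω ε lam u ∧
    ∀ᶠ x in 𝓝 x₀, u x = wkbVector S z H σ ε (wEven z H σ ε x₀ x) (wOdd z H σ ε x₀ x) x

/-- `u` is the exact WKB solution `u^±` with phase `z` whose symbol has its base point at the end
`l` (`atBot` or `atTop`) of the real axis: its symbol `(w_even, w_odd)` tends to `(1, 0)` there. -/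
def IsExactWKBAtInfinity (A S : ℂ → ℂ) (Ω : Set ℂ) (ε : ℝ) (lam : ℂ) (z H : ℂ → ℂ) (σ : WKBSign)
    (l : Filter ℝ) (u : ℂ → Fin 2 → ℂ) : Prop :=
  IsSolution A S Ω ε lam u ∧
    ∃ we wo : ℝ → ℂ, Tendsto we l (𝓝 1) ∧ Tendsto wo l (𝓝 0) ∧
      ∀ᶠ x : ℝ in l, u x = wkbVector S z H σ ε (we x) (wo x) x

/-! ### The cut neighbourhood of the contour, and the phase on it -/

/-- The open set `W`, cut along the segments from `p` to `p + k` and from `q` to `q + l`. -/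
def cutDomain (W : Set ℂ) (p k q l : ℂ) : Set ℂ := W \ (segment ℝ p (p + k) ∪ segment ℝ q (q + l))

/-- `z` is a branch of `z(x, lam, α) = i ∫_α^x √(-V₀)` on the domain `D`, which contains no turning
point and has the turning point `α` on its boundary. -/
structure IsPhase (A S : ℂ → ℂ) (lam : ℂ) (D : Set ℂ) (α : ℂ) (z : ℂ → ℂ) : Prop where
  ne_zero : ∀ x ∈ D, V0 A S lam x ≠ 0
  holo : DifferentiableOn ℂ z D
  deriv_sq : ∀ x ∈ D, deriv z x ^ 2 = V0 A S lam x
  base : Tendsto z (𝓝[D] α) (𝓝 0)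

/-- `H` is the branch of `(g₋ / g₊)^{1/4}` on `D` that belongs to the phase `z`. -/
structure IsAmplitude (A S : ℂ → ℂ) (lam : ℂ) (D : Set ℂ) (z H : ℂ → ℂ) : Prop where
  holo : DifferentiableOn ℂ H D
  pow_four : ∀ x ∈ D, H x ^ 4 = gMinus A S lam x / gPlus A S lam x
  sq : ∀ x ∈ D, H x ^ 2 = deriv z x / gPlus A S lam x

/-- The geometric data of the exact WKB method near an admissible contour at `lam₀`.

* `α`, `β` are the continuations of the turning points `c a`, `c b` to `lam` near `lam₀`.
* `W` is a neighbourhood of the contour, `dα`, `dβ` are the directions in which `C⁰` leaves `c a`,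
  `c b`. The Stokes lines leave `c a` in the directions `dα e^{2πij/3}`. `C⁻` leaves `c a` through
  the sector not adjacent to `C⁰`, given by `Re (x - c a) / dα < - |x - c a| / 2` to first
  order; similarly for `C⁺`.
* A branch cut leaves `α` between `C⁰` and the Stokes line that follows `C⁰` in the anti-clockwise
  sense around `α` (so on the left of `C`), and ends outside `W`; a second one leaves `β` between
  `C⁰` and the Stokes line that follows `C⁰` in the anti-clockwise sense around `β` (so on the right
  of `C`). Both cuts may be tangent to that Stokes line.
* `z lam` is the phase `z(·, lam, α)` on the cut neighbourhood, `τ lam` is the action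
  `z(β, lam, α)`, and the branch is such that `Re z → -∞` at the left end of the real axis, i.e.
  `Re z` increases along `C⁻` towards `α`. -/
structure IsWKBFrame (A S : ℂ → ℂ) (Ω : Set ℂ) (lam₀ : ℂ) (c : ℝ → ℂ) (a b : ℝ)
    (α β : ℂ → ℂ) (W : Set ℂ) (dα dβ kα kβ : ℂ) (z H : ℂ → ℂ → ℂ) (τ : ℂ → ℂ) : Prop where
  α_cont : ContinuousAt α lam₀
  β_cont : ContinuousAt β lam₀
  α_base : α lam₀ = c a
  β_base : β lam₀ = c b
  α_turning : ∀ᶠ lam in 𝓝 lam₀, V0 A S lam (α lam) = 0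
  β_turning : ∀ᶠ lam in 𝓝 lam₀, V0 A S lam (β lam) = 0
  isOpen : IsOpen W
  subset : W ⊆ Ω
  contour_mem : ∀ t, c t ∈ W
  tangent_left : Tendsto (fun t => (c t - c a) / (‖c t - c a‖ : ℂ)) (𝓝[>] a) (𝓝 dα)
  tangent_right : Tendsto (fun t => (c t - c b) / (‖c t - c b‖ : ℂ)) (𝓝[<] b) (𝓝 dβ)
  sector_left : ∃ κ : ℝ, 1 / 2 < κ ∧
    ∀ᶠ t in 𝓝[<] a, ((c t - c a) / dα).re ≤ -κ * ‖c t - c a‖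
  sector_right : ∃ κ : ℝ, 1 / 2 < κ ∧
    ∀ᶠ t in 𝓝[>] b, ((c t - c b) / dβ).re ≤ -κ * ‖c t - c b‖
  cut_left : ∃ r θ : ℝ, 0 < r ∧ 0 < θ ∧ θ ≤ 2 * Real.pi / 3 ∧ kα = r * dα * exp (I * θ)
  cut_right : ∃ r θ : ℝ, 0 < r ∧ 0 < θ ∧ θ ≤ 2 * Real.pi / 3 ∧ kβ = r * dβ * exp (I * θ)
  cut_left_end : c a + kα ∉ closure W
  cut_right_end : c b + kβ ∉ closure W
  cut_disjoint : Disjoint (segment ℝ (c a) (c a + kα)) (segment ℝ (c b) (c b + kβ))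
  contour_cut : ∀ t, t ≠ a → t ≠ b → c t ∈ cutDomain W (c a) kα (c b) kβ
  connected : ∀ᶠ lam in 𝓝 lam₀, IsPreconnected (cutDomain W (α lam) kα (β lam) kβ)
  phase : ∀ᶠ lam in 𝓝 lam₀,
    IsPhase A S lam (cutDomain W (α lam) kα (β lam) kβ) (α lam) (z lam)
  phase_branch : ∀ᶠ lam in 𝓝 lam₀, Tendsto (fun x : ℝ => (z lam x).re) atBot atBot
  amplitude : ∀ᶠ lam in 𝓝 lam₀,
    IsAmplitude A S lam (cutDomain W (α lam) kα (β lam) kβ) (z lam) (H lam)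
  action : ∀ᶠ lam in 𝓝 lam₀,
    Tendsto (z lam) (𝓝[cutDomain W (α lam) kα (β lam) kβ] (β lam)) (𝓝 (τ lam))

/-- The points of `D` on the side `Re z < 0` of the arc `Γ` from which there is a path in `D` to a
point of `Γ` along which `Re z` is strictly increasing. For `Γ = C⁰` this is `ω_up`. -/
def upRegion (D : Set ℂ) (z : ℂ → ℂ) (Γ : Set ℂ) : Set ℂ :=
  {x | ∃ γ : ℝ → ℂ, ContinuousOn γ (Icc 0 1) ∧ (∀ s ∈ Icc (0 : ℝ) 1, γ s ∈ D) ∧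
    γ 0 = x ∧ γ 1 ∈ Γ ∧ StrictMonoOn (fun s => (z (γ s)).re) (Icc 0 1)}

/-- The points of `D` from which there is a path in `D` to a point of `Γ` along which `Re z` is
strictly decreasing. For `Γ = C⁰` this is `ω_down`. -/
def downRegion (D : Set ℂ) (z : ℂ → ℂ) (Γ : Set ℂ) : Set ℂ :=
  {x | ∃ γ : ℝ → ℂ, ContinuousOn γ (Icc 0 1) ∧ (∀ s ∈ Icc (0 : ℝ) 1, γ s ∈ D) ∧
    γ 0 = x ∧ γ 1 ∈ Γ ∧ StrictAntiOn (fun s => (z (γ s)).re) (Icc 0 1)}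

open Classical in
/-- The index `δ(p, q)` of two simple turning points: `-1` if the same function among `g₊`, `g₋`
vanishes at both, and `1` otherwise. -/
def deltaIndex (A S : ℂ → ℂ) (lam p q : ℂ) : ℂ :=
  if (gPlus A S lam p = 0 ∧ gPlus A S lam q = 0) ∨ (gMinus A S lam p = 0 ∧ gMinus A S lam q = 0)
  then -1 else 1

/-- The ratio `m` of Wronskians, evaluated at `x`. -/
def wronskianRatio (u₀α u₁α u₂α u₀β u₁β u₂β : ℂ → Fin 2 → ℂ) (x : ℂ) : ℂ :=
  (wronskian u₀α u₁α x * wronskian u₂β u₀β x) / (wronskian u₂α u₀α x * wronskian u₀β u₁β x)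

end

end ZakharovShabat

/-!
The proof is the exact WKB method, with asymptotics that are uniform in the spectral parameter.

*Progressive paths.* Every solution `u` of the system has at a point `x` a symbol, with an even and
an odd part, with respect to a branch of the phase `z` and of the amplitude `H`. In the coordinate
`z` the symbol satisfies a first order system whose coefficients are `H' / H` and in which the odd
part is damped at the rate `2 / ε` when `Re z` increases. So if the even part dominates at one point
of a progressive path, then further along the even part changes only by a relative error `O(ε)`
and the odd part is `O(ε)` times the even part (`symbol_estimate`, `Leads`). No oscillatory integral
occurs, and a merely continuous path may be replaced by a polygon in the coordinate `z`
(`IsFamily.leads_of_strictMonoOn`).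

*Infinity.* Far to the left on the real axis the decaying solution `u₀` is dominated by its even
symbol for all `ε` at once: the coefficients tend to zero there while `z'` tends to a square root
of `-lam²` (`IncreasesAtBot.exactWKB`). It is square integrable, and an eigenfunction is
proportional to the decaying solutions at both ends, so eigenvalues are zeros of the
Wronskian `𝒲[u₀^α, u₀^β]` (`isEigenvalue_iff_wronskian`).

*Turning points.* Near a simple turning point `p` the phase is an odd function of `√(x - p)`, with a
leading term `(x - p)^{3/2}`, and the amplitude is `(x - p)^{∓1/4}` times a function without zeros,
according to whether `g₊` or `g₋` vanishes. Moving the cut shows that the path that comes in through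
the sector opposite to `C⁰` leads to both sides of `C⁰`, on one of them with the given branches, on
the other one with `-z` and `± I H` (`IsTurningFamily.crossing`). The sign of this factor is
what becomes the index `δ`.

*Wronskians.* The Wronskian with an exact WKB solution is, at its base point, a multiple of an
even symbol. Hence `𝒲[u₀, u₁] / 𝒲[u₂, u₀] = ± I (1 + O(ε))` at the left turning point
(`IsLeftFrame.connection`), and the reflection `x ↦ -x` gives the same at the right one. The product
of both quotients is `m`. The two sets of solutions `u₁`, `u₂` differ by the factors
`exp (± z(β, lam, α) / ε)`, so that the Plücker relation turns `𝒲[u₀^α, u₀^β] = 0` into the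
quantization condition (`wronskianRatio_mul_exp_eq_one_iff`).
-/
open Set Filter Topology MeasureTheory Complex
open scoped Matrix

namespace ZakharovShabat

/-! ### Solutions and Wronskians -/

theorem IsSolution.hasDerivAt_zero {A S : ℂ → ℂ} {Ω : Set ℂ} {ε : ℝ} {lam : ℂ}
    {u : ℂ → Fin 2 → ℂ} (hu : IsSolution A S Ω ε lam u) (hΩ : IsOpen Ω) (hε : ε ≠ 0)
    {x : ℂ} (hx : x ∈ Ω) :
    HasDerivAt (fun y => u y 0) (I / ε * (-lam * u x 0 + potential A S ε x * u x 1)) x := by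
  have h1 := (hu.1.differentiableAt (hΩ.mem_nhds hx)).hasDerivAt
  have h2 := hasDerivAt_pi.1 h1 0
  have h3 := congrFun (hu.2 x hx) 0
  have hε' : (ε : ℂ) ≠ 0 := by exact_mod_cast hε
  refine h2.congr_deriv ?_
  simp only [systemMatrix, Matrix.mulVec, dotProduct, Fin.sum_univ_two, Pi.smul_apply,
    smul_eq_mul, Matrix.of_apply, Matrix.cons_val_zero, Matrix.cons_val_one] at h3
  rw [← h3]
  field_simp

theorem IsSolution.hasDerivAt_one {A S : ℂ → ℂ} {Ω : Set ℂ} {ε : ℝ} {lam : ℂ}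
    {u : ℂ → Fin 2 → ℂ} (hu : IsSolution A S Ω ε lam u) (hΩ : IsOpen Ω) (hε : ε ≠ 0)
    {x : ℂ} (hx : x ∈ Ω) :
    HasDerivAt (fun y => u y 1) (I / ε * (potentialConj A S ε x * u x 0 + lam * u x 1)) x := by
  have h1 := (hu.1.differentiableAt (hΩ.mem_nhds hx)).hasDerivAt
  have h2 := hasDerivAt_pi.1 h1 1
  have h3 := congrFun (hu.2 x hx) 1
  have hε' : (ε : ℂ) ≠ 0 := by exact_mod_cast hε
  refine h2.congr_deriv ?_
  simp only [systemMatrix, Matrix.mulVec, dotProduct, Fin.sum_univ_two, Pi.smul_apply,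
    smul_eq_mul, Matrix.of_apply, Matrix.cons_val_zero, Matrix.cons_val_one] at h3
  rw [← h3]
  field_simp

theorem wronskian_apply (u v : ℂ → Fin 2 → ℂ) (x : ℂ) :
    wronskian u v x = u x 0 * v x 1 - v x 0 * u x 1 := by
  simp [wronskian, Matrix.det_fin_two]

theorem wronskian_swap (u v : ℂ → Fin 2 → ℂ) (x : ℂ) :
    wronskian u v x = -wronskian v u x := by
  simp only [wronskian_apply]; ring

/-- The system has trace zero, so the Wronskian of two solutions does not depend on the point. -/
theorem IsSolution.wronskian_eq {A S : ℂ → ℂ} {Ω : Set ℂ} {ε : ℝ} {lam : ℂ}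
    {u v : ℂ → Fin 2 → ℂ} (hu : IsSolution A S Ω ε lam u) (hv : IsSolution A S Ω ε lam v)
    (hΩ : IsOpen Ω) (hΩ' : IsPreconnected Ω) (hε : ε ≠ 0) {x y : ℂ} (hx : x ∈ Ω) (hy : y ∈ Ω) :
    wronskian u v x = wronskian u v y := by
  have key : ∀ x ∈ Ω, HasDerivAt (wronskian u v) 0 x := by
    intro x hx
    have h := ((hu.hasDerivAt_zero hΩ hε hx).mul (hv.hasDerivAt_one hΩ hε hx)).sub
      ((hv.hasDerivAt_zero hΩ hε hx).mul (hu.hasDerivAt_one hΩ hε hx))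
    rw [show wronskian u v = _ from funext (wronskian_apply u v)]
    exact h.congr_deriv (by ring)
  exact hΩ.is_const_of_deriv_eq_zero hΩ'
    (fun x hx => (key x hx).differentiableAt.differentiableWithinAt)
    (fun x hx => (key x hx).deriv) hx hy

theorem IsPotential.isPreconnected {A S : ℂ → ℂ} {Ω : Set ℂ} (h : IsPotential A S Ω) :
    IsPreconnected Ω := by
  have := h.simplyConnected
  exact isPreconnected_iff_preconnectedSpace.2 inferInstance

/-! ### Frames and symbols -/

/-- A branch `z` of the phase together with the matching branch `H` of the amplitude, on an open set
`D` without turning points. -/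
structure IsFrame (A S : ℂ → ℂ) (Ω : Set ℂ) (lam : ℂ) (D : Set ℂ) (z H : ℂ → ℂ) : Prop where
  isOpen : IsOpen D
  subset : D ⊆ Ω
  ne_zero : ∀ x ∈ D, V0 A S lam x ≠ 0
  holo_z : DifferentiableOn ℂ z D
  holo_H : DifferentiableOn ℂ H D
  pow_four : ∀ x ∈ D, H x ^ 4 = gMinus A S lam x / gPlus A S lam x
  sq : ∀ x ∈ D, H x ^ 2 = deriv z x / gPlus A S lam x

namespace IsFrame

variable {A S : ℂ → ℂ} {Ω : Set ℂ} {lam : ℂ} {D : Set ℂ} {z H : ℂ → ℂ}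

theorem gPlus_ne (h : IsFrame A S Ω lam D z H) {x : ℂ} (hx : x ∈ D) : gPlus A S lam x ≠ 0 := by
  intro h0
  exact h.ne_zero x hx (by rw [V0_eq, h0, mul_zero])

theorem gMinus_ne (h : IsFrame A S Ω lam D z H) {x : ℂ} (hx : x ∈ D) : gMinus A S lam x ≠ 0 := by
  intro h0
  exact h.ne_zero x hx (by rw [V0_eq, h0, zero_mul])

theorem H_ne (h : IsFrame A S Ω lam D z H) {x : ℂ} (hx : x ∈ D) : H x ≠ 0 := by
  intro h0
  have := h.pow_four x hx
  rw [h0] at this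
  exact div_ne_zero (h.gMinus_ne hx) (h.gPlus_ne hx) (by simpa using this.symm)

theorem gPlus_eq (h : IsFrame A S Ω lam D z H) {x : ℂ} (hx : x ∈ D) :
    gPlus A S lam x = deriv z x / H x ^ 2 := by
  have h1 := h.sq x hx
  have h2 := h.gPlus_ne hx
  have h3 := h.H_ne hx
  rw [eq_div_iff h2] at h1
  rw [eq_div_iff (pow_ne_zero 2 h3), ← h1]; ring

theorem gMinus_eq (h : IsFrame A S Ω lam D z H) {x : ℂ} (hx : x ∈ D) :
    gMinus A S lam x = deriv z x * H x ^ 2 := by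
  have h1 := h.pow_four x hx
  have h2 := h.gPlus_ne hx
  have h3 := h.H_ne hx
  have h4 := h.gPlus_eq hx
  rw [eq_div_iff h2, h4] at h1
  rw [← h1]; field_simp

theorem deriv_sq (h : IsFrame A S Ω lam D z H) {x : ℂ} (hx : x ∈ D) :
    deriv z x ^ 2 = V0 A S lam x := by
  have h3 := h.H_ne hx
  rw [V0_eq, h.gPlus_eq hx, h.gMinus_eq hx]; field_simp

theorem deriv_ne (h : IsFrame A S Ω lam D z H) {x : ℂ} (hx : x ∈ D) : deriv z x ≠ 0 := by
  intro h0
  apply h.ne_zero x hx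
  rw [← h.deriv_sq hx, h0]; simp

theorem hasDerivAt_z (h : IsFrame A S Ω lam D z H) {x : ℂ} (hx : x ∈ D) :
    HasDerivAt z (deriv z x) x :=
  (h.holo_z.differentiableAt (h.isOpen.mem_nhds hx)).hasDerivAt

theorem hasDerivAt_H (h : IsFrame A S Ω lam D z H) {x : ℂ} (hx : x ∈ D) :
    HasDerivAt H (deriv H x) x :=
  (h.holo_H.differentiableAt (h.isOpen.mem_nhds hx)).hasDerivAt

/-- On the other sheet of the square root `z'`, the amplitude is multiplied by a primitive fourth
root of unity. -/
theorem opposite (h : IsFrame A S Ω lam D z H) {s : ℂ} (hs : s ^ 2 = -1) :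
    IsFrame A S Ω lam D (fun x => -z x) (fun x => s * H x) where
  isOpen := h.isOpen
  subset := h.subset
  ne_zero := h.ne_zero
  holo_z := h.holo_z.neg
  holo_H := h.holo_H.const_mul s
  pow_four x hx := by
    rw [← h.pow_four x hx]; linear_combination (H x) ^ 4 * (s ^ 2 - 1) * hs
  sq x hx := by
    rw [deriv.fun_neg, neg_div, ← h.sq x hx]; linear_combination (H x) ^ 2 * hs

end IsFrame

/-- The first component of `u` in the basis that brings the system to off-diagonal form. -/
noncomputable def mixedFst (S : ℂ → ℂ) (ε : ℝ) (u : ℂ → Fin 2 → ℂ) (x : ℂ) : ℂ :=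
  (exp (-I * S x / (2 * ε)) * u x 0 - exp (I * S x / (2 * ε)) * u x 1) / 2

/-- The second component of `u` in the basis that brings the system to off-diagonal form. -/
noncomputable def mixedSnd (S : ℂ → ℂ) (ε : ℝ) (u : ℂ → Fin 2 → ℂ) (x : ℂ) : ℂ :=
  (exp (-I * S x / (2 * ε)) * u x 0 + exp (I * S x / (2 * ε)) * u x 1) / 2

/-- The even symbol of `u` at `x`, where `u` is written as a WKB vector with superscript `+`. -/
noncomputable def symbolEven (S z H : ℂ → ℂ) (ε : ℝ) (u : ℂ → Fin 2 → ℂ) (x : ℂ) : ℂ :=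
  exp (-z x / ε) * ((H x * mixedFst S ε u x + I * mixedSnd S ε u x / H x) / 2)

/-- The odd symbol of `u` at `x`, where `u` is written as a WKB vector with superscript `+`. -/
noncomputable def symbolOdd (S z H : ℂ → ℂ) (ε : ℝ) (u : ℂ → Fin 2 → ℂ) (x : ℂ) : ℂ :=
  exp (-z x / ε) * ((H x * mixedFst S ε u x - I * mixedSnd S ε u x / H x) / 2)

section
variable {A S : ℂ → ℂ} {Ω : Set ℂ} {lam : ℂ} {ε : ℝ} {u : ℂ → Fin 2 → ℂ}

theorem potential_mul (A S : ℂ → ℂ) (ε : ℝ) (x : ℂ) :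
    exp (-I * S x / (2 * ε)) * potential A S ε x = -I * A x * exp (I * S x / (2 * ε)) := by
  have : exp (I * S x / (2 * ε)) = exp (-I * S x / (2 * ε)) * exp (I * S x / ε) := by
    rw [← Complex.exp_add]; congr 1
    by_cases h : (ε : ℂ) = 0
    · simp [h]
    · field_simp; ring
  rw [this, potential]; ring

theorem potentialConj_mul (A S : ℂ → ℂ) (ε : ℝ) (x : ℂ) :
    exp (I * S x / (2 * ε)) * potentialConj A S ε x = I * A x * exp (-I * S x / (2 * ε)) := by
  have : exp (-I * S x / (2 * ε)) = exp (I * S x / (2 * ε)) * exp (-I * S x / ε) := by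
    rw [← Complex.exp_add]; congr 1
    by_cases h : (ε : ℂ) = 0
    · simp [h]
    · field_simp; ring
  rw [this, potentialConj]; ring

/-- The exponentials of the potential are cancelled by those in `mixedFst` and `mixedSnd`, and the
system becomes off-diagonal with the entries `g₊` and `-g₋`. -/
theorem IsSolution.hasDerivAt_mixedFst (hu : IsSolution A S Ω ε lam u) (hΩ : IsOpen Ω)
    (hS : DifferentiableOn ℂ S Ω) (hε : ε ≠ 0) {x : ℂ} (hx : x ∈ Ω) :
    HasDerivAt (mixedFst S ε u) (I / ε * gPlus A S lam x * mixedSnd S ε u x) x := by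
  have hS' := (hS.differentiableAt (hΩ.mem_nhds hx)).hasDerivAt
  have e1 := ((hS'.const_mul (-I)).div_const (2 * (ε : ℂ))).cexp
  have e2 := ((hS'.const_mul I).div_const (2 * (ε : ℂ))).cexp
  have h := ((e1.mul (hu.hasDerivAt_zero hΩ hε hx)).sub
    (e2.mul (hu.hasDerivAt_one hΩ hε hx))).div_const 2
  have hε' : (ε : ℂ) ≠ 0 := by exact_mod_cast hε
  have p1 := potential_mul A S ε x
  have p2 := potentialConj_mul A S ε x
  refine h.congr_deriv ?_
  unfold gPlus mixedSnd
  linear_combination (I / ε / 2 * u x 1) * p1 - (I / ε / 2 * u x 0) * p2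

theorem IsSolution.hasDerivAt_mixedSnd (hu : IsSolution A S Ω ε lam u) (hΩ : IsOpen Ω)
    (hS : DifferentiableOn ℂ S Ω) (hε : ε ≠ 0) {x : ℂ} (hx : x ∈ Ω) :
    HasDerivAt (mixedSnd S ε u) (-(I / ε * gMinus A S lam x * mixedFst S ε u x)) x := by
  have hS' := (hS.differentiableAt (hΩ.mem_nhds hx)).hasDerivAt
  have e1 := ((hS'.const_mul (-I)).div_const (2 * (ε : ℂ))).cexp
  have e2 := ((hS'.const_mul I).div_const (2 * (ε : ℂ))).cexp
  have h := ((e1.mul (hu.hasDerivAt_zero hΩ hε hx)).add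
    (e2.mul (hu.hasDerivAt_one hΩ hε hx))).div_const 2
  have hε' : (ε : ℂ) ≠ 0 := by exact_mod_cast hε
  have p1 := potential_mul A S ε x
  have p2 := potentialConj_mul A S ε x
  refine h.congr_deriv ?_
  unfold gMinus mixedFst
  linear_combination (I / ε / 2 * u x 1) * p1 + (I / ε / 2 * u x 0) * p2

variable {D : Set ℂ} {z H : ℂ → ℂ}

theorem IsFrame.hasDerivAt_symbolEven (h : IsFrame A S Ω lam D z H)
    (hu : IsSolution A S Ω ε lam u) (hΩ : IsOpen Ω)
    (hS : DifferentiableOn ℂ S Ω) (hε : ε ≠ 0) {x : ℂ} (hx : x ∈ D) :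
    HasDerivAt (symbolEven S z H ε u) (logDeriv H x * symbolOdd S z H ε u x) x := by
  have hε' : (ε : ℂ) ≠ 0 := by exact_mod_cast hε
  have hH := h.H_ne hx
  have d := (((h.hasDerivAt_z hx).neg.div_const (ε : ℂ)).cexp).mul
    ((((h.hasDerivAt_H hx).mul (hu.hasDerivAt_mixedFst hΩ hS hε (h.subset hx))).add
      (((hu.hasDerivAt_mixedSnd hΩ hS hε (h.subset hx)).const_mul I).div
        (h.hasDerivAt_H hx) hH)).div_const 2)
  refine d.congr_deriv ?_
  rw [h.gPlus_eq hx, h.gMinus_eq hx]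
  simp only [symbolOdd, logDeriv_apply, Pi.add_apply, Pi.mul_apply, Pi.div_apply, Pi.neg_apply]
  have hI : I ^ 2 = -1 := I_sq
  field_simp
  ring_nf
  simp only [hI]
  ring

theorem IsFrame.hasDerivAt_symbolOdd (h : IsFrame A S Ω lam D z H)
    (hu : IsSolution A S Ω ε lam u) (hΩ : IsOpen Ω)
    (hS : DifferentiableOn ℂ S Ω) (hε : ε ≠ 0) {x : ℂ} (hx : x ∈ D) :
    HasDerivAt (symbolOdd S z H ε u)
      (-(2 * deriv z x / ε) * symbolOdd S z H ε u x + logDeriv H x * symbolEven S z H ε u x) x := by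
  have hε' : (ε : ℂ) ≠ 0 := by exact_mod_cast hε
  have hH := h.H_ne hx
  have d := (((h.hasDerivAt_z hx).neg.div_const (ε : ℂ)).cexp).mul
    ((((h.hasDerivAt_H hx).mul (hu.hasDerivAt_mixedFst hΩ hS hε (h.subset hx))).sub
      (((hu.hasDerivAt_mixedSnd hΩ hS hε (h.subset hx)).const_mul I).div
        (h.hasDerivAt_H hx) hH)).div_const 2)
  refine d.congr_deriv ?_
  rw [h.gPlus_eq hx, h.gMinus_eq hx]
  simp only [symbolOdd, symbolEven, logDeriv_apply, Pi.sub_apply, Pi.mul_apply, Pi.div_apply,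
    Pi.neg_apply]
  have hI : I ^ 2 = -1 := I_sq
  field_simp
  ring_nf
  simp only [hI]
  ring

theorem exp_mul_exp_neg_half (S : ℂ → ℂ) (ε : ℝ) (x : ℂ) :
    exp (I * S x / (2 * ε)) * exp (-I * S x / (2 * ε)) = 1 := by
  rw [← Complex.exp_add, neg_mul, neg_div, add_neg_cancel, Complex.exp_zero]

theorem matrixQ_mulVec (S H : ℂ → ℂ) (ε : ℝ) (x p q : ℂ) :
    matrixQ S H ε x *ᵥ ![p, q] =
      ![exp (I * S x / (2 * ε)) * ((H x)⁻¹ * (p + q) + I * H x * (p - q)),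
        exp (-I * S x / (2 * ε)) * (-((H x)⁻¹ * (p + q)) + I * H x * (p - q))] := by
  ext i
  fin_cases i <;>
    simp [matrixQ, Matrix.mulVec, dotProduct, Fin.sum_univ_two, Matrix.mul_apply] <;> ring

theorem symbol_of_eq_wkbVector {S z H : ℂ → ℂ} {ε : ℝ} {u : ℂ → Fin 2 → ℂ} {x we wo : ℂ}
    (hH : H x ≠ 0) (hu : u x = wkbVector S z H .plus ε we wo x) :
    symbolEven S z H ε u x = we ∧ symbolOdd S z H ε u x = wo := by
  have h1 : exp (z x / ε) * exp (-z x / ε) = 1 := by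
    rw [← Complex.exp_add, neg_div, add_neg_cancel, Complex.exp_zero]
  have h2 := exp_mul_exp_neg_half S ε x
  have hI : I ^ 2 = -1 := I_sq
  have key : (matrixQ S H ε x * WKBSign.plus.swap) *ᵥ ![we, wo] =
      matrixQ S H ε x *ᵥ ![wo, we] := by
    rw [← Matrix.mulVec_mulVec]
    congr 1
    ext i; fin_cases i <;> simp [WKBSign.swap, Matrix.mulVec, dotProduct, Fin.sum_univ_two]
  rw [wkbVector, key, matrixQ_mulVec] at hu
  have u0 := congrFun hu 0
  have u1 := congrFun hu 1
  simp only [WKBSign.val, one_mul, Pi.smul_apply, smul_eq_mul, Matrix.cons_val_zero,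
    Matrix.cons_val_one] at u0 u1
  have m1 : mixedFst S ε u x = exp (z x / ε) * ((H x)⁻¹ * (wo + we)) := by
    rw [mixedFst, u0, u1]
    linear_combination exp (z x / ε) * ((H x)⁻¹ * (wo + we)) * h2
  have m2 : mixedSnd S ε u x = exp (z x / ε) * (I * H x * (wo - we)) := by
    rw [mixedSnd, u0, u1]
    linear_combination exp (z x / ε) * (I * H x * (wo - we)) * h2
  have a1 : H x * mixedFst S ε u x = exp (z x / ε) * (wo + we) := by
    rw [m1]; field_simp
  have a2 : I * mixedSnd S ε u x / H x = exp (z x / ε) * (we - wo) := by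
    rw [m2]; field_simp; rw [hI]; ring
  rw [symbolEven, symbolOdd, a1, a2]
  constructor
  · linear_combination we * h1
  · linear_combination wo * h1

/-- At its base point an exact WKB solution with superscript `-` picks out the even symbol. -/
theorem wronskian_of_eq_wkbVector_minus {S z H : ℂ → ℂ} {ε : ℝ} {u v : ℂ → Fin 2 → ℂ} {x : ℂ}
    (hH : H x ≠ 0) (hv : v x = wkbVector S z H .minus ε 1 0 x) :
    wronskian u v x = 4 * I * symbolEven S z H ε u x := by
  have h2 := exp_mul_exp_neg_half S ε x
  have hI : I ^ 2 = -1 := I_sq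
  have key : (matrixQ S H ε x * WKBSign.minus.swap) *ᵥ ![1, 0] =
      matrixQ S H ε x *ᵥ ![1, 0] := by
    simp [WKBSign.swap]
  rw [wkbVector, key, matrixQ_mulVec] at hv
  have v0 := congrFun hv 0
  have v1 := congrFun hv 1
  simp only [WKBSign.val, Pi.smul_apply, smul_eq_mul, Matrix.cons_val_zero,
    Matrix.cons_val_one, neg_one_mul, add_zero, sub_zero, mul_one] at v0 v1
  rw [wronskian_apply, v0, v1, symbolEven, mixedFst, mixedSnd]
  field_simp
  ring_nf
  simp only [hI]
  ring

/-- The Wronskian with a solution of the same superscript, which vanishes to leading order, is read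
off from the symbol on the other sheet. -/
theorem wronskian_of_eq_wkbVector_plus {S z H : ℂ → ℂ} {ε : ℝ} {u v : ℂ → Fin 2 → ℂ} {x s : ℂ}
    (hH : H x ≠ 0) (hs : s ^ 2 = -1) (hv : v x = wkbVector S z H .plus ε 1 0 x) :
    wronskian v u x = -4 * I * s *
      symbolEven S (fun y => -z y) (fun y => s * H y) ε u x := by
  have hI : I ^ 2 = -1 := I_sq
  have hs0 : s ≠ 0 := by rintro rfl; norm_num at hs
  have key : (matrixQ S H ε x * WKBSign.plus.swap) *ᵥ ![1, 0] =
      matrixQ S H ε x *ᵥ ![0, 1] := by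
    rw [← Matrix.mulVec_mulVec]
    congr 1
    ext i; fin_cases i <;> simp [WKBSign.swap, Matrix.mulVec, dotProduct, Fin.sum_univ_two]
  rw [wkbVector, key, matrixQ_mulVec] at hv
  have v0 := congrFun hv 0
  have v1 := congrFun hv 1
  simp only [WKBSign.val, one_mul, Pi.smul_apply, smul_eq_mul, Matrix.cons_val_zero,
    Matrix.cons_val_one, zero_add, zero_sub, mul_one, mul_neg] at v0 v1
  rw [wronskian_apply, v0, v1, symbolEven, mixedFst, mixedSnd]
  field_simp
  ring_nf
  simp only [hI, hs]
  ring

/-- At the base point all integrals in the symbol vanish. -/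
theorem wEven_wOdd_base (z H : ℂ → ℂ) (σ : WKBSign) (ε : ℝ) (x₀ : ℂ) :
    wEven z H σ ε x₀ x₀ = 1 ∧ wOdd z H σ ε x₀ x₀ = 0 := by
  have h : ∀ n, symbolTerm z H σ ε x₀ (n + 1) x₀ = 0 := by
    intro n
    rw [symbolTerm]
    split_ifs <;> simp [opI, opJ]
  constructor
  · rw [wEven, tsum_eq_single 0]
    · simp [symbolTerm]
    · intro n hn
      obtain ⟨m, rfl⟩ := Nat.exists_eq_succ_of_ne_zero hn
      exact h (2 * m + 1)
  · rw [wOdd]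
    simp [h]

theorem IsExactWKB.eq_at_base {A S : ℂ → ℂ} {Ω : Set ℂ} {ε : ℝ} {lam : ℂ} {z H : ℂ → ℂ}
    {σ : WKBSign} {x₀ : ℂ} {u : ℂ → Fin 2 → ℂ} (hu : IsExactWKB A S Ω ε lam z H σ x₀ u) :
    u x₀ = wkbVector S z H σ ε 1 0 x₀ := by
  have h := hu.2.self_of_nhds
  rwa [(wEven_wOdd_base z H σ ε x₀).1, (wEven_wOdd_base z H σ ε x₀).2] at h

end

/-! ### Estimates along progressive paths -/

theorem real_inner_mul_le (a b h : ℂ) {B : ℝ} (hB : ‖h‖ ≤ B) :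
    inner ℝ a (h * b) ≤ B * (‖a‖ * ‖b‖) :=
  calc inner ℝ a (h * b) ≤ ‖a‖ * ‖h * b‖ := real_inner_le_norm _ _
    _ = ‖h‖ * (‖a‖ * ‖b‖) := by rw [norm_mul]; ring
    _ ≤ B * (‖a‖ * ‖b‖) := by gcongr

theorem real_inner_self_mul (a p : ℂ) : inner ℝ a (p * a) = p.re * ‖a‖ ^ 2 := by
  rw [Complex.inner, ← Complex.normSq_eq_norm_sq, Complex.normSq_apply]
  simp; ring

theorem le_of_hasDerivAt_nonpos {f f' : ℝ → ℝ} {s t : ℝ} (hst : s ≤ t)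
    (hf : ∀ r ∈ Icc s t, HasDerivAt f (f' r) r) (hf' : ∀ r ∈ Icc s t, f' r ≤ 0) : f t ≤ f s := by
  refine antitoneOn_of_deriv_nonpos (convex_Icc s t)
    (fun r hr => (hf r hr).continuousAt.continuousWithinAt)
    (fun r hr => ?_) (fun r hr => ?_) (left_mem_Icc.2 hst) (right_mem_Icc.2 hst) hst
  · exact (hf r (interior_subset hr)).differentiableAt.differentiableWithinAt
  · rw [(hf r (interior_subset hr)).deriv]; exact hf' r (interior_subset hr)

section
variable {E O h p : ℝ → ℂ} {B μ : ℝ}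

/-- Along a progressive path the odd symbol is damped at a rate `μ ∼ 1 / ε`, so that it is driven
down to size `1 / μ`, and the even symbol changes by a relative amount of that size only. -/
theorem symbol_estimate (hB : 0 ≤ B) (hμ : 0 < μ)
    (hE : ∀ t ∈ Icc (0 : ℝ) 1, HasDerivAt E (h t * O t) t)
    (hO : ∀ t ∈ Icc (0 : ℝ) 1, HasDerivAt O (-p t * O t + h t * E t) t)
    (hh : ∀ t ∈ Icc (0 : ℝ) 1, ‖h t‖ ≤ B) (hp : ∀ t ∈ Icc (0 : ℝ) 1, 2 * μ ≤ (p t).re)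
    (h0 : ‖O 0‖ ≤ ‖E 0‖) :
    ‖O 1‖ ≤ (B * Real.exp B + 1) / μ * ‖E 0‖ ∧
      ‖E 1 - E 0‖ ≤ (B * (B * Real.exp B + 1)) / μ * ‖E 0‖ := by
  set e := ‖E 0‖ with he
  have he0 : 0 ≤ e := norm_nonneg _
  set K := 2 * Real.exp B with hK
  have hK0 : 0 < K := by positivity
  have dE : ∀ t ∈ Icc (0 : ℝ) 1, HasDerivAt (fun s => ‖E s‖ ^ 2) (2 * inner ℝ (E t) (h t * O t)) t :=
    fun t ht => (hE t ht).norm_sq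
  have dO : ∀ t ∈ Icc (0 : ℝ) 1, HasDerivAt (fun s => ‖O s‖ ^ 2)
      (2 * (-(p t).re * ‖O t‖ ^ 2 + inner ℝ (O t) (h t * E t))) t := by
    intro t ht
    refine (hO t ht).norm_sq.congr_deriv ?_
    rw [inner_add_right, real_inner_self_mul, neg_re]
  -- The full symbol grows by a bounded factor only.
  have bd : ∀ t ∈ Icc (0 : ℝ) 1, ‖E t‖ ≤ K * e ∧ ‖O t‖ ≤ K * e := by
    intro t ht
    have key := le_of_hasDerivAt_nonpos (f := fun s => Real.exp (-2 * B * s) *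
      (‖E s‖ ^ 2 + ‖O s‖ ^ 2)) ht.1
      (fun r hr => (((hasDerivAt_id r).const_mul (-2 * B)).exp.mul
        ((dE r ⟨hr.1, hr.2.trans ht.2⟩).add (dO r ⟨hr.1, hr.2.trans ht.2⟩)))) ?_
    · simp only [mul_zero, Real.exp_zero, one_mul] at key
      have h1 : ‖E t‖ ^ 2 + ‖O t‖ ^ 2 ≤ Real.exp (2 * B * t) * (‖E 0‖ ^ 2 + ‖O 0‖ ^ 2) := by
        have : Real.exp (2 * B * t) * Real.exp (-2 * B * t) = 1 := by
          rw [← Real.exp_add]; simp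
        calc _ = Real.exp (2 * B * t) * (Real.exp (-2 * B * t) * (‖E t‖ ^ 2 + ‖O t‖ ^ 2)) := by
              rw [← mul_assoc, this, one_mul]
          _ ≤ _ := by gcongr
      have h2 : Real.exp (2 * B * t) ≤ Real.exp B ^ 2 := by
        rw [← Real.exp_nat_mul]; apply Real.exp_le_exp.2; push_cast; nlinarith [ht.2]
      have h3 : ‖O 0‖ ^ 2 ≤ e ^ 2 := by gcongr
      have h4 : ‖E t‖ ^ 2 + ‖O t‖ ^ 2 ≤ (K * e) ^ 2 := by
        calc _ ≤ Real.exp (2 * B * t) * (‖E 0‖ ^ 2 + ‖O 0‖ ^ 2) := h1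
          _ ≤ Real.exp B ^ 2 * (e ^ 2 + e ^ 2) := by gcongr
          _ ≤ (K * e) ^ 2 := by rw [hK]; nlinarith [mul_nonneg (sq_nonneg (Real.exp B)) (sq_nonneg e)]
      constructor
      · refine (sq_le_sq₀ (norm_nonneg _) (by positivity)).1 ?_; nlinarith [sq_nonneg ‖O t‖]
      · refine (sq_le_sq₀ (norm_nonneg _) (by positivity)).1 ?_; nlinarith [sq_nonneg ‖E t‖]
    · intro r hr
      have hr' : r ∈ Icc (0 : ℝ) 1 := ⟨hr.1, hr.2.trans ht.2⟩
      have i1 := real_inner_mul_le (E r) (O r) (h r) (hh r hr')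
      have i2 := real_inner_mul_le (O r) (E r) (h r) (hh r hr')
      have i3 := hp r hr'
      have : 0 < Real.exp (-2 * B * r) := Real.exp_pos _
      have i4 : 2 * B * (‖E r‖ * ‖O r‖) ≤ B * (‖E r‖ ^ 2 + ‖O r‖ ^ 2) := by
        nlinarith [sq_nonneg (‖E r‖ - ‖O r‖)]
      have i5 : 0 ≤ (p r).re * ‖O r‖ ^ 2 := by
        have : 0 ≤ (p r).re := by linarith
        positivity
      simp only [Pi.add_apply, id, mul_one]
      have : (2 * inner ℝ (E r) (h r * O r) +
          2 * (-(p r).re * ‖O r‖ ^ 2 + inner ℝ (O r) (h r * E r))) ≤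
          2 * B * (‖E r‖ ^ 2 + ‖O r‖ ^ 2) := by nlinarith
      nlinarith
  set q := B * K * e / (2 * μ) with hq
  have hq0 : 0 ≤ q := by positivity
  have bO : ∀ t ∈ Icc (0 : ℝ) 1, ‖O t‖ ≤ q + Real.exp (-(μ * t)) * e := by
    intro t ht
    have key := le_of_hasDerivAt_nonpos (f := fun s => Real.exp (2 * μ * s) *
      (‖O s‖ ^ 2 - q ^ 2)) ht.1
      (fun r hr => (((hasDerivAt_id r).const_mul (2 * μ)).exp.mul
        ((dO r ⟨hr.1, hr.2.trans ht.2⟩).sub_const (q ^ 2)))) ?_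
    · simp only [mul_zero, Real.exp_zero, one_mul] at key
      have h3 : ‖O 0‖ ^ 2 ≤ e ^ 2 := by gcongr
      have h5 : Real.exp (-(μ * t)) ^ 2 * Real.exp (2 * μ * t) = 1 := by
        rw [← Real.exp_nat_mul, ← Real.exp_add]; simp; ring
      have h6 : ‖O t‖ ^ 2 - q ^ 2 ≤ Real.exp (-(μ * t)) ^ 2 * e ^ 2 := by
        calc ‖O t‖ ^ 2 - q ^ 2 = Real.exp (-(μ * t)) ^ 2 *
              (Real.exp (2 * μ * t) * (‖O t‖ ^ 2 - q ^ 2)) := by rw [← mul_assoc, h5, one_mul]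
          _ ≤ _ := by
            gcongr
            nlinarith [sq_nonneg q]
      refine (sq_le_sq₀ (norm_nonneg _) (by positivity)).1 ?_
      nlinarith [mul_nonneg hq0 (mul_nonneg (Real.exp_pos (-(μ * t))).le he0)]
    · intro r hr
      have hr' : r ∈ Icc (0 : ℝ) 1 := ⟨hr.1, hr.2.trans ht.2⟩
      have i2 := real_inner_mul_le (O r) (E r) (h r) (hh r hr')
      have i3 := hp r hr'
      have i4 := (bd r hr').1
      have : 0 < Real.exp (2 * μ * r) := Real.exp_pos _
      have i5 : B * K * e = 2 * μ * q := by rw [hq]; field_simp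
      have i6 : inner ℝ (O r) (h r * E r) ≤ 2 * μ * q * ‖O r‖ := by
        calc _ ≤ B * (‖O r‖ * ‖E r‖) := i2
          _ ≤ B * (‖O r‖ * (K * e)) := by gcongr
          _ = _ := by rw [← i5]; ring
      simp only [id, mul_one]
      have i7 : 2 * μ * ‖O r‖ ^ 2 ≤ (p r).re * ‖O r‖ ^ 2 := by gcongr
      have : 2 * μ * (‖O r‖ ^ 2 - q ^ 2) +
        2 * (-(p r).re * ‖O r‖ ^ 2 + inner ℝ (O r) (h r * E r)) ≤ 0 := by
        nlinarith [mul_nonneg hμ.le (sq_nonneg (‖O r‖ - q))]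
      nlinarith
  constructor
  · have h1 := bO 1 (by simp)
    have h2 : Real.exp (-(μ * 1)) ≤ 1 / μ := by
      rw [Real.exp_neg, mul_one, ← one_div]
      exact one_div_le_one_div_of_le hμ (by linarith [Real.add_one_le_exp μ])
    calc ‖O 1‖ ≤ q + 1 / μ * e := h1.trans (by gcongr)
      _ = _ := by rw [hq, hK]; field_simp
  · have key := image_norm_le_of_norm_deriv_right_le_deriv_boundary' (a := 0) (b := 1)
      (f := fun t => E t - E 0) (f' := fun t => h t * O t)
      (B := fun t => B * (q * t + (1 - Real.exp (-(μ * t))) / μ * e))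
      (B' := fun t => B * (q + Real.exp (-(μ * t)) * e))
      (fun t ht => ((hE t ht).continuousAt.sub continuousAt_const).continuousWithinAt)
      (fun t ht => ((hE t (Ico_subset_Icc_self ht)).sub_const _).hasDerivWithinAt)
      (by simp) (by fun_prop) ?_ ?_ (right_mem_Icc.2 zero_le_one)
    · refine key.trans ?_
      have : (1 - Real.exp (-(μ * 1))) / μ ≤ 1 / μ := by
        gcongr; linarith [Real.exp_pos (-(μ * 1))]
      calc B * (q * 1 + (1 - Real.exp (-(μ * 1))) / μ * e) ≤ B * (q * 1 + 1 / μ * e) := by gcongr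
        _ = _ := by rw [hq, hK]; field_simp
    · intro t ht
      apply HasDerivAt.hasDerivWithinAt
      have d1 := ((hasDerivAt_id t).const_mul μ).neg.exp
      have d2 := ((hasDerivAt_id t).const_mul q).add
        (((d1.const_sub 1).div_const μ).mul_const e)
      refine (d2.const_mul B).congr_deriv ?_
      simp only [id, Pi.neg_apply, mul_one]
      field_simp
    · intro t ht
      have ht' := Ico_subset_Icc_self ht
      rw [norm_mul]
      exact mul_le_mul (hh t ht') (bO t ht') (norm_nonneg _) hB

end

/-! ### Families of frames -/

/-- Branches of the phase and of the amplitude, and their domain, depending on the spectral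
parameter. -/
structure Family where
  /-- the domain -/
  D : ℂ → Set ℂ
  /-- the phase -/
  z : ℂ → ℂ → ℂ
  /-- the amplitude -/
  H : ℂ → ℂ → ℂ

/-- `F` is a family of frames for spectral parameters near `lam₀`. The domain may shrink only a
little when the parameter moves away from `lam₀`, and the branch of `z'` varies continuously. No
continuity is asked of `H`, whose sign is irrelevant. -/
structure IsFamily (A S : ℂ → ℂ) (Ω : Set ℂ) (lam₀ : ℂ) (F : Family) : Prop where
  frame : ∀ᶠ lam in 𝓝 lam₀, IsFrame A S Ω lam (F.D lam) (F.z lam) (F.H lam)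
  mem : ∀ x ∈ F.D lam₀, ∀ᶠ q : ℂ × ℂ in 𝓝 (lam₀, x), q.2 ∈ F.D q.1
  cont : ∀ x ∈ F.D lam₀, Tendsto (fun q : ℂ × ℂ => deriv (F.z q.1) q.2) (𝓝 (lam₀, x))
    (𝓝 (deriv (F.z lam₀) x))

/-- The family on the other sheet of `z'`, with a primitive fourth root of unity `s`. -/
def Family.opposite (F : Family) (s : ℂ) : Family :=
  ⟨F.D, fun lam x => -F.z lam x, fun lam x => s * F.H lam x⟩

theorem IsFamily.opposite {A S : ℂ → ℂ} {Ω : Set ℂ} {lam₀ : ℂ} {F : Family}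
    (h : IsFamily A S Ω lam₀ F) {s : ℂ} (hs : s ^ 2 = -1) :
    IsFamily A S Ω lam₀ (F.opposite s) where
  frame := h.frame.mono fun _ hl => hl.opposite hs
  mem := h.mem
  cont x hx := by
    have := (h.cont x hx).neg
    simpa only [Family.opposite, deriv.fun_neg] using this

/-- `(G, y)` is reached progressively from `(F, x)`: for every solution whose symbol at `x` is
dominated by its even part, the symbol at `y` is the even symbol at `x` up to a relative error
`O(ε)`, uniformly in the spectral parameter. -/
def Leads (A S : ℂ → ℂ) (Ω : Set ℂ) (lam₀ : ℂ) (F : Family) (x : ℂ) (G : Family) (y : ℂ) : Prop :=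
  ∃ C ε₀ : ℝ, 0 ≤ C ∧ 0 < ε₀ ∧ ∀ᶠ lam in 𝓝 lam₀, ∀ ε : ℝ, 0 < ε → ε < ε₀ →
    ∀ u : ℂ → Fin 2 → ℂ, IsSolution A S Ω ε lam u →
      ‖symbolOdd S (F.z lam) (F.H lam) ε u x‖ ≤ ‖symbolEven S (F.z lam) (F.H lam) ε u x‖ →
        ‖symbolOdd S (G.z lam) (G.H lam) ε u y‖ ≤
            C * ε * ‖symbolEven S (G.z lam) (G.H lam) ε u y‖ ∧
          ‖symbolEven S (G.z lam) (G.H lam) ε u y - symbolEven S (F.z lam) (F.H lam) ε u x‖ ≤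
            C * ε * ‖symbolEven S (F.z lam) (F.H lam) ε u x‖

section
variable {A S : ℂ → ℂ} {Ω : Set ℂ} {lam₀ : ℂ} {F G K : Family} {x y w : ℂ}

theorem Leads.trans (h : Leads A S Ω lam₀ F x G y) (h' : Leads A S Ω lam₀ G y K w) :
    Leads A S Ω lam₀ F x K w := by
  obtain ⟨C, e, hC, he, H⟩ := h
  obtain ⟨C', e', hC', he', H'⟩ := h'
  refine ⟨C + C' * 2 + C', min (min e e') (1 / (C + 1)), by positivity, by positivity, ?_⟩
  filter_upwards [H, H'] with lam H H' ε hε hεe u hu h0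
  have h1 : ε < e := lt_of_lt_of_le hεe ((min_le_left _ _).trans (min_le_left _ _))
  have h2 : ε < e' := lt_of_lt_of_le hεe ((min_le_left _ _).trans (min_le_right _ _))
  have h3 : ε < 1 / (C + 1) := lt_of_lt_of_le hεe (min_le_right _ _)
  have h4 : C * ε ≤ 1 := by
    rw [lt_div_iff₀ (by positivity)] at h3; nlinarith
  obtain ⟨a1, a2⟩ := H ε hε h1 u hu h0
  set E := symbolEven S (F.z lam) (F.H lam) ε u x
  set E' := symbolEven S (G.z lam) (G.H lam) ε u y
  set E'' := symbolEven S (K.z lam) (K.H lam) ε u w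
  obtain ⟨b1, b2⟩ := H' ε hε h2 u hu (a1.trans (mul_le_of_le_one_left (norm_nonneg _) h4))
  have h5 : ‖E'‖ ≤ 2 * ‖E‖ := by
    calc ‖E'‖ = ‖E' - E + E‖ := by rw [sub_add_cancel]
      _ ≤ ‖E' - E‖ + ‖E‖ := norm_add_le _ _
      _ ≤ 1 * ‖E‖ + ‖E‖ := by gcongr; exact a2.trans (by gcongr)
      _ = _ := by ring
  constructor
  · refine b1.trans ?_
    gcongr
    nlinarith
  · calc ‖E'' - E‖ = ‖(E'' - E') + (E' - E)‖ := by rw [sub_add_sub_cancel]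
      _ ≤ ‖E'' - E'‖ + ‖E' - E‖ := norm_add_le _ _
      _ ≤ C' * ε * (2 * ‖E‖) + C * ε * ‖E‖ := by
        gcongr
        exact b2.trans (by gcongr)
      _ ≤ _ := by
        have : 0 ≤ C' * ε * ‖E‖ := by positivity
        nlinarith

theorem Leads.congr_right (h : Leads A S Ω lam₀ F x G y)
    (hz : ∀ᶠ lam in 𝓝 lam₀, G.z lam y = K.z lam y ∧ G.H lam y = K.H lam y) :
    Leads A S Ω lam₀ F x K y := by
  obtain ⟨C, e, hC, he, H⟩ := h
  refine ⟨C, e, hC, he, ?_⟩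
  filter_upwards [H, hz] with lam H hz
  simpa only [symbolOdd, symbolEven, hz.1, hz.2] using H

theorem Leads.congr_left (h : Leads A S Ω lam₀ G y F x)
    (hz : ∀ᶠ lam in 𝓝 lam₀, G.z lam y = K.z lam y ∧ G.H lam y = K.H lam y) :
    Leads A S Ω lam₀ K y F x := by
  obtain ⟨C, e, hC, he, H⟩ := h
  refine ⟨C, e, hC, he, ?_⟩
  filter_upwards [H, hz] with lam H hz
  simpa only [symbolOdd, symbolEven, hz.1, hz.2] using H

theorem IsPotential.differentiableOn_deriv_S (hAS : IsPotential A S Ω) :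
    DifferentiableOn ℂ (deriv S) Ω :=
  hAS.holo_S.deriv hAS.isOpen

theorem IsPotential.hasDerivAt_gPlus (hAS : IsPotential A S Ω) (lam : ℂ) {x : ℂ} (hx : x ∈ Ω) :
    HasDerivAt (gPlus A S lam) (-(deriv (deriv S) x / 2 + I * deriv A x)) x := by
  have h1 := (hAS.differentiableOn_deriv_S.differentiableAt (hAS.isOpen.mem_nhds hx)).hasDerivAt
  have h2 := (hAS.holo_A.differentiableAt (hAS.isOpen.mem_nhds hx)).hasDerivAt
  exact (((h1.div_const 2).const_add lam).add (h2.const_mul I)).neg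

theorem IsPotential.hasDerivAt_gMinus (hAS : IsPotential A S Ω) (lam : ℂ) {x : ℂ} (hx : x ∈ Ω) :
    HasDerivAt (gMinus A S lam) (deriv (deriv S) x / 2 - I * deriv A x) x := by
  have h1 := (hAS.differentiableOn_deriv_S.differentiableAt (hAS.isOpen.mem_nhds hx)).hasDerivAt
  have h2 := (hAS.holo_A.differentiableAt (hAS.isOpen.mem_nhds hx)).hasDerivAt
  exact ((h1.div_const 2).const_add lam).sub (h2.const_mul I)

theorem IsPotential.continuousAt_gPlus (hAS : IsPotential A S Ω) (hx : x ∈ Ω) :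
    ContinuousAt (fun q : ℂ × ℂ => gPlus A S q.1 q.2) (lam₀, x) := by
  have h1 := (hAS.differentiableOn_deriv_S.differentiableAt (hAS.isOpen.mem_nhds hx)).continuousAt
  have h2 := (hAS.holo_A.differentiableAt (hAS.isOpen.mem_nhds hx)).continuousAt
  have h3 : ContinuousAt (fun q : ℂ × ℂ => deriv S q.2) (lam₀, x) :=
    ContinuousAt.comp (x := (lam₀, x)) (f := Prod.snd) h1 continuousAt_snd
  have h4 : ContinuousAt (fun q : ℂ × ℂ => A q.2) (lam₀, x) :=
    ContinuousAt.comp (x := (lam₀, x)) (f := Prod.snd) h2 continuousAt_snd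
  unfold gPlus
  fun_prop

theorem IsPotential.continuousAt_gMinus (hAS : IsPotential A S Ω) (hx : x ∈ Ω) :
    ContinuousAt (fun q : ℂ × ℂ => gMinus A S q.1 q.2) (lam₀, x) := by
  have h1 := (hAS.differentiableOn_deriv_S.differentiableAt (hAS.isOpen.mem_nhds hx)).continuousAt
  have h2 := (hAS.holo_A.differentiableAt (hAS.isOpen.mem_nhds hx)).continuousAt
  have h3 : ContinuousAt (fun q : ℂ × ℂ => deriv S q.2) (lam₀, x) :=
    ContinuousAt.comp (x := (lam₀, x)) (f := Prod.snd) h1 continuousAt_snd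
  have h4 : ContinuousAt (fun q : ℂ × ℂ => A q.2) (lam₀, x) :=
    ContinuousAt.comp (x := (lam₀, x)) (f := Prod.snd) h2 continuousAt_snd
  unfold gMinus
  fun_prop

theorem IsPotential.continuousAt_V0 (hAS : IsPotential A S Ω) (hx : x ∈ Ω) :
    ContinuousAt (fun q : ℂ × ℂ => V0 A S q.1 q.2) (lam₀, x) := by
  simp only [V0_eq]
  exact (hAS.continuousAt_gMinus hx).mul (hAS.continuousAt_gPlus hx)

/-- The logarithmic derivative of the amplitude, which is the same on all sheets. -/
noncomputable def ampLogDeriv (A S : ℂ → ℂ) (lam x : ℂ) : ℂ :=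
  ((deriv (deriv S) x / 2 - I * deriv A x) / gMinus A S lam x +
    (deriv (deriv S) x / 2 + I * deriv A x) / gPlus A S lam x) / 4

theorem IsFrame.logDeriv_H (hAS : IsPotential A S Ω) {lam : ℂ} {D : Set ℂ} {z H : ℂ → ℂ}
    (h : IsFrame A S Ω lam D z H) (hx : x ∈ D) : logDeriv H x = ampLogDeriv A S lam x := by
  have hp := hAS.hasDerivAt_gPlus lam (h.subset hx)
  have hm := hAS.hasDerivAt_gMinus lam (h.subset hx)
  have h1 : logDeriv (fun y => H y ^ 4) x =
      logDeriv (fun y => gMinus A S lam y / gPlus A S lam y) x := by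
    have : (fun y => H y ^ 4) =ᶠ[𝓝 x] fun y => gMinus A S lam y / gPlus A S lam y := by
      filter_upwards [h.isOpen.mem_nhds hx] with y hy using h.pow_four y hy
    rw [logDeriv_apply, logDeriv_apply, this.deriv_eq, h.pow_four x hx]
  rw [logDeriv_fun_pow (h.hasDerivAt_H hx).differentiableAt,
    logDeriv_div x (h.gMinus_ne hx) (h.gPlus_ne hx) hm.differentiableAt hp.differentiableAt,
    logDeriv_apply (gMinus A S lam), logDeriv_apply (gPlus A S lam), hp.deriv, hm.deriv] at h1
  rw [ampLogDeriv]
  push_cast at h1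
  linear_combination h1 / 4

theorem IsPotential.continuousAt_ampLogDeriv (hAS : IsPotential A S Ω) (hx : x ∈ Ω)
    (hV : V0 A S lam₀ x ≠ 0) :
    ContinuousAt (fun q : ℂ × ℂ => ampLogDeriv A S q.1 q.2) (lam₀, x) := by
  have hn := hAS.isOpen.mem_nhds hx
  have h1 := ((hAS.differentiableOn_deriv_S.deriv hAS.isOpen).differentiableAt hn).continuousAt
  have h2 := ((hAS.holo_A.deriv hAS.isOpen).differentiableAt hn).continuousAt
  have h3 : ContinuousAt (fun q : ℂ × ℂ => deriv (deriv S) q.2) (lam₀, x) :=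
    ContinuousAt.comp (x := (lam₀, x)) (f := Prod.snd) h1 continuousAt_snd
  have h4 : ContinuousAt (fun q : ℂ × ℂ => deriv A q.2) (lam₀, x) :=
    ContinuousAt.comp (x := (lam₀, x)) (f := Prod.snd) h2 continuousAt_snd
  rw [V0_eq, mul_ne_zero_iff] at hV
  unfold ampLogDeriv
  have h5 := hAS.continuousAt_gPlus (lam₀ := lam₀) hx
  have h6 := hAS.continuousAt_gMinus (lam₀ := lam₀) hx
  exact ((((h3.div_const 2).sub (h4.const_mul I)).div h6 hV.1).add
    (((h3.div_const 2).add (h4.const_mul I)).div h5 hV.2)).div_const 4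

/-- A smooth path along which `Re z` increases at a positive rate is progressive in the sense of
`Leads`. -/
theorem IsFamily.leads_of_deriv_pos (hAS : IsPotential A S Ω) (hF : IsFamily A S Ω lam₀ F)
    {γ γ' : ℝ → ℂ} (hγ : ∀ t ∈ Icc (0 : ℝ) 1, HasDerivAt γ (γ' t) t)
    (hγ' : ∀ t ∈ Icc (0 : ℝ) 1, ContinuousAt γ' t)
    (hD : ∀ t ∈ Icc (0 : ℝ) 1, γ t ∈ F.D lam₀)
    (hpos : ∀ t ∈ Icc (0 : ℝ) 1, 0 < (deriv (F.z lam₀) (γ t) * γ' t).re) :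
    Leads A S Ω lam₀ F (γ 0) F (γ 1) := by
  have F0 := hF.frame.self_of_nhds
  have mapc : ∀ t ∈ Icc (0 : ℝ) 1,
      Tendsto (fun q : ℂ × ℝ => (q.1, γ q.2)) (𝓝 (lam₀, t)) (𝓝 (lam₀, γ t)) := fun t ht =>
    (continuousAt_fst.prodMk
      (ContinuousAt.comp (x := (lam₀, t)) (f := Prod.snd) (hγ t ht).continuousAt continuousAt_snd))
  have gc : ∀ t ∈ Icc (0 : ℝ) 1, Tendsto (fun q : ℂ × ℝ => γ' q.2) (𝓝 (lam₀, t)) (𝓝 (γ' t)) :=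
    fun t ht => ContinuousAt.comp (x := (lam₀, t)) (f := Prod.snd) (hγ' t ht) continuousAt_snd
  have c1 : ∀ t ∈ Icc (0 : ℝ) 1, Tendsto (fun q : ℂ × ℝ => (deriv (F.z q.1) (γ q.2) * γ' q.2).re)
      (𝓝 (lam₀, t)) (𝓝 (deriv (F.z lam₀) (γ t) * γ' t).re) := fun t ht =>
    (continuous_re.tendsto _).comp
      (((hF.cont _ (hD t ht)).comp (mapc t ht)).mul (gc t ht))
  have c2 : ∀ t ∈ Icc (0 : ℝ) 1, Tendsto (fun q : ℂ × ℝ => ‖ampLogDeriv A S q.1 (γ q.2) * γ' q.2‖)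
      (𝓝 (lam₀, t)) (𝓝 ‖ampLogDeriv A S lam₀ (γ t) * γ' t‖) := fun t ht =>
    ((Tendsto.comp (hAS.continuousAt_ampLogDeriv (F0.subset (hD t ht)) (F0.ne_zero _ (hD t ht)))
      (mapc t ht)).mul (gc t ht)).norm
  have sl : ∀ t : ℝ, Tendsto (fun s : ℝ => (lam₀, s)) (𝓝 t) (𝓝 (lam₀, t)) := fun t =>
    (Continuous.prodMk_right lam₀).tendsto t
  have c1' : ContinuousOn (fun t => (deriv (F.z lam₀) (γ t) * γ' t).re) (Icc 0 1) := fun t ht =>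
    ((c1 t ht).comp (sl t)).mono_left nhdsWithin_le_nhds
  have c2' : ContinuousOn (fun t => ‖ampLogDeriv A S lam₀ (γ t) * γ' t‖) (Icc 0 1) := fun t ht =>
    ((c2 t ht).comp (sl t)).mono_left nhdsWithin_le_nhds
  obtain ⟨t₁, ht₁, hmin⟩ := isCompact_Icc.exists_isMinOn (nonempty_Icc.2 zero_le_one) c1'
  obtain ⟨t₂, ht₂, hmax⟩ := isCompact_Icc.exists_isMaxOn (nonempty_Icc.2 zero_le_one) c2'
  set m := (deriv (F.z lam₀) (γ t₁) * γ' t₁).re with hm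
  have hm0 : 0 < m := hpos t₁ ht₁
  set B := ‖ampLogDeriv A S lam₀ (γ t₂) * γ' t₂‖ + 1 with hB
  have hB0 : 0 ≤ B := by positivity
  have ev := isCompact_Icc.eventually_forall_of_forall_eventually (x₀ := lam₀)
    (K := Icc (0 : ℝ) 1) (P := fun lam t => γ t ∈ F.D lam ∧
      m / 2 ≤ (deriv (F.z lam) (γ t) * γ' t).re ∧ ‖ampLogDeriv A S lam (γ t) * γ' t‖ ≤ B) (by
    intro t ht
    have e1 := (mapc t ht).eventually (hF.mem _ (hD t ht))
    have e2 := (c1 t ht).eventually_const_lt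
      (lt_of_lt_of_le (half_lt_self hm0) (hmin ht))
    have e3 := (c2 t ht).eventually_lt_const
      (lt_of_le_of_lt (hmax ht) (lt_add_one _))
    filter_upwards [e1, e2, e3] with q h1 h2 h3 using ⟨h1, h2.le, h3.le⟩)
  set C₀ := (B * Real.exp B + 1) / (m / 2) with hC₀
  have hC₀0 : 0 < C₀ := by positivity
  refine ⟨2 * C₀ + B * C₀, 1 / (2 * (B * C₀ + 1)), by positivity, by positivity, ?_⟩
  filter_upwards [ev, hF.frame] with lam hev hfr ε hε hεε u hu h0
  have hε' : (ε : ℂ) ≠ 0 := by exact_mod_cast hε.ne'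
  have key := symbol_estimate (E := fun t => symbolEven S (F.z lam) (F.H lam) ε u (γ t))
    (O := fun t => symbolOdd S (F.z lam) (F.H lam) ε u (γ t))
    (h := fun t => logDeriv (F.H lam) (γ t) * γ' t)
    (p := fun t => 2 * (deriv (F.z lam) (γ t) * γ' t) / ε) (B := B) (μ := (m / 2) / ε) hB0
    (by positivity) ?_ ?_ ?_ ?_ h0
  · obtain ⟨k1, k2⟩ := key
    have e1 : (B * Real.exp B + 1) / (m / 2 / ε) = C₀ * ε := by rw [hC₀]; field_simp
    have e2 : B * (B * Real.exp B + 1) / (m / 2 / ε) = B * C₀ * ε := by rw [hC₀]; field_simp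
    rw [e1] at k1
    rw [e2] at k2
    set E0 := symbolEven S (F.z lam) (F.H lam) ε u (γ 0)
    set E1 := symbolEven S (F.z lam) (F.H lam) ε u (γ 1)
    have hsm : B * C₀ * ε ≤ 1 / 2 := by
      rw [lt_div_iff₀ (by positivity)] at hεε
      nlinarith
    have h5 : ‖E0‖ ≤ 2 * ‖E1‖ := by
      have : ‖E0‖ ≤ ‖E1‖ + ‖E1 - E0‖ := by
        calc ‖E0‖ = ‖E1 - (E1 - E0)‖ := by rw [sub_sub_cancel]
          _ ≤ _ := norm_sub_le _ _
      nlinarith [norm_nonneg E0]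
    constructor
    · refine k1.trans ?_
      calc C₀ * ε * ‖E0‖ ≤ C₀ * ε * (2 * ‖E1‖) := by gcongr
        _ ≤ _ := by
          have : 0 ≤ B * C₀ * ε * ‖E1‖ := by positivity
          nlinarith
    · refine k2.trans ?_
      gcongr
      linarith
  · intro t ht
    have := (hfr.hasDerivAt_symbolEven hu hAS.isOpen hAS.holo_S hε.ne' (hev t ht).1).comp t (hγ t ht)
    exact this.congr_deriv (by ring)
  · intro t ht
    have := (hfr.hasDerivAt_symbolOdd hu hAS.isOpen hAS.holo_S hε.ne' (hev t ht).1).comp t (hγ t ht)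
    exact this.congr_deriv (by ring)
  · intro t ht
    rw [hfr.logDeriv_H hAS (hev t ht).1]
    exact (hev t ht).2.2
  · intro t ht
    rw [Complex.div_ofReal_re, show (2 : ℂ) = ((2 : ℝ) : ℂ) by norm_num, Complex.re_ofReal_mul,
      ← mul_div_assoc]
    gcongr
    exact (hev t ht).2.1

end

/-! ### Progressive paths -/

/-- A holomorphic function with nonvanishing derivative is a local homeomorphism. -/
theorem exists_openPartialHomeomorph {f : ℂ → ℂ} {D : Set ℂ} (hD : IsOpen D)
    (hf : DifferentiableOn ℂ f D) {x : ℂ} (hx : x ∈ D) (h : deriv f x ≠ 0) :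
    ∃ e : OpenPartialHomeomorph ℂ ℂ, x ∈ e.source ∧ e.source ⊆ D ∧ ⇑e = f := by
  have hs := (hf.analyticAt (hD.mem_nhds hx)).hasStrictDerivAt
  have hs' := hs.hasStrictFDerivAt_equiv h
  refine ⟨(hs'.toOpenPartialHomeomorph f).restrOpen D hD, ?_, ?_, rfl⟩
  · exact ⟨hs'.mem_toOpenPartialHomeomorph_source, hx⟩
  · rw [OpenPartialHomeomorph.restrOpen_source]; exact inter_subset_right

section
variable {A S : ℂ → ℂ} {Ω : Set ℂ} {lam₀ : ℂ} {F G : Family}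

theorem IsFamily.eventually_leads (hAS : IsPotential A S Ω) (hF : IsFamily A S Ω lam₀ F) {x₀ : ℂ}
    (hx₀ : x₀ ∈ F.D lam₀) :
    ∃ N ∈ 𝓝 x₀, N ⊆ F.D lam₀ ∧ ∀ x ∈ N, ∀ y ∈ N, (F.z lam₀ x).re < (F.z lam₀ y).re →
      Leads A S Ω lam₀ F x F y := by
  have F0 := hF.frame.self_of_nhds
  obtain ⟨e, hxe, hes, hef⟩ :=
    exists_openPartialHomeomorph F0.isOpen F0.holo_z hx₀ (F0.deriv_ne hx₀)
  have hte : F.z lam₀ x₀ ∈ e.target := hef ▸ e.map_source hxe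
  obtain ⟨r, hr, hball⟩ := Metric.isOpen_iff.1 e.open_target _ hte
  refine ⟨e.source ∩ F.z lam₀ ⁻¹' Metric.ball (F.z lam₀ x₀) r, ?_, ?_, ?_⟩
  · exact inter_mem (e.open_source.mem_nhds hxe)
      ((F0.hasDerivAt_z hx₀).continuousAt.preimage_mem_nhds (Metric.ball_mem_nhds _ hr))
  · exact fun y hy => hes hy.1
  · rintro x ⟨hx, hxb⟩ y ⟨hy, hyb⟩ hxy
    set p := F.z lam₀ x
    set q := F.z lam₀ y
    have hseg : ∀ t ∈ Icc (0 : ℝ) 1, p + t * (q - p) ∈ e.target := by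
      intro t ht
      apply hball
      have := (convex_ball (F.z lam₀ x₀) r).add_smul_sub_mem hxb hyb ht
      simpa using this
    have hsrc : ∀ t ∈ Icc (0 : ℝ) 1, e.symm (p + t * (q - p)) ∈ F.D lam₀ := fun t ht =>
      hes (e.map_target (hseg t ht))
    have hd : ∀ t ∈ Icc (0 : ℝ) 1, HasDerivAt (fun t : ℝ => e.symm (p + t * (q - p)))
        ((deriv (F.z lam₀) (e.symm (p + t * (q - p))))⁻¹ * (q - p)) t := by
      intro t ht
      have h1 := e.hasDerivAt_symm (hseg t ht) (F0.deriv_ne (hsrc t ht))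
        (by rw [hef]; exact F0.hasDerivAt_z (hsrc t ht))
      have h2 : HasDerivAt (fun t : ℝ => p + t * (q - p)) (q - p) t := by
        simpa using ((Complex.ofRealCLM.hasDerivAt (x := t)).mul_const (q - p)).const_add p
      exact h1.comp t h2
    have key := hF.leads_of_deriv_pos hAS hd ?_ hsrc ?_
    · simpa [p, q, ← hef, e.left_inv hx, e.left_inv hy] using key
    · intro t ht
      have h3 : ContinuousAt (deriv (F.z lam₀)) (e.symm (p + t * (q - p))) :=
        ((F0.holo_z.deriv F0.isOpen).differentiableAt
          (F0.isOpen.mem_nhds (hsrc t ht))).continuousAt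
      exact ((ContinuousAt.comp (f := fun t : ℝ => e.symm (p + t * (q - p))) h3
        (hd t ht).continuousAt).inv₀ (F0.deriv_ne (hsrc t ht))).mul continuousAt_const
    · intro t ht
      rw [mul_inv_cancel_left₀ (F0.deriv_ne (hsrc t ht))]
      simpa using hxy

/-- A continuous path along which `Re z` increases strictly is progressive in the sense of `Leads`:
in the coordinate `z` it may be replaced by a polygon. -/
theorem IsFamily.leads_of_strictMonoOn (hAS : IsPotential A S Ω) (hF : IsFamily A S Ω lam₀ F)
    {γ : ℝ → ℂ} {a b : ℝ} (hab : a < b) (hγ : ContinuousOn γ (Icc a b))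
    (hD : ∀ t ∈ Icc a b, γ t ∈ F.D lam₀)
    (hm : StrictMonoOn (fun t => (F.z lam₀ (γ t)).re) (Icc a b)) :
    Leads A S Ω lam₀ F (γ a) F (γ b) := by
  choose! N hN hND hNL using fun x (hx : x ∈ F.D lam₀) => hF.eventually_leads hAS hx
  have hγ' : Continuous (fun t : Icc a b => γ t) := hγ.domRestrict
  obtain ⟨t, ht0, htm, ⟨m, htb⟩, htc⟩ := exists_monotone_Icc_subset_open_cover_Icc hab.le
    (c := fun s : Icc a b => (fun t : Icc a b => γ t) ⁻¹' interior (N (γ s)))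
    (fun s => isOpen_interior.preimage hγ')
    (fun s _ => mem_iUnion.2 ⟨s, mem_interior_iff_mem_nhds.2 (hN _ (hD s s.2))⟩)
  have key : ∀ n, (t n : ℝ) = a ∨ Leads A S Ω lam₀ F (γ a) F (γ (t n)) := by
    intro n
    induction n with
    | zero => exact Or.inl ht0
    | succ n ih =>
      by_cases heq : t n = t (n + 1)
      · rwa [← heq]
      have hlt : (t n : ℝ) < t (n + 1) := lt_of_le_of_ne (htm n.le_succ) (fun h => heq (Subtype.ext h))
      obtain ⟨i, hi⟩ := htc n
      have l := hNL _ (hD i i.2) (γ (t n)) (interior_subset (hi ⟨le_rfl, hlt.le⟩)) (γ (t (n + 1)))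
        (interior_subset (hi ⟨hlt.le, le_rfl⟩)) (hm (t n).2 (t (n + 1)).2 hlt)
      rcases ih with h | h
      · right; rwa [h] at l
      · exact Or.inr (h.trans l)
  rcases key m with h | h
  · rw [htb m le_rfl] at h; exact absurd h hab.ne'
  · rwa [htb m le_rfl] at h

/-- All points close to `x` on the side `Re z > 0` are reached progressively from `(G, x₀)`. -/
def LeadsNear (A S : ℂ → ℂ) (Ω : Set ℂ) (lam₀ : ℂ) (G : Family) (x₀ : ℂ) (F : Family)
    (x : ℂ) : Prop :=
  ∀ᶠ y in 𝓝 x, 0 < (F.z lam₀ y).re → Leads A S Ω lam₀ G x₀ F y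

/-- Close to an arc of the level line `Re z = 0` one may move progressively in both directions of
the arc, `Re z` being arbitrarily small. -/
theorem IsFamily.leadsNear_of_level (hAS : IsPotential A S Ω) (hF : IsFamily A S Ω lam₀ F)
    {c : ℝ → ℂ} {J : Set ℝ} (hJ : IsPreconnected J) (hc : ContinuousOn c J)
    (hD : ∀ t ∈ J, c t ∈ F.D lam₀) (h0 : ∀ t ∈ J, (F.z lam₀ (c t)).re = 0) {x₀ : ℂ} {t t' : ℝ}
    (ht : t ∈ J) (ht' : t' ∈ J) (h : LeadsNear A S Ω lam₀ G x₀ F (c t)) :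
    LeadsNear A S Ω lam₀ G x₀ F (c t') := by
  have F0 := hF.frame.self_of_nhds
  have move : ∀ t ∈ J, ∀ t' ∈ J, ∀ N : Set ℂ, N ∈ 𝓝 (c t) → N ∈ 𝓝 (c t') →
      (∀ x ∈ N, ∀ y ∈ N, (F.z lam₀ x).re < (F.z lam₀ y).re → Leads A S Ω lam₀ F x F y) →
      LeadsNear A S Ω lam₀ G x₀ F (c t) → LeadsNear A S Ω lam₀ G x₀ F (c t') := by
    intro t ht t' ht' N hN hN' hNL h
    filter_upwards [hN'] with y hy hpos
    have hmap : map (F.z lam₀) (𝓝 (c t)) = 𝓝 (F.z lam₀ (c t)) :=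
      ((F0.holo_z.analyticAt (F0.isOpen.mem_nhds (hD t ht))).hasStrictDerivAt).map_nhds_eq
        (F0.deriv_ne (hD t ht))
    have hfr : ∃ᶠ w in 𝓝 (F.z lam₀ (c t)), 0 < w.re ∧ w.re < (F.z lam₀ y).re := by
      have h1 : Tendsto (fun δ : ℝ => F.z lam₀ (c t) + δ) (𝓝[>] 0) (𝓝 (F.z lam₀ (c t))) := by
        have : Tendsto (fun δ : ℝ => F.z lam₀ (c t) + δ) (𝓝 0) (𝓝 (F.z lam₀ (c t) + (0 : ℝ))) :=
          Continuous.tendsto (by fun_prop) 0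
        simp only [ofReal_zero, add_zero] at this
        exact this.mono_left nhdsWithin_le_nhds
      apply h1.frequently
      apply Eventually.frequently
      filter_upwards [Ioo_mem_nhdsGT hpos] with δ hδ
      simpa [h0 t ht] using hδ
    rw [← hmap, frequently_map] at hfr
    obtain ⟨y', ⟨hy1, hy2⟩, hy3, hy4⟩ := (hfr.and_eventually (h.and hN)).exists
    exact (hy3 hy1).trans (hNL y' hy4 y hy hy2)
  refine (hJ.induction₂ (fun t t' => LeadsNear A S Ω lam₀ G x₀ F (c t) ↔
    LeadsNear A S Ω lam₀ G x₀ F (c t')) ?_ (fun _ _ _ _ _ _ => Iff.trans)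
    (fun _ _ _ _ => Iff.symm) ht ht').1 h
  intro t ht
  obtain ⟨N, hN, -, hNL⟩ := hF.eventually_leads hAS (hD t ht)
  filter_upwards [(hc t ht).eventually (eventually_mem_nhds_iff.2 hN), self_mem_nhdsWithin]
    with s hs hsJ
  exact ⟨move t ht s hsJ N hN hs hNL, move s hsJ t ht N hs hN hNL⟩

/-- Once the level line `Re z = 0` is reached at the foot of a path along which `Re z` is strictly
monotone, the other end of the path is reached. -/
theorem IsFamily.leads_of_leadsNear (hAS : IsPotential A S Ω) (hF : IsFamily A S Ω lam₀ F)
    {γ : ℝ → ℂ} (hγ : ContinuousOn γ (Icc 0 1)) (hD : ∀ t ∈ Icc (0 : ℝ) 1, γ t ∈ F.D lam₀)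
    (hm : StrictAntiOn (fun t => (F.z lam₀ (γ t)).re) (Icc 0 1))
    (h0 : (F.z lam₀ (γ 1)).re = 0) {x₀ : ℂ} (h : LeadsNear A S Ω lam₀ G x₀ F (γ 1)) :
    Leads A S Ω lam₀ G x₀ F (γ 0) := by
  have h1 : ∀ᶠ s in 𝓝[Icc 0 1] (1 : ℝ), 0 < (F.z lam₀ (γ s)).re → Leads A S Ω lam₀ G x₀ F (γ s) :=
    (hγ 1 (right_mem_Icc.2 zero_le_one)).eventually h
  have h2 : 𝓝[<] (1 : ℝ) ≤ 𝓝[Icc 0 1] (1 : ℝ) := by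
    rw [← nhdsWithin_Ioo_eq_nhdsLT (zero_lt_one' ℝ)]
    exact nhdsWithin_mono _ Ioo_subset_Icc_self
  obtain ⟨s, hs1, hs2⟩ := ((h1.filter_mono h2).and (Ioo_mem_nhdsLT (zero_lt_one' ℝ))).exists
  have hs3 : s ∈ Icc (0 : ℝ) 1 := Ioo_subset_Icc_self hs2
  have hs4 := hs1 (by rw [← h0]; exact hm hs3 (right_mem_Icc.2 zero_le_one) hs2.2)
  refine hs4.trans ?_
  have key := hF.leads_of_strictMonoOn hAS (γ := fun t => γ (s - t)) hs2.1
    (hγ.comp (by fun_prop) fun t ht => ⟨by linarith [ht.2], by linarith [ht.1, hs2.2]⟩)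
    (fun t ht => hD _ ⟨by linarith [ht.2], by linarith [ht.1, hs2.2]⟩)
    (fun t ht t' ht' htt => hm ⟨by linarith [ht'.2], by linarith [ht'.1, hs2.2]⟩
      ⟨by linarith [ht.2], by linarith [ht.1, hs2.2]⟩ (by linarith))
  simpa using key

end

/-! ### Decaying solutions on the real axis -/

section
variable {f g κ₁ κ₂ : ℝ → ℂ} {μ : ℂ} {R M : ℝ}

/-- If the coupling is weak, then `16 |g|² - |f|²` decreases at a rate that controls the size of the
solution. -/
theorem energy_hasDerivAt (hf : ∀ x ≤ R, HasDerivAt f (μ * f x + κ₁ x * g x) x)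
    (hg : ∀ x ≤ R, HasDerivAt g (-μ * g x + κ₂ x * f x) x)
    (hκ₁ : ∀ x ≤ R, ‖κ₁ x‖ ≤ μ.re / 16) (hκ₂ : ∀ x ≤ R, ‖κ₂ x‖ ≤ μ.re / 16) (hμ : 0 < μ.re) :
    ∃ e' : ℝ → ℝ, ∀ x ≤ R, HasDerivAt (fun y => 16 * ‖g y‖ ^ 2 - ‖f y‖ ^ 2) (e' x) x ∧
      e' x ≤ -(μ.re * (‖f x‖ ^ 2 + ‖g x‖ ^ 2)) := by
  refine ⟨fun x => 16 * (2 * inner ℝ (g x) (-μ * g x + κ₂ x * f x)) -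
    2 * inner ℝ (f x) (μ * f x + κ₁ x * g x), fun x hx => ⟨?_, ?_⟩⟩
  · exact ((hg x hx).norm_sq.const_mul 16).sub (hf x hx).norm_sq
  · dsimp only
    rw [inner_add_right, inner_add_right, real_inner_self_mul, real_inner_self_mul, neg_re]
    have h1 := real_inner_mul_le (g x) (f x) (κ₂ x) (hκ₂ x hx)
    have h2 := real_inner_mul_le (f x) (-g x) (κ₁ x) (hκ₁ x hx)
    rw [mul_neg, inner_neg_right, norm_neg] at h2
    nlinarith [mul_nonneg hμ.le (sq_nonneg (‖f x‖ - ‖g x‖)), mul_nonneg hμ.le (sq_nonneg ‖g x‖),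
      mul_nonneg hμ.le (sq_nonneg ‖f x‖)]

/-- A solution that stays bounded at `-∞` lies in the cone `4 |g| ≤ |f|`, is square integrable, and
vanishes to the left of any of its zeros. -/
theorem bounded_solution_at_bot
    (hf : ∀ x ≤ R, HasDerivAt f (μ * f x + κ₁ x * g x) x)
    (hg : ∀ x ≤ R, HasDerivAt g (-μ * g x + κ₂ x * f x) x)
    (hκ₁ : ∀ x ≤ R, ‖κ₁ x‖ ≤ μ.re / 16) (hκ₂ : ∀ x ≤ R, ‖κ₂ x‖ ≤ μ.re / 16) (hμ : 0 < μ.re)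
    (hM : ∀ᶠ x in atBot, ‖f x‖ ≤ M ∧ ‖g x‖ ≤ M) :
    (∀ x ≤ R, 4 * ‖g x‖ ≤ ‖f x‖) ∧ IntegrableOn (fun x => ‖f x‖ ^ 2 + ‖g x‖ ^ 2) (Iic R) ∧
      ∀ x ≤ R, f x = 0 → ∀ y < x, f y = 0 := by
  obtain ⟨e', he'⟩ := energy_hasDerivAt hf hg hκ₁ hκ₂ hμ
  set E := fun y => 16 * ‖g y‖ ^ 2 - ‖f y‖ ^ 2 with hE
  have hanti : ∀ x y, x ≤ y → y ≤ R → E y ≤ E x := fun x y hxy hy =>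
    le_of_hasDerivAt_nonpos hxy (fun r hr => (he' r (hr.2.trans hy)).1) fun r hr =>
      ((he' r (hr.2.trans hy)).2).trans (by
        have : 0 ≤ μ.re * (‖f r‖ ^ 2 + ‖g r‖ ^ 2) := by positivity
        linarith)
  have hbd : ∀ᶠ x in atBot, E x ≤ 16 * M ^ 2 := by
    filter_upwards [hM] with x hx
    have : ‖g x‖ ^ 2 ≤ M ^ 2 := by gcongr; exact hx.2
    simp only [hE]; nlinarith [sq_nonneg ‖f x‖]
  have hneg : ∀ x ≤ R, E x ≤ 0 := by
    intro x hx
    by_contra! hpos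
    -- A positive energy grows linearly towards `-∞`, which contradicts boundedness.
    have hlin : ∀ T ≤ x, E x + μ.re * E x / 16 * (x - T) ≤ E T := by
      intro T hT
      have := le_of_hasDerivAt_nonpos (f := fun r => E r + μ.re * E x / 16 * r) hT
        (fun r hr => (he' r (hr.2.trans hx)).1.add ((hasDerivAt_id r).const_mul _)) (fun r hr => by
          have h1 := hanti r x hr.2 hx
          have h2 := (he' r (hr.2.trans hx)).2
          have h3 : E x ≤ 16 * (‖f r‖ ^ 2 + ‖g r‖ ^ 2) := by
            refine h1.trans ?_
            simp only [hE]; nlinarith [sq_nonneg ‖f r‖]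
          nlinarith)
      linarith
    obtain ⟨T, hT1, hT2, hT3⟩ := (hbd.and ((eventually_le_atBot x).and
      (eventually_lt_atBot (x - 16 * M ^ 2 / (μ.re * E x / 16))))).exists
    have h1 := hlin T hT2
    have h2 : 0 < μ.re * E x / 16 := by positivity
    have h3 : 16 * M ^ 2 < μ.re * E x / 16 * (x - T) := by
      rw [← div_lt_iff₀' h2]; linarith
    linarith
  have cf : ContinuousOn f (Iic R) := fun x hx => (hf x hx).continuousAt.continuousWithinAt
  have cg : ContinuousOn g (Iic R) := fun x hx => (hg x hx).continuousAt.continuousWithinAt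
  have cP : ContinuousOn (fun x => ‖f x‖ ^ 2 + ‖g x‖ ^ 2) (Iic R) :=
    (cf.norm.pow 2).add (cg.norm.pow 2)
  refine ⟨fun x hx => ?_, ?_, fun x hx h0 y hy => ?_⟩
  · have := hneg x hx
    simp only [hE] at this
    refine (sq_le_sq₀ (by positivity) (norm_nonneg _)).1 ?_
    nlinarith
  · have hI : ∀ T, IntegrableOn (fun x => ‖f x‖ ^ 2 + ‖g x‖ ^ 2) (Icc T R) := fun T =>
      (cP.mono Icc_subset_Iic_self).integrableOn_Icc
    refine integrableOn_Iic_of_intervalIntegral_norm_bounded (l := atBot) (a := id)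
      ((16 * M ^ 2 - E R) / μ.re) R (fun T => (hI T).mono_set Ioc_subset_Icc_self) tendsto_id ?_
    filter_upwards [hbd, eventually_le_atBot R] with T hT hTR
    have key := intervalIntegral.integral_le_sub_of_hasDeriv_right_of_le
      (g := fun x => -E x / μ.re) (g' := fun x => -e' x / μ.re)
      (φ := fun x => ‖f x‖ ^ 2 + ‖g x‖ ^ 2) hTR
      (fun x hx => ((he' x hx.2).1.neg.div_const _).continuousAt.continuousWithinAt)
      (fun x hx => ((he' x hx.2.le).1.neg.div_const _).hasDerivWithinAt) (hI T)
      (fun x hx => by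
        rw [le_div_iff₀ hμ]
        linarith [(he' x hx.2.le).2])
    have hn : ∀ x, ‖‖f x‖ ^ 2 + ‖g x‖ ^ 2‖ = ‖f x‖ ^ 2 + ‖g x‖ ^ 2 := fun x =>
      Real.norm_of_nonneg (by positivity)
    simp only [hn, id]
    refine key.trans ?_
    rw [← sub_div]
    exact div_le_div_of_nonneg_right (by linarith) hμ.le
  · have hgx : g x = 0 := by
      have := hneg x hx
      simp only [hE, h0, norm_zero] at this
      have : ‖g x‖ ^ 2 ≤ 0 := by nlinarith
      simpa using this
    have hEx : E x = 0 := by simp [hE, h0, hgx]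
    have hE0 : ∀ r ≤ x, E r = 0 := fun r hr =>
      le_antisymm (hneg r (hr.trans hx)) (hEx ▸ hanti r x hr hx)
    have hev : E =ᶠ[𝓝 y] fun _ => 0 := by
      filter_upwards [Iio_mem_nhds hy] with r hr using hE0 r (le_of_lt hr)
    have h1 := (he' y (hy.le.trans hx))
    have h2 : e' y = 0 := (h1.1.unique ((hasDerivAt_const y (0 : ℝ)).congr_of_eventuallyEq hev))
    rw [h2] at h1
    have h3 : ‖f y‖ ^ 2 + ‖g y‖ ^ 2 ≤ 0 := by
      have := h1.2
      by_contra! h4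
      nlinarith [mul_pos hμ h4]
    have h4 : ‖f y‖ ^ 2 ≤ 0 := by nlinarith [sq_nonneg ‖g y‖]
    simpa using h4

end

/-- `u` solves the system on the real axis. -/
def IsRealSolution (A S : ℂ → ℂ) (ε : ℝ) (lam : ℂ) (u : ℝ → Fin 2 → ℂ) : Prop :=
  ∀ x : ℝ, HasDerivAt (fun y => u y 0) (I / ε * (-lam * u x 0 + potential A S ε x * u x 1)) x ∧
    HasDerivAt (fun y => u y 1) (I / ε * (potentialConj A S ε x * u x 0 + lam * u x 1)) x

section
variable {A S : ℂ → ℂ} {Ω : Set ℂ} {ε : ℝ} {lam : ℂ}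

theorem IsSolution.isRealSolution (hAS : IsPotential A S Ω) (hε : ε ≠ 0)
    {u : ℂ → Fin 2 → ℂ} (hu : IsSolution A S Ω ε lam u) :
    IsRealSolution A S ε lam (fun x : ℝ => u x) := fun x =>
  ⟨(hu.hasDerivAt_zero hAS.isOpen hε (hAS.real_mem x)).comp_ofReal,
    (hu.hasDerivAt_one hAS.isOpen hε (hAS.real_mem x)).comp_ofReal⟩

theorem IsPotential.conj_potential (hAS : IsPotential A S Ω) (ε x : ℝ) :
    starRingEnd ℂ (potential A S ε x) = potentialConj A S ε x := by
  have hA : starRingEnd ℂ (A x) = A x := Complex.conj_eq_iff_im.2 (hAS.real_A x)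
  have hS : starRingEnd ℂ (S x) = S x := Complex.conj_eq_iff_im.2 (hAS.real_S x)
  simp [potential, potentialConj, ← Complex.exp_conj, hA, hS]

theorem IsPotential.norm_exp (hAS : IsPotential A S Ω) (ε x : ℝ) :
    ‖exp (I * S x / ε)‖ = 1 := by
  have hS : S x = ((S x).re : ℂ) := Complex.ext (by simp) (by simpa using hAS.real_S x)
  rw [hS, show I * ((S x).re : ℂ) / ε = (((S x).re / ε : ℝ) : ℂ) * I by push_cast; ring]
  exact Complex.norm_exp_ofReal_mul_I _

theorem IsPotential.norm_potential (hAS : IsPotential A S Ω) (ε x : ℝ) :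
    ‖potential A S ε x‖ = ‖A x‖ := by
  rw [potential, norm_mul, hAS.norm_exp]; simp

theorem IsPotential.norm_potentialConj (hAS : IsPotential A S Ω) (ε x : ℝ) :
    ‖potentialConj A S ε x‖ = ‖A x‖ := by
  rw [← hAS.conj_potential, Complex.norm_conj, hAS.norm_potential]

theorem isRealSolution_iff (hAS : IsPotential A S Ω) (hε : ε ≠ 0) {u : ℝ → Fin 2 → ℂ} :
    IsRealSolution A S ε lam u ↔ Differentiable ℝ u ∧ ∀ x, zsOperator A S ε u x = lam • u x := by
  have hε' : (ε : ℂ) ≠ 0 := by exact_mod_cast hε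
  constructor
  · intro h
    refine ⟨fun x => differentiableAt_pi.2 fun j => ?_, fun x => ?_⟩
    · fin_cases j
      · exact (h x).1.differentiableAt
      · exact (h x).2.differentiableAt
    · ext j
      fin_cases j
      · simp [zsOperator, (h x).1.deriv]
        field_simp
        ring_nf
        simp
      · simp [zsOperator, (h x).2.deriv, hAS.conj_potential]
        field_simp
        ring_nf
        simp
  · rintro ⟨h, h'⟩ x
    have d := differentiableAt_pi.1 (h x)
    have e0 := congrFun (h' x) 0
    have e1 := congrFun (h' x) 1
    simp only [zsOperator, Matrix.cons_val_zero, Matrix.cons_val_one, Pi.smul_apply, smul_eq_mul,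
      hAS.conj_potential] at e0 e1
    refine ⟨(d 0).hasDerivAt.congr_deriv ?_, (d 1).hasDerivAt.congr_deriv ?_⟩
    · have : -lam * u x 0 + potential A S ε x * u x 1 = ε / I * deriv (fun y => u y 0) x := by
        linear_combination e0
      rw [this]; field_simp
    · have : potentialConj A S ε x * u x 0 + lam * u x 1 = ε / I * deriv (fun y => u y 1) x := by
        linear_combination -e1
      rw [this]; field_simp

theorem IsRealSolution.wronskian_eq {u v : ℝ → Fin 2 → ℂ} (hu : IsRealSolution A S ε lam u)
    (hv : IsRealSolution A S ε lam v) (x y : ℝ) :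
    u x 0 * v x 1 - v x 0 * u x 1 = u y 0 * v y 1 - v y 0 * u y 1 := by
  have key : ∀ x, HasDerivAt (fun x => u x 0 * v x 1 - v x 0 * u x 1) 0 x := fun x =>
    (((hu x).1.mul (hv x).2).sub ((hv x).1.mul (hu x).2)).congr_deriv (by ring)
  exact is_const_of_deriv_eq_zero (fun x => (key x).differentiableAt) (fun x => (key x).deriv) x y

theorem IsRealSolution.continuous {u : ℝ → Fin 2 → ℂ} (hu : IsRealSolution A S ε lam u) (j : Fin 2) :
    Continuous (fun x => u x j) := by
  rw [continuous_iff_continuousAt]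
  intro x
  fin_cases j
  · exact (hu x).1.continuousAt
  · exact (hu x).2.continuousAt

theorem memLp_two_of_integrableOn {f : ℝ → ℂ} (hf : Continuous f) {s : Set ℝ}
    (h : IntegrableOn (fun x => ‖f x‖ ^ 2) s) : MemLp f 2 (volume.restrict s) :=
  (memLp_two_iff_integrable_sq_norm hf.aestronglyMeasurable).2 h

theorem integrableOn_norm_sq_of_add {f g : ℝ → ℂ} (hf : Continuous f) {s : Set ℝ}
    (h : IntegrableOn (fun x => ‖f x‖ ^ 2 + ‖g x‖ ^ 2) s) :
    IntegrableOn (fun x => ‖f x‖ ^ 2) s := by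
  refine Integrable.mono' h (hf.norm.pow 2).aestronglyMeasurable (Eventually.of_forall fun x => ?_)
  rw [Real.norm_of_nonneg (by positivity)]
  nlinarith [sq_nonneg ‖g x‖]

/-- The component that is large, for a solution decaying at `-∞`. -/
noncomputable def bigIndex (lam : ℂ) : Fin 2 := if 0 < lam.im then 0 else 1

/-- The component that is small, for a solution decaying at `-∞`. -/
noncomputable def smallIndex (lam : ℂ) : Fin 2 := if 0 < lam.im then 1 else 0

/-- `bounded_solution_at_bot` for the system on the real axis, where the coupling is `A / ε` and the
rate `|Im lam| / ε`, so that the threshold for `R` does not depend on `ε`. -/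
theorem IsRealSolution.bounded_at_bot (hAS : IsPotential A S Ω) (hε : 0 < ε) (hlam : lam.im ≠ 0)
    {R : ℝ} (hR : ∀ x : ℝ, x ≤ R → ‖A x‖ ≤ |lam.im| / 16) {u : ℝ → Fin 2 → ℂ}
    (hu : IsRealSolution A S ε lam u) {M : ℝ} (hM : ∀ᶠ x in atBot, ∀ j, ‖u x j‖ ≤ M) :
    (∀ x ≤ R, 4 * ‖u x (smallIndex lam)‖ ≤ ‖u x (bigIndex lam)‖) ∧
      (∀ j, MemLp (fun x => u x j) 2 (volume.restrict (Iic R))) ∧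
      ∀ x ≤ R, u x (bigIndex lam) = 0 → ∀ y < x, u y = 0 := by
  have hκ : ∀ x ≤ R, ∀ w : ℂ, ‖w‖ = ‖A x‖ → ‖I / ε * w‖ ≤ |lam.im| / ε / 16 := by
    intro x hx w hw
    rw [norm_mul, norm_div, norm_I, Complex.norm_real, Real.norm_of_nonneg hε.le, hw,
      show |lam.im| / ε / 16 = 1 / ε * (|lam.im| / 16) by ring]
    gcongr
    exact hR x hx
  have zero : ∀ x ≤ R, 4 * ‖u x (smallIndex lam)‖ ≤ ‖u x (bigIndex lam)‖ →
      u x (bigIndex lam) = 0 → u x = 0 := by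
    intro x hx h h0
    have h1 : u x (smallIndex lam) = 0 := by
      rw [h0, norm_zero] at h
      have : ‖u x (smallIndex lam)‖ ≤ 0 := by linarith
      simpa using this
    ext j
    simp only [bigIndex, smallIndex] at h0 h1
    split_ifs at h0 h1 <;> fin_cases j <;> assumption
  rcases lt_or_gt_of_ne hlam with hl | hl
  · have hb : bigIndex lam = 1 := by simp [bigIndex, hl.le]
    have hs : smallIndex lam = 0 := by simp [smallIndex, hl.le]
    have hm : (I * lam / ε).re = |lam.im| / ε := by
      rw [Complex.div_ofReal_re, abs_of_neg hl]; simp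
    obtain ⟨k1, k2, k3⟩ := bounded_solution_at_bot (f := fun x => u x 1) (g := fun x => u x 0)
      (κ₁ := fun x => I / ε * potentialConj A S ε x) (κ₂ := fun x => I / ε * potential A S ε x)
      (μ := I * lam / ε) (R := R) (M := M)
      (fun x _ => (hu x).2.congr_deriv (by ring)) (fun x _ => (hu x).1.congr_deriv (by ring))
      (fun x hx => hm ▸ hκ x hx _ (hAS.norm_potentialConj ε x))
      (fun x hx => hm ▸ hκ x hx _ (hAS.norm_potential ε x))
      (by rw [hm]; positivity) (hM.mono fun x hx => ⟨hx 1, hx 0⟩)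
    rw [hb, hs] at zero ⊢
    refine ⟨k1, fun j => ?_, fun x hx h0 y hy =>
      zero y (hy.le.trans hx) (k1 y (hy.le.trans hx)) (k3 x hx h0 y hy)⟩
    fin_cases j
    · exact memLp_two_of_integrableOn (hu.continuous 0)
        (integrableOn_norm_sq_of_add (g := fun x => u x 1) (hu.continuous 0)
          (by simpa only [add_comm] using k2))
    · exact memLp_two_of_integrableOn (hu.continuous 1)
        (integrableOn_norm_sq_of_add (hu.continuous 1) k2)
  · have hb : bigIndex lam = 0 := by simp [bigIndex, hl]
    have hs : smallIndex lam = 1 := by simp [smallIndex, hl]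
    have hm : (-(I * lam) / ε).re = |lam.im| / ε := by
      rw [Complex.div_ofReal_re, abs_of_pos hl]; simp
    obtain ⟨k1, k2, k3⟩ := bounded_solution_at_bot (f := fun x => u x 0) (g := fun x => u x 1)
      (κ₁ := fun x => I / ε * potential A S ε x) (κ₂ := fun x => I / ε * potentialConj A S ε x)
      (μ := -(I * lam) / ε) (R := R) (M := M)
      (fun x _ => (hu x).1.congr_deriv (by ring)) (fun x _ => (hu x).2.congr_deriv (by ring))
      (fun x hx => hm ▸ hκ x hx _ (hAS.norm_potential ε x))
      (fun x hx => hm ▸ hκ x hx _ (hAS.norm_potentialConj ε x))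
      (by rw [hm]; positivity) (hM.mono fun x hx => ⟨hx 0, hx 1⟩)
    rw [hb, hs] at zero ⊢
    refine ⟨k1, fun j => ?_, fun x hx h0 y hy =>
      zero y (hy.le.trans hx) (k1 y (hy.le.trans hx)) (k3 x hx h0 y hy)⟩
    fin_cases j
    · exact memLp_two_of_integrableOn (hu.continuous 0)
        (integrableOn_norm_sq_of_add (hu.continuous 0) k2)
    · exact memLp_two_of_integrableOn (hu.continuous 1)
        (integrableOn_norm_sq_of_add (g := fun x => u x 0) (hu.continuous 1)
          (by simpa only [add_comm] using k2))

/-- The Wronskian of two square integrable solutions is constant and integrable over a set of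
infinite measure. -/
theorem wronskian_eq_zero_of_memLp {u v : ℝ → Fin 2 → ℂ} (hu : IsRealSolution A S ε lam u)
    (hv : IsRealSolution A S ε lam v) {s : Set ℝ} (hs : volume s = ⊤)
    (hu2 : ∀ j, MemLp (fun x => u x j) 2 (volume.restrict s))
    (hv2 : ∀ j, MemLp (fun x => v x j) 2 (volume.restrict s)) (x : ℝ) :
    u x 0 * v x 1 - v x 0 * u x 1 = 0 := by
  have h := ((hu2 0).integrable_mul (hv2 1)).sub ((hv2 0).integrable_mul (hu2 1))
  have h2 : IntegrableOn (fun _ : ℝ => u x 0 * v x 1 - v x 0 * u x 1) s := by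
    refine h.congr (Eventually.of_forall fun y => ?_)
    exact hu.wronskian_eq hv y x
  rw [integrableOn_const_iff, hs] at h2
  simpa using h2

/-- Let `p`, `q` be solutions that are square integrable at `-∞` and at `+∞`, respectively. The
eigenvalues are the zeros of their Wronskian. -/
theorem isEigenvalue_iff_wronskian (hAS : IsPotential A S Ω) (hε : ε ≠ 0)
    {p q v : ℂ → Fin 2 → ℂ} (hp : IsSolution A S Ω ε lam p) (hq : IsSolution A S Ω ε lam q)
    (hv : IsSolution A S Ω ε lam v) {R R' : ℝ}
    (hp2 : ∀ j, MemLp (fun x : ℝ => p x j) 2 (volume.restrict (Iic R)))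
    (hq2 : ∀ j, MemLp (fun x : ℝ => q x j) 2 (volume.restrict (Ici R')))
    (hp0 : ∀ x ∈ Ω, p x ≠ 0) {x : ℂ} (hx : x ∈ Ω) (hqv : wronskian q v x ≠ 0) :
    IsEigenvalue A S ε lam ↔ wronskian p q x = 0 := by
  have hpr := hp.isRealSolution hAS hε
  have hqr := hq.isRealSolution hAS hε
  have hpre := hAS.isPreconnected
  constructor
  · rintro ⟨u, hu0, hud, hu2, hu⟩
    have hur := (isRealSolution_iff hAS hε).2 ⟨hud, hu⟩
    obtain ⟨y, hy⟩ : ∃ y, u y ≠ 0 := by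
      by_contra! h; exact hu0 (funext h)
    have w1 := wronskian_eq_zero_of_memLp hur hpr (s := Iic R) (by simp)
      (fun j => (hu2 j).restrict _) hp2 y
    have w2 := wronskian_eq_zero_of_memLp hur hqr (s := Ici R') (by simp)
      (fun j => (hu2 j).restrict _) hq2 y
    rw [hp.wronskian_eq hq hAS.isOpen hpre hε hx (hAS.real_mem y), wronskian_apply]
    by_cases h0 : u y 0 = 0
    · have h1 : u y 1 ≠ 0 := by
        intro h1; apply hy; ext j; fin_cases j <;> simp [h0, h1]
      apply mul_left_cancel₀ h1
      linear_combination p y 1 * w2 - q y 1 * w1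
    · apply mul_left_cancel₀ h0
      linear_combination p y 0 * w2 - q y 0 * w1
  · intro hW
    -- `p` is a multiple of `q`.
    set k := wronskian p v x / wronskian q v x with hk
    have hpk : ∀ y ∈ Ω, ∀ j, p y j = k * q y j := by
      intro y hy j
      have e1 := hp.wronskian_eq hv hAS.isOpen hpre hε hx hy
      have e2 := hq.wronskian_eq hv hAS.isOpen hpre hε hx hy
      have e3 := hp.wronskian_eq hq hAS.isOpen hpre hε hx hy
      rw [hk, div_mul_eq_mul_div, eq_div_iff hqv, e1, e2]
      rw [hW] at e3
      simp only [wronskian_apply] at e3 ⊢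
      fin_cases j
      · simp only [Fin.zero_eta, Fin.isValue]; linear_combination v y 0 * e3
      · simp only [Fin.mk_one, Fin.isValue]; linear_combination v y 1 * e3
    obtain ⟨h1, h2⟩ := (isRealSolution_iff hAS hε).1 hpr
    refine ⟨fun x : ℝ => p x, ?_, h1, fun j => ?_, h2⟩
    · intro h
      exact hp0 _ (hAS.real_mem 0) (congrFun h 0)
    · have l3 : MemLp (fun x : ℝ => p x j) 2 (volume.restrict (Ici R')) := by
        refine ((hq2 j).const_mul k).congr_norm (hpr.continuous j).aestronglyMeasurable
          (Eventually.of_forall fun y => ?_)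
        rw [hpk y (hAS.real_mem y) j]
      have i1 := (memLp_two_iff_integrable_sq_norm
        (hpr.continuous j).aestronglyMeasurable).1 (hp2 j)
      have i3 := (memLp_two_iff_integrable_sq_norm
        (hpr.continuous j).aestronglyMeasurable).1 l3
      have i2 : IntegrableOn (fun x : ℝ => ‖p x j‖ ^ 2) (Icc R R') :=
        ((hpr.continuous j).norm.pow 2).continuousOn.integrableOn_Icc
      refine (memLp_two_iff_integrable_sq_norm (hpr.continuous j).aestronglyMeasurable).2 ?_
      have i4 := (IntegrableOn.union (IntegrableOn.union i1 i2) i3)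
      rw [← integrableOn_univ]
      refine i4.mono_set fun y _ => ?_
      rcases le_total y R with h | h
      · exact Or.inl (Or.inl h)
      · rcases le_total y R' with h' | h'
        · exact Or.inl (Or.inr ⟨h, h'⟩)
        · exact Or.inr h'

end

/-! ### Frames at the left end of the real axis -/

theorem pos_or_neg_of_ne_zero {f : ℝ → ℝ} {s : Set ℝ} (hs : IsPreconnected s)
    (hf : ContinuousOn f s) (h : ∀ x ∈ s, f x ≠ 0) : (∀ x ∈ s, 0 < f x) ∨ ∀ x ∈ s, f x < 0 := by
  by_contra! hcon
  obtain ⟨⟨x, hx, hx0⟩, ⟨y, hy, hy0⟩⟩ := hcon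
  obtain ⟨w, hw, hw0⟩ := hs.intermediate_value hx hy hf ⟨hx0, hy0⟩
  exact h w hw hw0

theorem re_ne_zero_of_sq_mem_slitPlane {w : ℂ} (h : w ^ 2 ∈ slitPlane) : w.re ≠ 0 := by
  intro h0
  rw [Complex.mem_slitPlane_iff] at h
  simp [pow_two, h0] at h
  nlinarith [mul_self_nonneg w.im]

section
variable {A S : ℂ → ℂ} {Ω : Set ℂ} {lam₀ : ℂ} {F : Family}

/-- Two continuous branches of `√V₀` on a connected set that agree in the limit `lam → lam₀` at one
point agree in this limit everywhere. -/
theorem tendsto_deriv_of_tendsto (hAS : IsPotential A S Ω)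
    (hF : ∀ᶠ lam in 𝓝 lam₀, IsFrame A S Ω lam (F.D lam) (F.z lam) (F.H lam))
    (hmem : ∀ x ∈ F.D lam₀, ∀ᶠ q : ℂ × ℂ in 𝓝 (lam₀, x), q.2 ∈ F.D q.1)
    (hconn : IsPreconnected (F.D lam₀)) {x₀ : ℂ} (hx₀ : x₀ ∈ F.D lam₀)
    (h : Tendsto (fun lam => deriv (F.z lam) x₀) (𝓝 lam₀) (𝓝 (deriv (F.z lam₀) x₀)))
    {x : ℂ} (hx : x ∈ F.D lam₀) :
    Tendsto (fun q : ℂ × ℂ => deriv (F.z q.1) q.2) (𝓝 (lam₀, x)) (𝓝 (deriv (F.z lam₀) x)) := by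
  have F0 := hF.self_of_nhds
  set P : ℂ → Prop := fun x =>
    Tendsto (fun lam => deriv (F.z lam) x) (𝓝 lam₀) (𝓝 (deriv (F.z lam₀) x)) with hP
  have loc : ∀ x ∈ F.D lam₀, ∃ N ∈ 𝓝 x, ∀ y ∈ N, y ∈ F.D lam₀ → P y → ∀ w ∈ N,
      w ∈ F.D lam₀ → Tendsto (fun q : ℂ × ℂ => deriv (F.z q.1) q.2) (𝓝 (lam₀, w))
        (𝓝 (deriv (F.z lam₀) w)) := by
    intro x hx
    set v := deriv (F.z lam₀) x with hv
    have hv0 : v ≠ 0 := F0.deriv_ne hx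
    have hq : Tendsto (fun q : ℂ × ℂ => V0 A S q.1 q.2 / v ^ 2) (𝓝 (lam₀, x)) (𝓝 1) := by
      have := (hAS.continuousAt_V0 (lam₀ := lam₀) (F0.subset hx)).div_const (v ^ 2)
      rw [ContinuousAt] at this
      rwa [← F0.deriv_sq hx, ← hv, div_self (pow_ne_zero 2 hv0)] at this
    have hs := hq.eventually (isOpen_slitPlane.mem_nhds one_mem_slitPlane)
    have hall := (hs.and (hmem x hx))
    rw [nhds_prod_eq, eventually_prod_iff] at hall
    obtain ⟨pa, ha, pb, hb, hab⟩ := hall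
    obtain ⟨r, hr, hrb⟩ := Metric.eventually_nhds_iff_ball.1 hb
    refine ⟨Metric.ball x r, Metric.ball_mem_nhds _ hr, fun y hy hyD hPy w hw hwD => ?_⟩
    -- The real part of the quotient with `v` has a constant sign on the ball.
    have sgn : ∀ᶠ lam in 𝓝 lam₀, (∀ y ∈ Metric.ball x r, (deriv (F.z lam) y / v).re ≠ 0) ∧
        ContinuousOn (fun y => (deriv (F.z lam) y / v).re) (Metric.ball x r) := by
      filter_upwards [ha, hF] with lam h1 h2
      constructor
      · intro y hy
        apply re_ne_zero_of_sq_mem_slitPlane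
        rw [div_pow, h2.deriv_sq (hab h1 (hrb y hy)).2]
        exact (hab h1 (hrb y hy)).1
      · intro y hy
        exact (continuous_re.continuousAt.comp (((h2.holo_z.deriv h2.isOpen).differentiableAt
          (h2.isOpen.mem_nhds (hab h1 (hrb y hy)).2)).continuousAt.div_const
            v)).continuousWithinAt
    have same : ∀ᶠ lam in 𝓝 lam₀, ∀ y ∈ Metric.ball x r, ∀ y' ∈ Metric.ball x r,
        0 < (deriv (F.z lam) y / v).re → 0 < (deriv (F.z lam) y' / v).re := by
      filter_upwards [sgn] with lam h1 y hy y' hy' hpos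
      by_contra! hneg
      obtain ⟨w, hw, hw0⟩ := (convex_ball x r).isPreconnected.intermediate_value hy' hy h1.2
        ⟨hneg, hpos.le⟩
      exact h1.1 w hw hw0
    have pos0 : ∀ y ∈ Metric.ball x r, 0 < (deriv (F.z lam₀) y / v).re := fun y hy =>
      same.self_of_nhds x (Metric.mem_ball_self hr) y hy (by rw [← hv, div_self hv0]; simp)
    have hy1 : ∀ᶠ lam in 𝓝 lam₀, 0 < (deriv (F.z lam) y / v).re := by
      have : Tendsto (fun lam => (deriv (F.z lam) y / v).re) (𝓝 lam₀)
          (𝓝 (deriv (F.z lam₀) y / v).re) := (continuous_re.tendsto _).comp (hPy.div_const v)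
      exact this.eventually_const_lt (pos0 y hy)
    have hposj : ∀ᶠ q : ℂ × ℂ in 𝓝 (lam₀, w),
        deriv (F.z q.1) q.2 = v * (V0 A S q.1 q.2 / v ^ 2) ^ (2⁻¹ : ℂ) := by
      have e1 : ∀ᶠ q : ℂ × ℂ in 𝓝 (lam₀, w), q.2 ∈ Metric.ball x r :=
        continuous_snd.continuousAt.eventually (Metric.isOpen_ball.mem_nhds hw)
      have e2 : ∀ᶠ q : ℂ × ℂ in 𝓝 (lam₀, w), pa q.1 ∧ 0 < (deriv (F.z q.1) y / v).re ∧
          (∀ y ∈ Metric.ball x r, ∀ y' ∈ Metric.ball x r,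
            0 < (deriv (F.z q.1) y / v).re → 0 < (deriv (F.z q.1) y' / v).re) ∧
          IsFrame A S Ω q.1 (F.D q.1) (F.z q.1) (F.H q.1) :=
        (continuous_fst.tendsto (lam₀, w)).eventually (ha.and (hy1.and (same.and hF)))
      filter_upwards [e1, e2] with q h1 h2
      have h3 := h2.2.2.1 y hy q.2 h1 h2.2.1
      rw [← h2.2.2.2.deriv_sq (hab h2.1 (hrb _ h1)).2, ← div_pow, Complex.sq_cpow_two_inv h3,
        mul_div_cancel₀ _ hv0]
    have hw' := (hab ha.self_of_nhds (hrb w hw)).1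
    have hval := hposj.self_of_nhds
    simp only at hval
    rw [hval]
    refine Tendsto.congr' (hposj.mono fun _ h => h.symm) ?_
    have c : ContinuousAt (fun q : ℂ × ℂ => V0 A S q.1 q.2 / v ^ 2) (lam₀, w) :=
      (hAS.continuousAt_V0 (F0.subset hwD)).div_const _
    exact (c.cpow continuousAt_const hw').const_mul v
  have key : P x₀ ↔ P x := by
    refine hconn.induction₂ (fun x y => P x ↔ P y) ?_ (fun _ _ _ _ _ _ => Iff.trans)
      (fun _ _ _ _ => Iff.symm) hx₀ hx
    intro x hx
    obtain ⟨N, hN, h⟩ := loc x hx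
    have sl : ∀ w : ℂ, Tendsto (fun lam : ℂ => (lam, w)) (𝓝 lam₀) (𝓝 (lam₀, w)) := fun w =>
      (Continuous.prodMk_left w).tendsto lam₀
    filter_upwards [nhdsWithin_le_nhds hN, self_mem_nhdsWithin] with y hy hyD
    exact ⟨fun hp => (h x (mem_of_mem_nhds hN) hx hp y hy hyD).comp (sl y),
      fun hp => (h y hy hyD hp x (mem_of_mem_nhds hN) hx).comp (sl x)⟩
  obtain ⟨N, hN, hloc⟩ := loc x hx
  exact hloc x (mem_of_mem_nhds hN) hx (key.1 h) x (mem_of_mem_nhds hN) hx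

theorem IsPotential.tendsto_A_atBot (hAS : IsPotential A S Ω) :
    Tendsto (fun q : ℂ × ℝ => A q.2) (𝓝 lam₀ ×ˢ atBot) (𝓝 0) :=
  (hAS.zero_A.mono_left atBot_le_cocompact).comp tendsto_snd

theorem IsPotential.tendsto_gPlus_atBot (hAS : IsPotential A S Ω) :
    Tendsto (fun q : ℂ × ℝ => gPlus A S q.1 q.2) (𝓝 lam₀ ×ˢ atBot) (𝓝 (-lam₀)) := by
  have h1 := hAS.tendsto_A_atBot (lam₀ := lam₀)
  have h2 : Tendsto (fun q : ℂ × ℝ => deriv S q.2) (𝓝 lam₀ ×ˢ atBot) (𝓝 0) :=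
    (hAS.zero_S'.mono_left atBot_le_cocompact).comp tendsto_snd
  have h3 : Tendsto (fun q : ℂ × ℝ => q.1) (𝓝 lam₀ ×ˢ atBot) (𝓝 lam₀) := tendsto_fst
  have := ((h3.add (h2.div_const 2)).add (h1.const_mul I)).neg
  simpa [gPlus] using this

theorem IsPotential.tendsto_V0_atBot (hAS : IsPotential A S Ω) :
    Tendsto (fun q : ℂ × ℝ => V0 A S q.1 q.2) (𝓝 lam₀ ×ˢ atBot) (𝓝 (-lam₀ ^ 2)) := by
  have h1 := hAS.tendsto_A_atBot (lam₀ := lam₀)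
  have h2 : Tendsto (fun q : ℂ × ℝ => deriv S q.2) (𝓝 lam₀ ×ˢ atBot) (𝓝 0) :=
    (hAS.zero_S'.mono_left atBot_le_cocompact).comp tendsto_snd
  have h3 : Tendsto (fun q : ℂ × ℝ => q.1) (𝓝 lam₀ ×ˢ atBot) (𝓝 lam₀) := tendsto_fst
  have := (((h3.add (h2.div_const 2)).pow 2).neg).sub (h1.pow 2)
  simpa [V0] using this

theorem neg_sq_mem_slitPlane {lam : ℂ} (h : lam.im ≠ 0) : -lam ^ 2 ∈ slitPlane := by
  rw [Complex.mem_slitPlane_iff]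
  by_cases h0 : lam.re = 0
  · left; simp [pow_two, h0]; positivity
  · right; simp [pow_two]; exact fun h' => (mul_ne_zero h0 h) (by linarith)

/-- Far to the left on the real axis, `Re z` is monotone. -/
theorem re_deriv_pos_or_neg (hAS : IsPotential A S Ω) (hlam₀ : lam₀.im ≠ 0)
    (hF : ∀ᶠ lam in 𝓝 lam₀, IsFrame A S Ω lam (F.D lam) (F.z lam) (F.H lam))
    (hfar : ∀ᶠ q : ℂ × ℝ in 𝓝 lam₀ ×ˢ atBot, (q.2 : ℂ) ∈ F.D q.1) :
    ∀ᶠ R : ℝ in atBot, ∀ᶠ lam in 𝓝 lam₀, (∀ x : ℝ, x ≤ R → (x : ℂ) ∈ F.D lam) ∧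
      ((∀ x : ℝ, x ≤ R → 0 < (deriv (F.z lam) x).re) ∨
        ∀ x : ℝ, x ≤ R → (deriv (F.z lam) x).re < 0) := by
  have h1 := (hAS.tendsto_V0_atBot (lam₀ := lam₀)).eventually
    (isOpen_slitPlane.mem_nhds (neg_sq_mem_slitPlane hlam₀))
  have h2 := hfar.and h1
  rw [eventually_prod_iff] at h2
  obtain ⟨pa, ha, pb, hb, hab⟩ := h2
  obtain ⟨R₀, hR₀⟩ := eventually_atBot.1 hb
  filter_upwards [eventually_le_atBot R₀] with R hR
  filter_upwards [ha, hF] with lam hl hf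
  have hD : ∀ x : ℝ, x ≤ R → (x : ℂ) ∈ F.D lam := fun x hx => (hab hl (hR₀ x (hx.trans hR))).1
  refine ⟨hD, pos_or_neg_of_ne_zero (f := fun x : ℝ => (deriv (F.z lam) x).re) (s := Iic R)
    isPreconnected_Iic ?_ ?_⟩
  · intro x hx
    have := ((hf.holo_z.deriv hf.isOpen).differentiableAt
      (hf.isOpen.mem_nhds (hD x hx))).continuousAt
    exact (continuous_re.continuousAt.comp (ContinuousAt.comp (f := fun x : ℝ => (x : ℂ)) this
      continuous_ofReal.continuousAt)).continuousWithinAt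
  · intro x hx
    apply re_ne_zero_of_sq_mem_slitPlane
    rw [hf.deriv_sq (hD x hx)]
    exact (hab hl (hR₀ x (le_trans hx hR))).2

/-- `Re z` increases on the real axis near `-∞`, uniformly in the spectral parameter. -/
def IncreasesAtBot (lam₀ : ℂ) (F : Family) : Prop :=
  ∀ᶠ R : ℝ in atBot, ∀ᶠ lam in 𝓝 lam₀, ∀ x : ℝ, x ≤ R →
    (x : ℂ) ∈ F.D lam ∧ 0 < (deriv (F.z lam) x).re

theorem IsFrame.hasDerivAt_re {lam : ℂ} {D : Set ℂ} {z H : ℂ → ℂ} (h : IsFrame A S Ω lam D z H)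
    {x : ℝ} (hx : (x : ℂ) ∈ D) : HasDerivAt (fun y : ℝ => (z y).re) (deriv z x).re x := by
  have h1 := (h.hasDerivAt_z hx).comp_ofReal
  exact (reCLM.hasFDerivAt.comp_hasDerivAt x h1)

theorem increasesAtBot_of_tendsto (hAS : IsPotential A S Ω) (hlam₀ : lam₀.im ≠ 0)
    (hF : ∀ᶠ lam in 𝓝 lam₀, IsFrame A S Ω lam (F.D lam) (F.z lam) (F.H lam))
    (hfar : ∀ᶠ q : ℂ × ℝ in 𝓝 lam₀ ×ˢ atBot, (q.2 : ℂ) ∈ F.D q.1)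
    (h : ∀ᶠ lam in 𝓝 lam₀, Tendsto (fun x : ℝ => (F.z lam x).re) atBot atBot) :
    IncreasesAtBot lam₀ F := by
  filter_upwards [re_deriv_pos_or_neg hAS hlam₀ hF hfar] with R hR
  filter_upwards [hR, h, hF] with lam h1 h2 h3 x hx
  refine ⟨h1.1 x hx, ?_⟩
  rcases h1.2 with h4 | h4
  · exact h4 x hx
  · exfalso
    obtain ⟨y, hy1, hy2⟩ := ((h2.eventually (eventually_lt_atBot (F.z lam R).re)).and
      (eventually_le_atBot R)).exists
    have := le_of_hasDerivAt_nonpos hy2 (fun r hr => h3.hasDerivAt_re (h1.1 r hr.2))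
      (fun r hr => (h4 r hr.2).le)
    linarith

theorem IsFamily.increasesAtBot_of_frequently (hAS : IsPotential A S Ω) (hlam₀ : lam₀.im ≠ 0)
    (hF : IsFamily A S Ω lam₀ F)
    (hfar : ∀ᶠ q : ℂ × ℝ in 𝓝 lam₀ ×ˢ atBot, (q.2 : ℂ) ∈ F.D q.1)
    (h : ∃ᶠ x : ℝ in atBot, 0 ≤ (deriv (F.z lam₀) x).re) : IncreasesAtBot lam₀ F := by
  filter_upwards [re_deriv_pos_or_neg hAS hlam₀ hF.frame hfar] with R hR
  obtain ⟨y, hy1, hy2⟩ := (h.and_eventually (eventually_le_atBot R)).exists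
  have h0 := hR.self_of_nhds
  have hy3 : 0 < (deriv (F.z lam₀) y).re := by
    rcases h0.2 with h4 | h4
    · exact h4 y hy2
    · exact absurd (h4 y hy2) (not_lt.2 hy1)
  have hc : Tendsto (fun lam => (deriv (F.z lam) y).re) (𝓝 lam₀)
      (𝓝 (deriv (F.z lam₀) y).re) :=
    (continuous_re.tendsto _).comp ((hF.cont _ (h0.1 y hy2)).comp
      ((Continuous.prodMk_left (y : ℂ)).tendsto lam₀))
  filter_upwards [hR, hc.eventually_const_lt hy3] with lam h1 h2 x hx
  refine ⟨h1.1 x hx, ?_⟩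
  rcases h1.2 with h4 | h4
  · exact h4 x hx
  · exact absurd (h4 y hy2) (not_lt.2 h2.le)

/-- The sign of the imaginary part of the spectral parameter. -/
noncomputable def imSign (lam : ℂ) : ℂ := if 0 < lam.im then 1 else -1

theorem re_imSign_mul {lam : ℂ} (h : lam.im ≠ 0) : 0 < (-I * imSign lam * lam).re := by
  rw [imSign]
  split_ifs with h'
  · simpa using h'
  · have := lt_of_le_of_ne (not_lt.1 h') h
    simpa using this

theorem imSign_sq (lam : ℂ) : imSign lam ^ 2 = 1 := by
  rw [imSign]; split_ifs <;> simp

/-- Near `-∞` the branch of `z' = √V₀` is the root of `-lam²` with positive real part. -/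
theorem IncreasesAtBot.tendsto_deriv (hAS : IsPotential A S Ω) (hlam₀ : lam₀.im ≠ 0)
    (hF : ∀ᶠ lam in 𝓝 lam₀, IsFrame A S Ω lam (F.D lam) (F.z lam) (F.H lam))
    (h : IncreasesAtBot lam₀ F) :
    Tendsto (fun q : ℂ × ℝ => deriv (F.z q.1) q.2) (𝓝 lam₀ ×ˢ atBot)
      (𝓝 (-I * imSign lam₀ * lam₀)) := by
  obtain ⟨R, hR⟩ := h.exists
  have e : ∀ᶠ q : ℂ × ℝ in 𝓝 lam₀ ×ˢ atBot,
      (V0 A S q.1 q.2) ^ (2⁻¹ : ℂ) = deriv (F.z q.1) q.2 := by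
    filter_upwards [(hR.and hF).prod_inl atBot, (eventually_le_atBot R).prod_inr (𝓝 lam₀)]
      with q h1 h2
    obtain ⟨h3, h4⟩ := h1.1 q.2 h2
    rw [← h1.2.deriv_sq h3, Complex.sq_cpow_two_inv h4]
  refine Tendsto.congr' e ?_
  have e1 : -lam₀ ^ 2 = (-I * imSign lam₀ * lam₀) ^ 2 := by
    have := imSign_sq lam₀
    linear_combination (-lam₀ ^ 2 * imSign lam₀ ^ 2) * I_sq + lam₀ ^ 2 * this
  rw [← Complex.sq_cpow_two_inv (re_imSign_mul hlam₀), ← e1]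
  exact (hAS.tendsto_V0_atBot).cpow tendsto_const_nhds (neg_sq_mem_slitPlane hlam₀)

/-- A branch of `√V₀` with positive real part is the principal one, and so is continuous in the
spectral parameter. -/
theorem IncreasesAtBot.tendsto_deriv_point (hAS : IsPotential A S Ω)
    (hF : ∀ᶠ lam in 𝓝 lam₀, IsFrame A S Ω lam (F.D lam) (F.z lam) (F.H lam))
    {R : ℝ} (hR : ∀ᶠ lam in 𝓝 lam₀, (R : ℂ) ∈ F.D lam ∧ 0 < (deriv (F.z lam) R).re) :
    Tendsto (fun lam => deriv (F.z lam) R) (𝓝 lam₀) (𝓝 (deriv (F.z lam₀) R)) := by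
  have F0 := hF.self_of_nhds
  have R0 := hR.self_of_nhds
  have e : ∀ᶠ lam in 𝓝 lam₀, (V0 A S lam R) ^ (2⁻¹ : ℂ) = deriv (F.z lam) R := by
    filter_upwards [hR, hF] with lam h1 h2
    rw [← h2.deriv_sq h1.1, Complex.sq_cpow_two_inv h1.2]
  rw [← e.self_of_nhds]
  refine Tendsto.congr' e ?_
  have c : ContinuousAt (fun lam => V0 A S lam R) lam₀ :=
    ContinuousAt.comp (g := fun q : ℂ × ℂ => V0 A S q.1 q.2) (f := fun lam => (lam, (R : ℂ)))
      (hAS.continuousAt_V0 (hAS.real_mem R)) (by fun_prop)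
  refine c.cpow continuousAt_const ?_
  rw [← F0.deriv_sq R0.1, Complex.mem_slitPlane_iff]
  by_cases h0 : (deriv (F.z lam₀) R).im = 0
  · left
    simp only [pow_two, mul_re, h0, mul_zero, sub_zero]
    exact mul_pos R0.2 R0.2
  · right
    simp only [pow_two, mul_im]
    intro h
    exact mul_ne_zero R0.2.ne' h0 (by linarith)

/-- `H²` tends to `± I`, the sign being that of `Im lam₀`. -/
theorem IncreasesAtBot.tendsto_H_sq (hAS : IsPotential A S Ω) (hlam₀ : lam₀.im ≠ 0)
    (hF : ∀ᶠ lam in 𝓝 lam₀, IsFrame A S Ω lam (F.D lam) (F.z lam) (F.H lam))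
    (h : IncreasesAtBot lam₀ F) :
    Tendsto (fun q : ℂ × ℝ => F.H q.1 q.2 ^ 2) (𝓝 lam₀ ×ˢ atBot) (𝓝 (I * imSign lam₀)) := by
  have hl : lam₀ ≠ 0 := by rintro rfl; simp at hlam₀
  have h1 := (h.tendsto_deriv hAS hlam₀ hF).div hAS.tendsto_gPlus_atBot (neg_ne_zero.2 hl)
  have e : -I * imSign lam₀ * lam₀ / -lam₀ = I * imSign lam₀ := by field_simp
  rw [e] at h1
  refine h1.congr' ?_
  obtain ⟨R, hR⟩ := h.exists
  filter_upwards [(hR.and hF).prod_inl atBot, (eventually_le_atBot R).prod_inr (𝓝 lam₀)]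
    with q h1 h2
  exact (h1.2.sq _ (h1.1 q.2 h2).1).symm

end

theorem norm_exp_half {A S : ℂ → ℂ} {Ω : Set ℂ} (hAS : IsPotential A S Ω) (ε x : ℝ) :
    ‖exp (I * S x / (2 * ε))‖ = 1 ∧ ‖exp (-I * S x / (2 * ε))‖ = 1 := by
  have h := hAS.norm_exp (2 * ε) x
  have h' := hAS.norm_exp (-(2 * ε)) x
  push_cast at h h'
  refine ⟨h, ?_⟩
  rwa [div_neg, ← neg_div, ← neg_mul] at h'

/-- In the cone of decaying solutions the symbol is dominated by its even part. -/
theorem symbolOdd_le_of_cone {A S : ℂ → ℂ} {Ω : Set ℂ} (hAS : IsPotential A S Ω) {lam : ℂ}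
    {z H : ℂ → ℂ} {ε x : ℝ} {u : ℂ → Fin 2 → ℂ} (hH : H x ≠ 0)
    (hH2 : ‖H x ^ 2 - I * imSign lam‖ ≤ 1 / 4)
    (hcone : 4 * ‖u x (smallIndex lam)‖ ≤ ‖u x (bigIndex lam)‖) (h0 : u x (bigIndex lam) ≠ 0) :
    ‖symbolOdd S z H ε u x‖ ≤ ‖symbolEven S z H ε u x‖ ∧ symbolEven S z H ε u x ≠ 0 := by
  obtain ⟨n1, n2⟩ := norm_exp_half hAS ε x
  set v := exp (-I * S x / (2 * ε)) * u x 0 with hv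
  set w := exp (I * S x / (2 * ε)) * u x 1 with hw
  have hvn : ‖v‖ = ‖u x 0‖ := by rw [hv, norm_mul, n2, one_mul]
  have hwn : ‖w‖ = ‖u x 1‖ := by rw [hw, norm_mul, n1, one_mul]
  set e := H x ^ 2 - I * imSign lam with he
  have hHe : H x ^ 2 = I * imSign lam + e := by rw [he]; ring
  have m1 : mixedFst S ε u x = (v - w) / 2 := rfl
  have m2 : mixedSnd S ε u x = (v + w) / 2 := rfl
  have em : ‖e * ((v - w) / 2)‖ ≤ 1 / 8 * (‖v‖ + ‖w‖) := by
    rw [norm_mul, norm_div, Complex.norm_ofNat]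
    have := norm_sub_le v w
    calc ‖e‖ * (‖v - w‖ / 2) ≤ 1 / 4 * ((‖v‖ + ‖w‖) / 2) := by gcongr
      _ = _ := by ring
  set k := exp (-z x / ε) / (2 * H x) with hk
  have hk0 : 0 < ‖k‖ := by
    rw [norm_pos_iff, hk]; exact div_ne_zero (Complex.exp_ne_zero _) (by simpa using hH)
  have hE : symbolEven S z H ε u x = k * (H x ^ 2 * ((v - w) / 2) + I * ((v + w) / 2)) := by
    rw [symbolEven, m1, m2, hk]; field_simp
  have hO : symbolOdd S z H ε u x = k * (H x ^ 2 * ((v - w) / 2) - I * ((v + w) / 2)) := by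
    rw [symbolOdd, m1, m2, hk]; field_simp
  suffices h : ‖H x ^ 2 * ((v - w) / 2) - I * ((v + w) / 2)‖ ≤
      ‖H x ^ 2 * ((v - w) / 2) + I * ((v + w) / 2)‖ ∧
      0 < ‖H x ^ 2 * ((v - w) / 2) + I * ((v + w) / 2)‖ by
    constructor
    · rw [hE, hO, norm_mul, norm_mul]; exact mul_le_mul_of_nonneg_left h.1 (norm_nonneg _)
    · rw [← norm_pos_iff, hE, norm_mul]; exact mul_pos hk0 h.2
  have hb : 0 < ‖u x (bigIndex lam)‖ := norm_pos_iff.2 h0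
  have core : ∀ p q r : ℂ, 4 * ‖q‖ ≤ ‖p‖ → ‖r‖ ≤ 1 / 8 * (‖p‖ + ‖q‖) → 0 < ‖p‖ →
      ‖-I * q + r‖ ≤ ‖I * p + r‖ ∧ 0 < ‖I * p + r‖ := by
    intro p q r h1 h2 h3
    have a1 : ‖-I * q + r‖ ≤ ‖q‖ + ‖r‖ := (norm_add_le _ _).trans (by simp)
    have a2 : ‖p‖ - ‖r‖ ≤ ‖I * p + r‖ := by
      have := norm_sub_le (I * p + r) r
      rw [add_sub_cancel_right, norm_mul, norm_I, one_mul] at this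
      linarith
    constructor <;> linarith
  rw [hHe]
  by_cases hl : 0 < lam.im
  · simp only [bigIndex, smallIndex, imSign, hl, if_true] at *
    have := core v w _ (by rwa [hvn, hwn]) em (by rwa [hvn])
    convert this using 3 <;> ring_nf
  · simp only [bigIndex, smallIndex, imSign, hl, if_false] at *
    have := core w v (e * ((v - w) / 2)) (by rwa [hvn, hwn]) (by linarith) (by rwa [hwn])
    convert this using 3 <;> ring_nf

section
variable {A S : ℂ → ℂ} {Ω : Set ℂ} {lam₀ : ℂ} {F : Family}

/-- At a point far to the left on the real axis the decaying solution is dominated by its even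
symbol, whatever the value of `ε`. -/
theorem IncreasesAtBot.exactWKB (hAS : IsPotential A S Ω) (hlam₀ : lam₀.im ≠ 0)
    (hF : ∀ᶠ lam in 𝓝 lam₀, IsFrame A S Ω lam (F.D lam) (F.z lam) (F.H lam))
    (h : IncreasesAtBot lam₀ F) :
    ∀ᶠ R : ℝ in atBot, ∀ᶠ lam in 𝓝 lam₀, ∀ ε : ℝ, 0 < ε → ∀ u : ℂ → Fin 2 → ℂ,
      IsExactWKBAtInfinity A S Ω ε lam (F.z lam) (F.H lam) .plus atBot u →
        ‖symbolOdd S (F.z lam) (F.H lam) ε u R‖ ≤ ‖symbolEven S (F.z lam) (F.H lam) ε u R‖ ∧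
        symbolEven S (F.z lam) (F.H lam) ε u R ≠ 0 ∧
        ∀ j, MemLp (fun x : ℝ => u x j) 2 (volume.restrict (Iic R)) := by
  have t1 : ∀ᶠ q : ℂ × ℝ in 𝓝 lam₀ ×ˢ atBot, ‖F.H q.1 q.2 ^ 2 - I * imSign lam₀‖ < 1 / 4 := by
    have := ((h.tendsto_H_sq hAS hlam₀ hF).sub_const (I * imSign lam₀)).norm
    rw [sub_self, norm_zero] at this
    exact this.eventually_lt_const (by norm_num)
  have him : ∀ᶠ lam in 𝓝 lam₀, |lam.im| > |lam₀.im| / 2 := by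
    have : Tendsto (fun lam : ℂ => |lam.im|) (𝓝 lam₀) (𝓝 |lam₀.im|) :=
      (continuous_abs.comp continuous_im).tendsto _
    exact this.eventually_const_lt (half_lt_self (abs_pos.2 hlam₀))
  have t2 : ∀ᶠ q : ℂ × ℝ in 𝓝 lam₀ ×ˢ atBot, ‖A q.2‖ < |lam₀.im| / 2 / 16 := by
    have := (hAS.tendsto_A_atBot (lam₀ := lam₀)).norm
    rw [norm_zero] at this
    exact this.eventually_lt_const (by have := abs_pos.2 hlam₀; positivity)
  have t3 := t1.and t2
  rw [eventually_prod_iff] at t3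
  obtain ⟨pa, ha, pb, hb, hab⟩ := t3
  obtain ⟨R₀, hR₀⟩ := eventually_atBot.1 hb
  have hsgn : ∀ᶠ lam in 𝓝 lam₀, (0 < lam.im ↔ 0 < lam₀.im) := by
    rcases lt_or_gt_of_ne hlam₀ with hl | hl
    · filter_upwards [continuous_im.continuousAt.eventually_lt_const hl] with lam h
      exact ⟨fun h' => absurd h' (not_lt.2 h.le), fun h' => absurd h' (not_lt.2 hl.le)⟩
    · filter_upwards [continuous_im.continuousAt.eventually_const_lt hl] with lam h
      exact ⟨fun _ => hl, fun _ => h⟩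
  filter_upwards [h, eventually_le_atBot R₀] with R hR hRR
  filter_upwards [hR, ha, him, hsgn, hF] with lam h1 h2 h3 h4 h5 ε hε u hu
  have hsg : imSign lam = imSign lam₀ := by simp only [imSign, h4]
  have hlam : lam.im ≠ 0 := by
    intro h0; rw [h0, abs_zero] at h3; linarith [abs_nonneg lam₀.im]
  have hHx : ∀ x : ℝ, x ≤ R → ‖F.H lam x ^ 2 - I * imSign lam‖ ≤ 1 / 4 := fun x hx => by
    rw [hsg]; exact (hab h2 (hR₀ x (hx.trans hRR))).1.le
  have hAx : ∀ x : ℝ, x ≤ R → ‖A x‖ ≤ |lam.im| / 16 := fun x hx => by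
    have := (hab h2 (hR₀ x (hx.trans hRR))).2
    linarith
  have hHn : ∀ x : ℝ, x ≤ R → ‖F.H lam x‖ ≤ 2 ∧ ‖(F.H lam x)⁻¹‖ ≤ 2 := by
    intro x hx
    have a := hHx x hx
    have b : ‖I * imSign lam‖ = 1 := by rw [norm_mul, norm_I, imSign]; split_ifs <;> simp
    have c1 : ‖F.H lam x‖ ^ 2 ≤ 5 / 4 := by
      rw [← norm_pow]
      have := norm_add_le (F.H lam x ^ 2 - I * imSign lam) (I * imSign lam)
      rw [sub_add_cancel] at this
      linarith
    have c2 : 3 / 4 ≤ ‖F.H lam x‖ ^ 2 := by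
      rw [← norm_pow]
      have := norm_sub_le (F.H lam x ^ 2) (F.H lam x ^ 2 - I * imSign lam)
      rw [sub_sub_cancel] at this
      linarith
    have c3 : 1 / 2 ≤ ‖F.H lam x‖ := by
      by_contra! hcon
      nlinarith [norm_nonneg (F.H lam x)]
    constructor
    · nlinarith [norm_nonneg (F.H lam x)]
    · rw [norm_inv]; exact inv_le_of_inv_le₀ (by norm_num) (by linarith)
  obtain ⟨hsol, we, wo, hwe, hwo, huw⟩ := hu
  have hreal := hsol.isRealSolution hAS hε.ne'
  have hbd : ∀ᶠ x : ℝ in atBot, ∀ j, ‖u x j‖ ≤ Real.exp ((F.z lam R).re / ε) * 12 := by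
    have w1 := hwe.norm.eventually_lt_const (show ‖(1 : ℂ)‖ < 2 by simp)
    have w2 := hwo.norm.eventually_lt_const (show ‖(0 : ℂ)‖ < 1 by simp)
    filter_upwards [huw, w1, w2, eventually_le_atBot R] with x hx w1 w2 hxR j
    have key : (matrixQ S (F.H lam) ε x * WKBSign.plus.swap) *ᵥ ![we x, wo x] =
        matrixQ S (F.H lam) ε x *ᵥ ![wo x, we x] := by
      rw [← Matrix.mulVec_mulVec]
      congr 1
      ext i; fin_cases i <;> simp [WKBSign.swap, Matrix.mulVec, dotProduct, Fin.sum_univ_two]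
    have hz : (F.z lam x).re ≤ (F.z lam R).re := by
      have := le_of_hasDerivAt_nonpos (f := fun r => -(F.z lam r).re) hxR
        (fun r hr => (h5.hasDerivAt_re (h1 r hr.2).1).neg)
        (fun r hr => (neg_nonpos.2 (h1 r hr.2).2.le))
      linarith
    have he : ‖exp (WKBSign.plus.val * F.z lam x / ε)‖ ≤ Real.exp ((F.z lam R).re / ε) := by
      rw [Complex.norm_exp, WKBSign.val, one_mul, Complex.div_ofReal_re]
      gcongr
    obtain ⟨n1, n2⟩ := norm_exp_half hAS ε x
    obtain ⟨n3, n4⟩ := hHn x hxR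
    have a1 : ‖(F.H lam x)⁻¹ * (wo x + we x)‖ ≤ 2 * (1 + 2) := by
      rw [norm_mul]; gcongr; exact (norm_add_le _ _).trans (by gcongr)
    have a2 : ‖I * F.H lam x * (wo x - we x)‖ ≤ 2 * (1 + 2) := by
      rw [norm_mul, norm_mul, norm_I, one_mul]; gcongr; exact (norm_sub_le _ _).trans (by gcongr)
    rw [hx, wkbVector, key, matrixQ_mulVec, Pi.smul_apply, norm_smul]
    gcongr
    fin_cases j
    · simp only [Fin.zero_eta, Matrix.cons_val_zero]
      rw [norm_mul, n1, one_mul]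
      exact (norm_add_le _ _).trans (by linarith)
    · simp only [Fin.mk_one, Matrix.cons_val_one, Matrix.cons_val_fin_one]
      rw [norm_mul, n2, one_mul]
      exact (norm_add_le _ _).trans (by rw [norm_neg]; linarith)
  obtain ⟨k1, k2, k3⟩ := hreal.bounded_at_bot hAS hε hlam hAx hbd
  have hne : u R (bigIndex lam) ≠ 0 := by
    intro h0
    have w1 := hwe.eventually_ne one_ne_zero
    obtain ⟨x, ⟨hx1, hx2⟩, hx3⟩ := ((huw.and w1).and (eventually_lt_atBot R)).exists
    have := k3 R le_rfl h0 x hx3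
    have hs := (symbol_of_eq_wkbVector (h5.H_ne (h1 x hx3.le).1) hx1).1
    apply hx2
    rw [← hs]
    simp [symbolEven, mixedFst, mixedSnd, this]
  have key := symbolOdd_le_of_cone hAS (z := F.z lam) (ε := ε) (u := u) (h5.H_ne (h1 R le_rfl).1)
    (hHx R le_rfl) (k1 R le_rfl) hne
  exact ⟨key.1, key.2, k2⟩

end

/-! ### Branches of the logarithm, cube roots -/

/-- The plane cut along the ray opposite to the direction `exp (φ I)`. -/
def slitAt (φ : ℝ) : Set ℂ := {ξ | ξ * exp (-(φ * I)) ∈ slitPlane}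

/-- The branch of the logarithm on `slitAt φ` with imaginary part in `(φ - π, φ + π)`. -/
noncomputable def logBranch (φ : ℝ) (ξ : ℂ) : ℂ := log (ξ * exp (-(φ * I))) + φ * I

theorem isOpen_slitAt (φ : ℝ) : IsOpen (slitAt φ) :=
  isOpen_slitPlane.preimage (by fun_prop)

theorem ne_zero_of_mem_slitAt {φ : ℝ} {ξ : ℂ} (h : ξ ∈ slitAt φ) : ξ ≠ 0 := by
  rintro rfl
  simp [slitAt] at h

theorem exp_logBranch {φ : ℝ} {ξ : ℂ} (h : ξ ≠ 0) : exp (logBranch φ ξ) = ξ := by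
  rw [logBranch, exp_add, exp_log (mul_ne_zero h (exp_ne_zero _)), mul_assoc, ← exp_add]
  simp

theorem logBranch_exp {φ : ℝ} {l : ℂ} (h1 : φ - Real.pi < l.im) (h2 : l.im < φ + Real.pi) :
    exp l ∈ slitAt φ ∧ logBranch φ (exp l) = l := by
  have e : exp l * exp (-(φ * I)) = exp (l - φ * I) := by rw [← exp_add, sub_eq_add_neg]
  have him : (l - φ * I).im = l.im - φ := by simp
  have hlog : log (exp (l - φ * I)) = l - φ * I :=
    Complex.log_exp (by rw [him]; linarith) (by rw [him]; linarith)
  constructor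
  · rw [slitAt, mem_ofPred_eq, e, mem_slitPlane_iff_arg]
    refine ⟨?_, exp_ne_zero _⟩
    rw [← log_im, hlog, him]
    linarith
  · rw [logBranch, e, hlog, sub_add_cancel]

theorem hasDerivAt_logBranch {φ : ℝ} {ξ : ℂ} (h : ξ ∈ slitAt φ) :
    HasDerivAt (logBranch φ) ξ⁻¹ ξ := by
  have h1 : HasDerivAt (fun ξ : ℂ => ξ * exp (-(φ * I))) (exp (-(φ * I))) ξ := by
    simpa using (hasDerivAt_id ξ).mul_const (exp (-(φ * I)))
  have h2 := ((h1.clog h).add_const (φ * I))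
  refine h2.congr_deriv ?_
  have := ne_zero_of_mem_slitAt h
  have := exp_ne_zero (-(φ * I))
  field_simp

/-- A cut disc is connected. -/
theorem isPreconnected_slitBall (p d : ℂ) (hd : d ≠ 0) (φ ρ : ℝ) :
    IsPreconnected {x : ℂ | x ∈ Metric.ball p ρ ∧ (x - p) / d ∈ slitAt φ} := by
  rcases le_or_gt ρ 0 with hρ | hρ
  · rw [Metric.ball_eq_empty.2 hρ]; simpa using isPreconnected_empty
  set ρ' := ρ / ‖d‖ with hρ'
  have hd' : 0 < ‖d‖ := norm_pos_iff.2 hd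
  have hρ'0 : 0 < ρ' := by positivity
  have hst : StarConvex ℝ ((ρ' / 2 : ℝ) : ℂ) (Metric.ball 0 ρ' ∩ slitPlane) := by
    refine ((convex_ball (0 : ℂ) ρ').starConvex ?_).inter (starConvex_ofReal_slitPlane (by positivity))
    rw [mem_ball_zero_iff, norm_real, Real.norm_of_nonneg (by positivity)]
    linarith
  have hpc : IsPreconnected (Metric.ball (0 : ℂ) ρ' ∩ slitPlane) := by
    refine (hst.isPathConnected ?_).isConnected.isPreconnected
    refine mem_inter ?_ ?_
    · rw [mem_ball_zero_iff, norm_real, Real.norm_of_nonneg (by positivity)]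
      linarith
    · exact ofReal_mem_slitPlane.2 (by positivity)
  have he : ‖exp (φ * I)‖ = 1 := by rw [norm_exp_ofReal_mul_I]
  have he1 : exp (φ * I) * exp (-(φ * I)) = 1 := by rw [← exp_add]; simp
  convert hpc.image (fun w => p + d * exp (φ * I) * w) (by fun_prop) using 1
  ext x
  simp only [mem_ofPred_eq, mem_image, mem_inter_iff, mem_ball_iff_norm, sub_zero]
  constructor
  · rintro ⟨h1, h2⟩
    refine ⟨(x - p) / d * exp (-(φ * I)), ⟨?_, h2⟩, ?_⟩
    · have : ‖exp (-(φ * I))‖ = 1 := by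
        have := norm_exp_ofReal_mul_I (-φ)
        rwa [ofReal_neg, neg_mul] at this
      rw [norm_mul, this, mul_one, norm_div, hρ']
      gcongr
    · field_simp
      linear_combination (x - p) * he1
  · rintro ⟨w, ⟨h1, h2⟩, rfl⟩
    constructor
    · rw [add_sub_cancel_left, norm_mul, norm_mul, he, mul_one]
      rw [hρ', lt_div_iff₀ hd'] at h1
      linarith
    · rw [slitAt, mem_ofPred_eq]
      convert h2 using 1
      rw [add_sub_cancel_left]
      field_simp
      linear_combination w * he1

theorem abs_arg_lt_of_re {ξ : ℂ} (h : ‖ξ‖ / 2 < ξ.re) : |arg ξ| < Real.pi / 3 := by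
  have h0 : ξ ≠ 0 := by rintro rfl; simp at h
  by_contra! hcon
  have h1 := Real.cos_le_cos_of_nonneg_of_le_pi (by positivity) (abs_arg_le_pi ξ) hcon
  rw [Real.cos_abs, Real.cos_pi_div_three, cos_arg h0, div_le_iff₀ (norm_pos_iff.2 h0)] at h1
  linarith

/-- In the sector `|arg q| < π / 3` the principal cube root inverts the cube. -/
theorem cube_cpow_of_sector {q : ℂ} (h0 : 0 < q.re) (h : q.im ^ 2 < 3 * q.re ^ 2) :
    (q ^ 3) ^ (3⁻¹ : ℂ) = q ∧ q ^ 3 ∈ slitPlane := by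
  have hn : ‖q‖ / 2 < q.re := by
    have h1 : ‖q‖ ^ 2 < (2 * q.re) ^ 2 := by
      rw [← normSq_eq_norm_sq, normSq_apply]; nlinarith
    have := lt_of_pow_lt_pow_left₀ 2 (by positivity) h1
    linarith
  have ha := abs_lt.1 (abs_arg_lt_of_re hn)
  constructor
  · have := pow_cpow_nat_inv (x := q) (n := 3) (by norm_num) (by push_cast; linarith [ha.1])
      (by push_cast; linarith [ha.2])
    simpa using this
  · have hq : q ≠ 0 := by rintro rfl; simp at h0
    have e : q ^ 3 = exp (3 * log q) := by
      rw [show (3 : ℂ) = ((3 : ℕ) : ℂ) by norm_num, exp_nat_mul, exp_log hq]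
    have him : (3 * log q).im = 3 * arg q := by simp [log_im]
    rw [e, mem_slitPlane_iff_arg]
    refine ⟨?_, exp_ne_zero _⟩
    rw [← log_im, Complex.log_exp (by rw [him]; linarith) (by rw [him]; linarith), him]
    intro h; linarith

theorem re_cpow_third {p : ℂ} (h : p ≠ 0) : ‖p ^ (3⁻¹ : ℂ)‖ / 2 ≤ (p ^ (3⁻¹ : ℂ)).re := by
  rw [cpow_def_of_ne_zero h, norm_exp, exp_re]
  have h1 : (log p * 3⁻¹).im = arg p / 3 := by
    rw [show (3⁻¹ : ℂ) = ((3⁻¹ : ℝ) : ℂ) by push_cast; rfl, im_mul_ofReal, log_im]; ring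
  have h2 : 1 / 2 ≤ Real.cos (log p * 3⁻¹).im := by
    rw [h1, ← Real.cos_pi_div_three, ← Real.cos_abs (arg p / 3)]
    apply Real.cos_le_cos_of_nonneg_of_le_pi (abs_nonneg _) (by linarith [Real.pi_pos])
    rw [abs_div, abs_of_pos (by norm_num : (0 : ℝ) < 3)]
    linarith [abs_arg_le_pi p]
  have := Real.exp_pos (log p * 3⁻¹).re
  nlinarith

/-- A holomorphic function with a triple zero is the cube of a local coordinate. -/
theorem exists_cube_coordinate {G : ℂ → ℂ} (hG : AnalyticAt ℂ G 0) (h1 : G 0 = 1) :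
    ∃ e : OpenPartialHomeomorph ℂ ℂ, 0 ∈ e.source ∧ e 0 = 0 ∧
      (∀ᶠ y in 𝓝 0, e y ^ 3 = y ^ 3 * G y) ∧ (∀ᶠ y in 𝓝 0, ‖e y - y‖ ≤ ‖y‖ / 8) ∧
      ∀ᶠ q in 𝓝 0, ‖e.symm q - q‖ ≤ ‖q‖ / 8 := by
  set s : ℂ → ℂ := fun y => y * G y ^ (3⁻¹ : ℂ) with hs
  have hsl : G 0 ∈ slitPlane := by rw [h1]; exact one_mem_slitPlane
  have ha : AnalyticAt ℂ s 0 := analyticAt_id.mul (hG.cpow analyticAt_const hsl)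
  have hd : HasDerivAt s 1 0 := by
    have := (hasDerivAt_id (0 : ℂ)).mul (hG.cpow (analyticAt_const (v := (3⁻¹ : ℂ))) hsl).differentiableAt.hasDerivAt
    refine this.congr_deriv ?_
    simp [h1]
  have hst : HasStrictDerivAt s 1 0 := by
    have := ha.hasStrictDerivAt; rwa [hd.deriv] at this
  have hst' := hst.hasStrictFDerivAt_equiv one_ne_zero
  set e := hst'.toOpenPartialHomeomorph s with he
  have hes : (e : ℂ → ℂ) = s := rfl
  have h0 : (0 : ℂ) ∈ e.source := hst'.mem_toOpenPartialHomeomorph_source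
  have e0 : e 0 = 0 := by rw [hes, hs]; simp
  have t0 : (0 : ℂ) ∈ e.target := by have := e.map_source h0; rwa [e0] at this
  have es0 : e.symm 0 = 0 := by have := e.left_inv h0; rwa [e0] at this
  have hd' : HasDerivAt e.symm 1 0 := by
    have := e.hasDerivAt_symm t0 one_ne_zero (by rw [es0, hes]; exact hd)
    simpa using this
  have small : ∀ f : ℂ → ℂ, f 0 = 0 → HasDerivAt f 1 0 → ∀ᶠ y in 𝓝 0, ‖f y - y‖ ≤ ‖y‖ / 8 := by
    intro f f0 hf
    have := hf.isLittleO.bound (show (0 : ℝ) < 1 / 8 by norm_num)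
    filter_upwards [this] with y hy
    simpa [f0, div_eq_inv_mul] using hy
  refine ⟨e, h0, e0, ?_, small e e0 (by rw [hes]; exact hd), small _ es0 hd'⟩
  refine Eventually.of_forall fun y => ?_
  rw [hes, hs]
  simp only
  have := cpow_nat_inv_pow (G y) (n := 3) (by norm_num)
  rw [mul_pow]
  congr 1

/-! ### Uniformization at a simple turning point -/

/-- A holomorphic function without zeros in a disc has a fourth root there. -/
theorem exists_fourth_root {f : ℂ → ℂ} {p : ℂ} {ρ : ℝ}
    (hf : DifferentiableOn ℂ f (Metric.ball p ρ)) (h0 : ∀ x ∈ Metric.ball p ρ, f x ≠ 0) :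
    ∃ K : ℂ → ℂ, DifferentiableOn ℂ K (Metric.ball p ρ) ∧ ∀ x ∈ Metric.ball p ρ, K x ^ 4 = f x := by
  rcases le_or_gt ρ 0 with hρ | hρ
  · rw [Metric.ball_eq_empty.2 hρ]; exact ⟨0, by simp, by simp⟩
  have hd : DifferentiableOn ℂ (fun x => deriv f x / f x) (Metric.ball p ρ) :=
    (hf.deriv Metric.isOpen_ball).div hf h0
  obtain ⟨L, hL0, hL⟩ := hd.isExactOn_ball.with_val_at p (log (f p))
  have hfd : ∀ x ∈ Metric.ball p ρ, HasDerivAt f (deriv f x) x := fun x hx =>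
    (hf.differentiableAt (Metric.isOpen_ball.mem_nhds hx)).hasDerivAt
  have hg : ∀ x ∈ Metric.ball p ρ, HasDerivAt (fun x => f x * exp (-L x)) 0 x := by
    intro x hx
    refine ((hfd x hx).mul (hL x hx).neg.cexp).congr_deriv ?_
    have := h0 x hx
    field_simp
    ring
  obtain ⟨k, hk⟩ := Metric.isOpen_ball.exists_is_const_of_deriv_eq_zero
    (convex_ball p ρ).isPreconnected (fun x hx => (hg x hx).differentiableAt.differentiableWithinAt)
    (fun x hx => (hg x hx).deriv)
  have hp := Metric.mem_ball_self (x := p) hρ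
  have hk1 : k = 1 := by
    rw [← hk p hp, hL0, exp_neg, exp_log (h0 p hp), mul_inv_cancel₀ (h0 p hp)]
  refine ⟨fun x => exp (L x / 4), fun x hx =>
    ((hL x hx).div_const 4).cexp.differentiableAt.differentiableWithinAt, fun x hx => ?_⟩
  have := hk x hx
  rw [hk1, exp_neg] at this
  rw [← exp_nat_mul]
  have h2 := exp_ne_zero (L x)
  field_simp at this
  rw [this]
  congr 1
  push_cast; ring

/-- The phase and the amplitude at a simple turning point `p`, in terms of the square root
`y = exp (l / 2)` of the local coordinate `(x - p) / d`, where `l` is any of its logarithms. The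
phase is `Z y`, with `Z` odd, and the amplitude is `exp (-σ l / 4) * K x`. The number `σ` is `1` if
`g₊` vanishes at `p`, and `-1` if `g₋` does. -/
structure IsUniformizer (A S : ℂ → ℂ) (lam p d : ℂ) (ρ : ℝ) (σ : ℂ) (Z K : ℂ → ℂ) : Prop where
  ne_zero : ∀ x ∈ Metric.ball p ρ, x ≠ p → V0 A S lam x ≠ 0
  holo_K : DifferentiableOn ℂ K (Metric.ball p ρ)
  odd : ∀ y : ℂ, ‖y‖ ^ 2 < ρ → Z (-y) = -Z y
  pow_four : ∀ x ∈ Metric.ball p ρ, x ≠ p → ∀ l, exp l = (x - p) / d →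
    (exp (-σ * l / 4) * K x) ^ 4 = gMinus A S lam x / gPlus A S lam x
  hasDerivAt : ∀ x ∈ Metric.ball p ρ, x ≠ p → ∀ l, exp l = (x - p) / d →
    HasDerivAt Z (2 * d * exp (l / 2) * ((exp (-σ * l / 4) * K x) ^ 2 * gPlus A S lam x))
      (exp (l / 2))
  germ : ∃ G, AnalyticAt ℂ G 0 ∧ G 0 ≠ 0 ∧ ∀ᶠ y in 𝓝 0, Z y = y ^ 3 * G y

section
variable {A S : ℂ → ℂ} {Ω : Set ℂ} {lam p d : ℂ} {ρ : ℝ} {σ : ℂ} {Z K : ℂ → ℂ}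

/-- Here `P` and `Q` are the factors that remain of `g₊` and `g₋` when the zero at `p` is split off
from one of them; `K` is a fourth root of `Q / P`, and `Z` is found by integrating `√V₀` in the
coordinate `y`. -/
theorem exists_isUniformizer_of_factor {P Q : ℂ → ℂ} (hd : ‖d‖ = 1) (hρ : 0 < ρ)
    (hne : ∀ x ∈ Metric.ball p ρ, x ≠ p → V0 A S lam x ≠ 0)
    (hP : DifferentiableOn ℂ P (Metric.ball p ρ)) (hQ : DifferentiableOn ℂ Q (Metric.ball p ρ))
    (hP0 : ∀ x ∈ Metric.ball p ρ, P x ≠ 0) (hQ0 : ∀ x ∈ Metric.ball p ρ, Q x ≠ 0)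
    (hg : ∀ x ∈ Metric.ball p ρ, x ≠ p → ∀ l, exp l = (x - p) / d →
      gPlus A S lam x = exp ((1 + σ) * l / 2) * P x ∧
        gMinus A S lam x = exp ((1 - σ) * l / 2) * Q x) :
    ∃ Z K, IsUniformizer A S lam p d ρ σ Z K := by
  obtain ⟨K, hK, hK4⟩ := exists_fourth_root (hQ.div hP hP0) (fun x hx => div_ne_zero (hQ0 x hx) (hP0 x hx))
  have hd0 : d ≠ 0 := by rintro rfl; simp at hd
  have hK0 : ∀ x ∈ Metric.ball p ρ, K x ≠ 0 := by
    intro x hx h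
    have := hK4 x hx
    rw [h] at this
    exact div_ne_zero (hQ0 x hx) (hP0 x hx) (by simpa using this.symm)
  set R : ℂ → ℂ := fun y => 2 * d * (K (p + d * y ^ 2) ^ 2 * P (p + d * y ^ 2)) with hR
  have hmap : ∀ y : ℂ, ‖y‖ ^ 2 < ρ → p + d * y ^ 2 ∈ Metric.ball p ρ := by
    intro y hy
    rw [mem_ball_iff_norm, add_sub_cancel_left, norm_mul, hd, one_mul, norm_pow]
    exact hy
  have hball : ∀ y ∈ Metric.ball (0 : ℂ) (√ρ), ‖y‖ ^ 2 < ρ := by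
    intro y hy
    rw [mem_ball_zero_iff] at hy
    calc ‖y‖ ^ 2 < √ρ ^ 2 := by gcongr
      _ = ρ := Real.sq_sqrt hρ.le
  have hball' : ∀ y : ℂ, ‖y‖ ^ 2 < ρ → y ∈ Metric.ball (0 : ℂ) (√ρ) := by
    intro y hy
    rw [mem_ball_zero_iff]
    exact Real.lt_sqrt_of_sq_lt hy
  have hRd : DifferentiableOn ℂ R (Metric.ball 0 (√ρ)) := by
    have hm : MapsTo (fun y : ℂ => p + d * y ^ 2) (Metric.ball 0 (√ρ)) (Metric.ball p ρ) :=
      fun y hy => hmap y (hball y hy)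
    have hq : DifferentiableOn ℂ (fun y : ℂ => p + d * y ^ 2) (Metric.ball 0 (√ρ)) := by fun_prop
    exact (((hK.comp hq hm).pow 2).mul (hP.comp hq hm)).const_mul (2 * d)
  have hyR : DifferentiableOn ℂ (fun y => y ^ 2 * R y) (Metric.ball 0 (√ρ)) :=
    DifferentiableOn.mul (by fun_prop) hRd
  -- With `x = p + d y²` one has `√V₀ dx = y² R(y) dy`.
  obtain ⟨Z, hZ0, hZ⟩ := hyR.isExactOn_ball.with_val_at 0 0
  have h0 : (0 : ℂ) ∈ Metric.ball (0 : ℂ) (√ρ) := Metric.mem_ball_self (Real.sqrt_pos.2 hρ)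
  have hpb : p ∈ Metric.ball p ρ := Metric.mem_ball_self hρ
  refine ⟨Z, K, hne, hK, ?_, ?_, ?_, ?_⟩
  · have hodd : ∀ y ∈ Metric.ball (0 : ℂ) (√ρ), HasDerivAt (fun y => Z (-y) + Z y) 0 y := by
      intro y hy
      have hy' : -y ∈ Metric.ball (0 : ℂ) (√ρ) := by simpa using hy
      have h1 := (hZ (-y) hy').comp y (hasDerivAt_neg y)
      refine (h1.add (hZ y hy)).congr_deriv ?_
      simp only [hR, neg_sq]; ring
    obtain ⟨k, hk⟩ := Metric.isOpen_ball.exists_is_const_of_deriv_eq_zero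
      (convex_ball (0 : ℂ) (√ρ)).isPreconnected
      (fun x hx => (hodd x hx).differentiableAt.differentiableWithinAt)
      (fun x hx => (hodd x hx).deriv)
    intro y hy
    have h1 := hk y (hball' y hy)
    have h2 := hk 0 h0
    simp only [neg_zero, hZ0, add_zero] at h2
    rw [← h2] at h1
    exact eq_neg_of_add_eq_zero_left h1
  · intro x hx hxp l hl
    obtain ⟨h1, h2⟩ := hg x hx hxp l hl
    have h3 := hP0 x hx
    rw [mul_pow, hK4 x hx, h1, h2, ← exp_nat_mul, Pi.div_apply]
    have h4 := exp_ne_zero ((1 + σ) * l / 2)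
    have h5 : exp ((4 : ℕ) * (-σ * l / 4)) * exp ((1 + σ) * l / 2) = exp ((1 - σ) * l / 2) := by
      rw [← exp_add]; congr 1; push_cast; ring
    rw [eq_div_iff (mul_ne_zero h4 h3), ← h5]
    field_simp
  · intro x hx hxp l hl
    obtain ⟨h1, -⟩ := hg x hx hxp l hl
    have hy2 : exp (l / 2) ^ 2 = (x - p) / d := by
      rw [← hl, ← exp_nat_mul]; congr 1; push_cast; ring
    have hxe : p + d * exp (l / 2) ^ 2 = x := by rw [hy2]; field_simp; ring
    have hyb : ‖exp (l / 2)‖ ^ 2 < ρ := by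
      rw [← norm_pow, hy2, norm_div, hd, div_one]; exact mem_ball_iff_norm.1 hx
    refine (hZ _ (hball' _ hyb)).congr_deriv ?_
    simp only [hR, hxe, h1]
    rw [mul_pow, ← exp_nat_mul (-σ * l / 4)]
    have : exp (l / 2) * exp (l / 2) =
        exp (l / 2) * (exp ((2 : ℕ) * (-σ * l / 4)) * exp ((1 + σ) * l / 2)) := by
      rw [← exp_add, ← exp_add, ← exp_add]; congr 1; push_cast; ring
    linear_combination (2 * d * K x ^ 2 * P x) * this
  · have hZa : AnalyticAt ℂ Z 0 :=
      DifferentiableOn.analyticAt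
        (fun y hy => (hZ y hy).differentiableAt.differentiableWithinAt)
        (Metric.isOpen_ball.mem_nhds h0)
    have hRa : AnalyticAt ℂ R 0 := hRd.analyticAt (Metric.isOpen_ball.mem_nhds h0)
    have hR0 : R 0 ≠ 0 := by
      simp only [hR, ne_eq, OfNat.ofNat_ne_zero, not_false_eq_true, zero_pow, mul_zero, add_zero]
      exact mul_ne_zero (mul_ne_zero two_ne_zero hd0)
        (mul_ne_zero (pow_ne_zero 2 (hK0 p hpb)) (hP0 p hpb))
    have hder : ∀ᶠ y in 𝓝 0, deriv Z y = (y - 0) ^ 2 • R y := by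
      filter_upwards [Metric.isOpen_ball.mem_nhds h0] with y hy
      rw [(hZ y hy).deriv, sub_zero, smul_eq_mul]
    have ho : analyticOrderAt (deriv Z) 0 = (2 : ℕ) :=
      hZa.deriv.analyticOrderAt_eq_natCast.2 ⟨R, hRa, hR0, hder⟩
    have h3 := hZa.analyticOrderAt_deriv_add_one
    rw [ho] at h3
    have h4 : analyticOrderAt Z 0 = (3 : ℕ) := by
      simp only [hZ0, sub_zero] at h3
      rw [← h3]; norm_num
    obtain ⟨G, hG, hG0, hGe⟩ := hZa.analyticOrderAt_eq_natCast.1 h4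
    exact ⟨G, hG, hG0, by simpa using hGe⟩

theorem exists_isUniformizer (hAS : IsPotential A S Ω) (hd : ‖d‖ = 1) (hρ : 0 < ρ)
    (hΩ : Metric.ball p ρ ⊆ Ω) (hne : ∀ x ∈ Metric.ball p ρ, x ≠ p → V0 A S lam x ≠ 0)
    (hs : deriv (V0 A S lam) p ≠ 0)
    (hσ : σ = 1 ∧ gPlus A S lam p = 0 ∨ σ = -1 ∧ gMinus A S lam p = 0) :
    ∃ Z K, IsUniformizer A S lam p d ρ σ Z K := by
  have hd0 : d ≠ 0 := by rintro rfl; simp at hd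
  have hp : p ∈ Metric.ball p ρ := Metric.mem_ball_self hρ
  have hn : Metric.ball p ρ ∈ 𝓝 p := Metric.ball_mem_nhds p hρ
  have hgp : DifferentiableOn ℂ (gPlus A S lam) (Metric.ball p ρ) := fun x hx =>
    (hAS.hasDerivAt_gPlus lam (hΩ hx)).differentiableAt.differentiableWithinAt
  have hgm : DifferentiableOn ℂ (gMinus A S lam) (Metric.ball p ρ) := fun x hx =>
    (hAS.hasDerivAt_gMinus lam (hΩ hx)).differentiableAt.differentiableWithinAt
  have hV : deriv (V0 A S lam) p = deriv (gMinus A S lam) p * gPlus A S lam p +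
      gMinus A S lam p * deriv (gPlus A S lam) p := by
    rw [show V0 A S lam = fun x => gMinus A S lam x * gPlus A S lam x from funext (V0_eq A S lam)]
    exact ((hgm.differentiableAt hn).hasDerivAt.mul (hgp.differentiableAt hn).hasDerivAt).deriv
  have hne' : ∀ x ∈ Metric.ball p ρ, x ≠ p → gMinus A S lam x ≠ 0 ∧ gPlus A S lam x ≠ 0 := by
    intro x hx hxp
    have := hne x hx hxp
    rwa [V0_eq, mul_ne_zero_iff] at this
  -- The factor that vanishes at `p`, divided by the local coordinate.
  have slope : ∀ g : ℂ → ℂ, g p = 0 → DifferentiableOn ℂ g (Metric.ball p ρ) → deriv g p ≠ 0 →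
      (∀ x ∈ Metric.ball p ρ, x ≠ p → g x ≠ 0) →
      DifferentiableOn ℂ (fun x => d * dslope g p x) (Metric.ball p ρ) ∧
      (∀ x ∈ Metric.ball p ρ, d * dslope g p x ≠ 0) ∧
      ∀ x, x ≠ p → g x = (x - p) / d * (d * dslope g p x) := by
    intro g h0 hg hg' hgne
    have e : ∀ x, x ≠ p → g x = (x - p) / d * (d * dslope g p x) := by
      intro x hx
      rw [dslope_of_ne _ hx, slope_def_field, h0, sub_zero]
      have := sub_ne_zero.2 hx
      field_simp
    refine ⟨((Complex.differentiableOn_dslope hn).2 hg).const_mul d, fun x hx => ?_, e⟩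
    by_cases hxp : x = p
    · rw [hxp, dslope_same]; exact mul_ne_zero hd0 hg'
    · intro h
      apply hgne x hx hxp
      rw [e x hxp, h, mul_zero]
  rcases hσ with ⟨rfl, h0⟩ | ⟨rfl, h0⟩
  · rw [hV, h0, mul_zero, zero_add, mul_ne_zero_iff] at hs
    obtain ⟨h1, h2, h3⟩ := slope _ h0 hgp hs.2 (fun x hx hxp => (hne' x hx hxp).2)
    refine exists_isUniformizer_of_factor hd hρ hne h1 hgm h2 (fun x hx => ?_) ?_
    · by_cases hxp : x = p
      · rw [hxp]; exact hs.1
      · exact (hne' x hx hxp).1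
    · intro x hx hxp l hl
      constructor
      · rw [h3 x hxp, ← hl]; congr 2; ring
      · rw [show (1 - 1) * l / 2 = 0 by ring, exp_zero, one_mul]
  · rw [hV, h0, zero_mul, add_zero, mul_ne_zero_iff] at hs
    obtain ⟨h1, h2, h3⟩ := slope _ h0 hgm hs.1 (fun x hx hxp => (hne' x hx hxp).1)
    refine exists_isUniformizer_of_factor hd hρ hne hgp h1 (fun x hx => ?_) h2 ?_
    · by_cases hxp : x = p
      · rw [hxp]; exact hs.2
      · exact (hne' x hx hxp).2
    · intro x hx hxp l hl
      constructor
      · rw [show (1 + -1) * l / 2 = 0 by ring, exp_zero, one_mul]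
      · rw [h3 x hxp, ← hl]; congr 2; ring

/-- The disc around the turning point, cut along a radius. -/
def slitBall (p d : ℂ) (ρ φ : ℝ) : Set ℂ := {x | x ∈ Metric.ball p ρ ∧ (x - p) / d ∈ slitAt φ}

theorem ne_of_mem_slitBall {φ : ℝ} {x : ℂ} (hx : x ∈ slitBall p d ρ φ) : x ≠ p := by
  rintro rfl
  have := ne_zero_of_mem_slitAt hx.2
  simp at this

theorem isOpen_slitBall (p d : ℂ) (ρ φ : ℝ) : IsOpen (slitBall p d ρ φ) :=
  Metric.isOpen_ball.inter ((isOpen_slitAt φ).preimage (by fun_prop))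

theorem hasDerivAt_logBranch_slitBall (hd : d ≠ 0) {φ : ℝ} {x : ℂ} (hx : x ∈ slitBall p d ρ φ) :
    HasDerivAt (fun x => logBranch φ ((x - p) / d)) (x - p)⁻¹ x := by
  have h1 : HasDerivAt (fun x : ℂ => (x - p) / d) (1 / d) x :=
    ((hasDerivAt_id x).sub_const p).div_const d
  refine ((hasDerivAt_logBranch hx.2).comp x h1).congr_deriv ?_
  have := sub_ne_zero.2 (ne_of_mem_slitBall hx)
  field_simp

/-- The branches of phase and amplitude on a slit disc. -/
theorem IsUniformizer.isFrame (h : IsUniformizer A S lam p d ρ σ Z K) (hd : d ≠ 0)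
    (hΩ : Metric.ball p ρ ⊆ Ω) (φ : ℝ) :
    IsFrame A S Ω lam (slitBall p d ρ φ) (fun x => Z (exp (logBranch φ ((x - p) / d) / 2)))
      (fun x => exp (-σ * logBranch φ ((x - p) / d) / 4) * K x) := by
  have hl : ∀ x ∈ slitBall p d ρ φ, exp (logBranch φ ((x - p) / d)) = (x - p) / d := fun x hx =>
    exp_logBranch (ne_zero_of_mem_slitAt hx.2)
  have hz : ∀ x ∈ slitBall p d ρ φ, HasDerivAt
      (fun x => Z (exp (logBranch φ ((x - p) / d) / 2)))
      ((exp (-σ * logBranch φ ((x - p) / d) / 4) * K x) ^ 2 * gPlus A S lam x) x := by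
    intro x hx
    have h1 := h.hasDerivAt x hx.1 (ne_of_mem_slitBall hx) _ (hl x hx)
    have h2 := ((hasDerivAt_logBranch_slitBall hd hx).div_const 2).cexp
    refine (h1.comp x h2).congr_deriv ?_
    have h3 : exp (logBranch φ ((x - p) / d) / 2) * exp (logBranch φ ((x - p) / d) / 2) =
        (x - p) / d := by rw [← exp_add, add_halves, hl x hx]
    have h4 := sub_ne_zero.2 (ne_of_mem_slitBall hx)
    generalize exp (logBranch φ ((x - p) / d) / 2) = e at *
    generalize (exp (-σ * logBranch φ ((x - p) / d) / 4) * K x) ^ 2 * gPlus A S lam x = w at *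
    field_simp
    field_simp at h3
    linear_combination w * h3
  have hne := fun x (hx : x ∈ slitBall p d ρ φ) => h.ne_zero x hx.1 (ne_of_mem_slitBall hx)
  refine ⟨isOpen_slitBall p d ρ φ, fun x hx => hΩ hx.1, hne, fun x hx =>
    (hz x hx).differentiableAt.differentiableWithinAt, fun x hx => ?_, fun x hx => ?_, fun x hx => ?_⟩
  · refine (DifferentiableAt.mul ?_ (h.holo_K.differentiableAt
      (Metric.isOpen_ball.mem_nhds hx.1))).differentiableWithinAt
    exact (((hasDerivAt_logBranch_slitBall hd hx).const_mul (-σ)).div_const 4).cexp.differentiableAt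
  · exact h.pow_four x hx.1 (ne_of_mem_slitBall hx) _ (hl x hx)
  · have h0 : gPlus A S lam x ≠ 0 := by
      have := hne x hx
      rw [V0_eq] at this
      exact right_ne_zero_of_mul this
    rw [(hz x hx).deriv, mul_div_cancel_right₀ _ h0]

/-- The choice of the fourth root: the sign of the phase and the branch of the amplitude. -/
theorem IsUniformizer.mul_const (h : IsUniformizer A S lam p d ρ σ Z K) {k : ℂ} (hk : k ^ 4 = 1) :
    IsUniformizer A S lam p d ρ σ (fun y => k ^ 2 * Z y) (fun x => k * K x) := by
  have hk0 : k ≠ 0 := by rintro rfl; simp at hk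
  obtain ⟨G, hG, hG0, hGe⟩ := h.germ
  refine ⟨h.ne_zero, h.holo_K.const_mul k, fun y hy => by rw [h.odd y hy]; ring,
    fun x hx hxp l hl => ?_, fun x hx hxp l hl => ?_,
    fun y => k ^ 2 * G y, analyticAt_const.mul hG, mul_ne_zero (pow_ne_zero 2 hk0) hG0,
    hGe.mono fun y hy => by rw [hy]; ring⟩
  · rw [← h.pow_four x hx hxp l hl]
    linear_combination (exp (-σ * l / 4) * K x) ^ 4 * hk
  · exact ((h.hasDerivAt x hx hxp l hl).const_mul (k ^ 2)).congr_deriv (by ring)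

/-- Every branch of the phase that tends to `0` at the turning point comes from a uniformizer. -/
theorem IsUniformizer.exists_eq (h : IsUniformizer A S lam p d ρ σ Z K) (hd : d ≠ 0) (hρ : 0 < ρ)
    (hΩ : Metric.ball p ρ ⊆ Ω) {φ : ℝ} {D : Set ℂ} {z H : ℂ → ℂ} (hF : IsFrame A S Ω lam D z H)
    (hD : slitBall p d ρ φ ⊆ D) (hz : Tendsto z (𝓝[D] p) (𝓝 0)) :
    ∃ Z' K', IsUniformizer A S lam p d ρ σ Z' K' ∧ ∀ x ∈ slitBall p d ρ φ,
      z x = Z' (exp (logBranch φ ((x - p) / d) / 2)) ∧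
      H x = exp (-σ * logBranch φ ((x - p) / d) / 4) * K' x := by
  have hF' := h.isFrame hd hΩ φ
  set z' := fun x => Z (exp (logBranch φ ((x - p) / d) / 2)) with hz'
  set H' := fun x => exp (-σ * logBranch φ ((x - p) / d) / 4) * K x with hH'
  have hconn : IsPreconnected (slitBall p d ρ φ) := isPreconnected_slitBall p d hd φ ρ
  have hq : ∀ x ∈ slitBall p d ρ φ, (H x / H' x) ^ 4 = 1 := by
    intro x hx
    rw [div_pow, hF.pow_four x (hD hx), ← hF'.pow_four x hx, div_self]
    exact pow_ne_zero 4 (hF'.H_ne hx)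
  obtain ⟨k, hk⟩ := (isOpen_slitBall p d ρ φ).exists_is_const_of_deriv_eq_zero hconn
    (f := fun x => H x / H' x)
    (fun x hx => ((hF.hasDerivAt_H (hD hx)).div (hF'.hasDerivAt_H hx)
      (hF'.H_ne hx)).differentiableAt.differentiableWithinAt) (by
    intro x hx
    have h1 := ((hF.hasDerivAt_H (hD hx)).div (hF'.hasDerivAt_H hx)
      (hF'.H_ne hx)).differentiableAt.hasDerivAt
    have h2 := (h1.pow 4).deriv
    have h3 : (fun x => (H x / H' x) ^ 4) =ᶠ[𝓝 x] fun _ => 1 := by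
      filter_upwards [(isOpen_slitBall p d ρ φ).mem_nhds hx] with y hy using hq y hy
    have h4 : deriv (fun x => (H x / H' x) ^ 4) x = 0 := by rw [h3.deriv_eq]; simp
    have h5 : H x / H' x ≠ 0 := div_ne_zero (hF.H_ne (hD hx)) (hF'.H_ne hx)
    change deriv (fun x => (H x / H' x) ^ 4) x = _ at h2
    rw [h4] at h2
    simp only [Pi.zero_apply]
    rcases mul_eq_zero.1 h2.symm with h6 | h6
    · exact absurd h6 (mul_ne_zero (by norm_num) (pow_ne_zero _ h5))
    · exact h6)
  -- A point sequence in the slit disc that tends to its centre.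
  have hcl : Tendsto (fun t : ℝ => p + d * exp (φ * I) * t) (𝓝[>] 0) (𝓝[slitBall p d ρ φ] p) := by
    refine tendsto_nhdsWithin_iff.2 ⟨?_, ?_⟩
    · have : Tendsto (fun t : ℝ => p + d * exp (φ * I) * t) (𝓝 0)
          (𝓝 (p + d * exp (φ * I) * (0 : ℝ))) := Continuous.tendsto (by fun_prop) 0
      simp only [ofReal_zero, mul_zero, add_zero] at this
      exact this.mono_left nhdsWithin_le_nhds
    · have hd' : 0 < ‖d‖ := norm_pos_iff.2 hd
      filter_upwards [Ioo_mem_nhdsGT (show 0 < ρ / ‖d‖ by positivity)] with t ht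
      have ht0 : 0 < t := ht.1
      constructor
      · rw [mem_ball_iff_norm, add_sub_cancel_left, norm_mul, norm_mul, norm_exp_ofReal_mul_I,
          mul_one, norm_real, Real.norm_of_nonneg ht0.le]
        have := (lt_div_iff₀ hd').1 ht.2
        linarith
      · rw [slitAt, mem_ofPred_eq, add_sub_cancel_left]
        have : d * exp (φ * I) * t / d * exp (-(φ * I)) = t := by
          have h1 : exp (φ * I) * exp (-(φ * I)) = 1 := by rw [← exp_add]; simp
          field_simp
          linear_combination (t : ℂ) * h1
        rw [this]
        exact ofReal_mem_slitPlane.2 ht0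
  have hne : (𝓝[slitBall p d ρ φ] p).NeBot := hcl.neBot
  obtain ⟨x₁, hx₁⟩ : (slitBall p d ρ φ).Nonempty := by
    have := hne.nonempty_of_mem (self_mem_nhdsWithin); exact this
  have hk4 : k ^ 4 = 1 := by rw [← hk x₁ hx₁]; exact hq x₁ hx₁
  have hHk : ∀ x ∈ slitBall p d ρ φ, H x = k * H' x := fun x hx =>
    (div_eq_iff (hF'.H_ne hx)).1 (hk x hx)
  have hder : ∀ x ∈ slitBall p d ρ φ, deriv z x = k ^ 2 * deriv z' x := by
    intro x hx
    have h1 := hF.sq x (hD hx)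
    have h2 := hF'.sq x hx
    have h3 := hF'.gPlus_ne hx
    rw [hHk x hx, mul_pow, h2] at h1
    field_simp at h1
    exact h1.symm
  obtain ⟨k', hk'⟩ := (isOpen_slitBall p d ρ φ).exists_is_const_of_deriv_eq_zero hconn
    (f := fun x => z x - k ^ 2 * z' x)
    (fun x hx => ((hF.hasDerivAt_z (hD hx)).sub
      ((hF'.hasDerivAt_z hx).const_mul (k ^ 2))).differentiableAt.differentiableWithinAt) (by
    intro x hx
    have h1 := ((hF.hasDerivAt_z (hD hx)).sub ((hF'.hasDerivAt_z hx).const_mul (k ^ 2))).deriv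
    rwa [hder x hx, sub_self] at h1)
  have hZ0 : Tendsto Z (𝓝 0) (𝓝 0) := by
    obtain ⟨G, hG, -, hGe⟩ := h.germ
    have : Tendsto (fun y => y ^ 3 * G y) (𝓝 0) (𝓝 (0 ^ 3 * G 0)) :=
      ((continuous_pow 3).tendsto 0).mul hG.continuousAt
    simp only [ne_eq, OfNat.ofNat_ne_zero, not_false_eq_true, zero_pow, zero_mul] at this
    exact this.congr' (hGe.mono fun y hy => hy.symm)
  have hz'0 : Tendsto z' (𝓝[slitBall p d ρ φ] p) (𝓝 0) := by
    refine hZ0.comp ?_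
    rw [tendsto_zero_iff_norm_tendsto_zero]
    have e : ∀ x ∈ slitBall p d ρ φ, ‖exp (logBranch φ ((x - p) / d) / 2)‖ =
        √‖(x - p) / d‖ := by
      intro x hx
      rw [eq_comm, Real.sqrt_eq_iff_eq_sq (norm_nonneg _) (norm_nonneg _), ← norm_pow,
        ← exp_nat_mul]
      rw [show ((2 : ℕ) : ℂ) * (logBranch φ ((x - p) / d) / 2) = logBranch φ ((x - p) / d) by
        push_cast; ring, exp_logBranch (ne_zero_of_mem_slitAt hx.2)]
    have h1 : Tendsto (fun x => √‖(x - p) / d‖) (𝓝 p) (𝓝 (√‖(p - p) / d‖)) :=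
      Continuous.tendsto (by fun_prop) p
    simp only [sub_self, zero_div, norm_zero, Real.sqrt_zero] at h1
    refine (h1.mono_left nhdsWithin_le_nhds).congr' ?_
    filter_upwards [self_mem_nhdsWithin] with x hx using (e x hx).symm
  have hk'0 : k' = 0 := by
    have h1 : Tendsto (fun x => z x - k ^ 2 * z' x) (𝓝[slitBall p d ρ φ] p) (𝓝 (0 - k ^ 2 * 0)) :=
      (hz.mono_left (nhdsWithin_mono p hD)).sub (hz'0.const_mul _)
    have h2 : Tendsto (fun x => z x - k ^ 2 * z' x) (𝓝[slitBall p d ρ φ] p) (𝓝 k') := by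
      refine tendsto_const_nhds.congr' ?_
      filter_upwards [self_mem_nhdsWithin] with x hx using (hk' x hx).symm
    have := tendsto_nhds_unique h2 h1
    simpa using this
  refine ⟨_, _, h.mul_const hk4, fun x hx => ⟨?_, ?_⟩⟩
  · have := hk' x hx
    rw [hk'0] at this
    exact sub_eq_zero.1 this
  · rw [hHk x hx, hH']; ring

end

/-! ### Families of frames around a simple turning point -/

/-- The family `F` of frames is defined on a disc around the simple turning point `α lam` of
radius `r`, cut along a radius of direction `d * exp (θ I)` with `0 < θ ≤ 2 π / 3`, and its phase
vanishes at the turning point. -/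
structure IsTurningFamily (A S : ℂ → ℂ) (Ω : Set ℂ) (lam₀ : ℂ) (F : Family) (α : ℂ → ℂ) (d : ℂ)
    (θ r : ℝ) : Prop where
  family : IsFamily A S Ω lam₀ F
  cont : ContinuousAt α lam₀
  zero : ∀ᶠ lam in 𝓝 lam₀, V0 A S lam (α lam) = 0
  simple : deriv (V0 A S lam₀) (α lam₀) ≠ 0
  norm_dir : ‖d‖ = 1
  pos_angle : 0 < θ
  angle_le : θ ≤ 2 * Real.pi / 3
  pos_radius : 0 < r
  ball_subset : ∀ᶠ lam in 𝓝 lam₀, Metric.ball (α lam) r ⊆ Ω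
  slit_subset : ∀ᶠ lam in 𝓝 lam₀, slitBall (α lam) d r (θ + Real.pi) ⊆ F.D lam
  base : ∀ᶠ lam in 𝓝 lam₀, Tendsto (F.z lam) (𝓝[F.D lam] (α lam)) (𝓝 0)

/-- The family of frames given by uniformizers on a disc around `α lam`, cut in another
direction. -/
noncomputable def sheetFamily (α : ℂ → ℂ) (d : ℂ) (ρ : ℝ) (σ : ℂ) (Z K : ℂ → ℂ → ℂ) (φ : ℝ) :
    Family where
  D lam := slitBall (α lam) d ρ φ
  z lam x := Z lam (exp (logBranch φ ((x - α lam) / d) / 2))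
  H lam x := exp (-σ * logBranch φ ((x - α lam) / d) / 4) * K lam x

theorem slitBall_mono {p d : ℂ} {ρ r φ : ℝ} (h : ρ ≤ r) : slitBall p d ρ φ ⊆ slitBall p d r φ :=
  fun _ hx => ⟨Metric.ball_subset_ball h hx.1, hx.2⟩

section
variable {A S : ℂ → ℂ} {Ω : Set ℂ} {lam₀ d σ : ℂ} {F : Family} {α : ℂ → ℂ} {θ r ρ φ φ' : ℝ}
  {Z K : ℂ → ℂ → ℂ}

theorem eventually_mem_slitBall (hα : ContinuousAt α lam₀) {x : ℂ}
    (hx : x ∈ slitBall (α lam₀) d ρ φ) :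
    ∀ᶠ q : ℂ × ℂ in 𝓝 (lam₀, x), q.2 ∈ slitBall (α q.1) d ρ φ := by
  have h0 : ContinuousAt (fun q : ℂ × ℂ => α q.1) (lam₀, x) :=
    ContinuousAt.comp (x := (lam₀, x)) (f := Prod.fst) hα continuousAt_fst
  have h1 : ContinuousAt (fun q : ℂ × ℂ => q.2 - α q.1) (lam₀, x) := continuousAt_snd.sub h0
  have h2 := h1.norm.eventually_lt_const (mem_ball_iff_norm.1 hx.1)
  have h3 := (h1.div_const d).eventually ((isOpen_slitAt φ).mem_nhds hx.2)
  filter_upwards [h2, h3] with q h4 h5 using ⟨mem_ball_iff_norm.2 h4, h5⟩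

/-- Two branches of the logarithm differ by a multiple of `2 π i`, which depends on the
sector only. -/
theorem eventually_logBranch_eq (hα : ContinuousAt α lam₀) {x : ℂ}
    (hx : x ∈ slitBall (α lam₀) d ρ φ) (k : ℤ)
    (h1 : φ' - Real.pi < (logBranch φ ((x - α lam₀) / d)).im + 2 * Real.pi * k)
    (h2 : (logBranch φ ((x - α lam₀) / d)).im + 2 * Real.pi * k < φ' + Real.pi) :
    ∀ᶠ lam in 𝓝 lam₀, x ∈ slitBall (α lam) d ρ φ ∧ x ∈ slitBall (α lam) d ρ φ' ∧
      logBranch φ' ((x - α lam) / d) =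
        logBranch φ ((x - α lam) / d) + k * (2 * Real.pi * I) := by
  have hc : ContinuousAt (fun lam => (x - α lam) / d) lam₀ :=
    (continuousAt_const.sub hα).div_const d
  have hl : ContinuousAt (fun lam => (logBranch φ ((x - α lam) / d)).im + 2 * Real.pi * k) lam₀ :=
    ((continuous_im.continuousAt.comp (ContinuousAt.comp (f := fun lam => (x - α lam) / d)
      (hasDerivAt_logBranch hx.2).continuousAt hc)).add_const _)
  have hm := ((Continuous.prodMk_left x).tendsto lam₀).eventually (eventually_mem_slitBall hα hx)
  filter_upwards [hm, hl.eventually_const_lt h1, hl.eventually_lt_const h2] with lam h3 h4 h5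
  set l := logBranch φ ((x - α lam) / d) with hl
  have him : (l + k * (2 * Real.pi * I)).im = l.im + 2 * Real.pi * k := by
    simp; ring
  have he : exp (l + k * (2 * Real.pi * I)) = (x - α lam) / d := by
    rw [exp_add, exp_int_mul_two_pi_mul_I, mul_one, exp_logBranch (ne_zero_of_mem_slitAt h3.2)]
  obtain ⟨h6, h7⟩ := logBranch_exp (φ := φ') (l := l + k * (2 * Real.pi * I)) (by rw [him]; exact h4)
    (by rw [him]; exact h5)
  rw [he] at h6 h7
  exact ⟨h3, ⟨h3.1, h6⟩, h7⟩

/-- Functions with the same derivative are injective on a common disc. The functions `g₊`, and also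
`g₋`, for different spectral parameters differ by constants only. -/
theorem exists_ball_injOn {g' : ℂ → ℂ} (hΩ : IsOpen Ω) {p : ℂ} (hp : p ∈ Ω)
    (hg' : ContinuousAt g' p) (h0 : g' p ≠ 0) :
    ∃ ρ > 0, Metric.ball p ρ ⊆ Ω ∧ ∀ g : ℂ → ℂ, (∀ x ∈ Ω, HasDerivAt g (g' x) x) →
      InjOn g (Metric.ball p ρ) ∧ ∀ x ∈ Metric.ball p ρ, g' x ≠ 0 := by
  have h1 : ∀ᶠ x in 𝓝 p, ‖g' x - g' p‖ < ‖g' p‖ / 2 := by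
    have : Tendsto (fun x => ‖g' x - g' p‖) (𝓝 p) (𝓝 ‖g' p - g' p‖) :=
      (Tendsto.sub_const hg' (g' p)).norm
    rw [sub_self, norm_zero] at this
    exact this.eventually_lt_const (half_pos (norm_pos_iff.2 h0))
  obtain ⟨ρ, hρ, hb⟩ := Metric.eventually_nhds_iff_ball.1 (h1.and (hΩ.eventually_mem hp))
  refine ⟨ρ, hρ, fun x hx => (hb x hx).2, fun g hg => ⟨?_, ?_⟩⟩
  · intro x hx y hy hxy
    have key := (convex_ball p ρ).norm_image_sub_le_of_norm_hasDerivWithin_le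
      (f := fun x => g x - g' p * x) (f' := fun x => g' x - g' p) (C := ‖g' p‖ / 2)
      (fun x hx => by
        have := (hg x (hb x hx).2).sub ((hasDerivAt_id x).const_mul (g' p))
        rw [mul_one] at this
        exact this.hasDerivWithinAt)
      (fun x hx => (hb x hx).1.le) hx hy
    have e : g y - g' p * y - (g x - g' p * x) = g' p * (x - y) := by rw [hxy]; ring
    rw [e, norm_mul, norm_sub_rev x y] at key
    have h2 := norm_pos_iff.2 h0
    have h3 : ‖y - x‖ ≤ 0 := by nlinarith [norm_nonneg (y - x)]
    exact (sub_eq_zero.1 (norm_le_zero_iff.1 h3)).symm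
  · intro x hx h
    have := (hb x hx).1
    rw [h, zero_sub, norm_neg] at this
    linarith [norm_nonneg (g' p)]

/-- Near a simple turning point the phase and the amplitude are given by uniformizers, in discs
whose radius does not depend on the spectral parameter. -/
theorem IsTurningFamily.exists_uniformizer (hAS : IsPotential A S Ω)
    (h : IsTurningFamily A S Ω lam₀ F α d θ r)
    (hσ : σ = 1 ∧ gPlus A S lam₀ (α lam₀) = 0 ∨ σ = -1 ∧ gMinus A S lam₀ (α lam₀) = 0) :
    ∃ ρ > 0, ∃ Z K : ℂ → ℂ → ℂ, ∀ᶠ lam in 𝓝 lam₀, Metric.ball (α lam) ρ ⊆ Ω ∧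
      IsUniformizer A S lam (α lam) d ρ σ (Z lam) (K lam) ∧
      ∀ x ∈ slitBall (α lam) d ρ (θ + Real.pi), x ∈ F.D lam ∧
        F.z lam x = Z lam (exp (logBranch (θ + Real.pi) ((x - α lam) / d) / 2)) ∧
        F.H lam x = exp (-σ * logBranch (θ + Real.pi) ((x - α lam) / d) / 4) * K lam x := by
  have hd0 : d ≠ 0 := by rintro rfl; simpa using h.norm_dir
  have hp : α lam₀ ∈ Ω := h.ball_subset.self_of_nhds (Metric.mem_ball_self h.pos_radius)
  have hn := hAS.isOpen.mem_nhds hp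
  have hV : ∀ lam, ∀ x ∈ Ω, deriv (V0 A S lam) x =
      (deriv (deriv S) x / 2 - I * deriv A x) * gPlus A S lam x +
      gMinus A S lam x * (-(deriv (deriv S) x / 2 + I * deriv A x)) := by
    intro lam x hx
    rw [show V0 A S lam = fun x => gMinus A S lam x * gPlus A S lam x from funext (V0_eq A S lam)]
    exact ((hAS.hasDerivAt_gMinus lam hx).mul (hAS.hasDerivAt_gPlus lam hx)).deriv
  have c1 := ((hAS.differentiableOn_deriv_S.deriv hAS.isOpen).differentiableAt hn).continuousAt
  have c2 := ((hAS.holo_A.deriv hAS.isOpen).differentiableAt hn).continuousAt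
  have hs := h.simple
  rw [hV _ _ hp] at hs
  -- The discs on which one factor of `V₀` is injective and the other one does not vanish.
  have main : ∃ ρ > 0, ∀ᶠ lam in 𝓝 lam₀,
      (σ = 1 ∧ gPlus A S lam (α lam) = 0 ∨ σ = -1 ∧ gMinus A S lam (α lam) = 0) ∧
      (∀ x ∈ Metric.ball (α lam) ρ, x ≠ α lam → V0 A S lam x ≠ 0) ∧
      deriv (V0 A S lam) (α lam) ≠ 0 := by
    have near : ∀ ρ : ℝ, 0 < ρ → ∀ᶠ lam in 𝓝 lam₀, ∀ x ∈ Metric.ball (α lam) (ρ / 2),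
        x ∈ Metric.ball (α lam₀) ρ := by
      intro ρ hρ
      filter_upwards [h.cont.eventually (Metric.ball_mem_nhds (α lam₀) (half_pos hρ))] with lam hl x hx
      rw [Metric.mem_ball] at hx ⊢
      linarith [dist_triangle x (α lam) (α lam₀)]
    have ev : ∀ g : ℂ × ℂ → ℂ, ContinuousAt g (lam₀, α lam₀) → g (lam₀, α lam₀) ≠ 0 →
        ∃ ρ > 0, ∀ᶠ lam in 𝓝 lam₀, ∀ x ∈ Metric.ball (α lam₀) ρ, g (lam, x) ≠ 0 := by
      intro g hg h0
      have := hg.eventually_ne h0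
      rw [nhds_prod_eq, eventually_prod_iff] at this
      obtain ⟨pa, ha, pb, hb, hab⟩ := this
      obtain ⟨ρ, hρ, hρb⟩ := Metric.eventually_nhds_iff_ball.1 hb
      exact ⟨ρ, hρ, ha.mono fun lam hl x hx => hab hl (hρb x hx)⟩
    rcases hσ with ⟨rfl, h0⟩ | ⟨rfl, h0⟩
    · rw [h0, mul_zero, zero_add, mul_ne_zero_iff] at hs
      obtain ⟨ρ₁, hρ₁, hΩ₁, hinj⟩ := exists_ball_injOn
        (g' := fun x => -(deriv (deriv S) x / 2 + I * deriv A x)) hAS.isOpen hp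
        ((c1.div_const 2).add (c2.const_mul I)).neg hs.2
      obtain ⟨ρ₂, hρ₂, hne⟩ := ev _ (hAS.continuousAt_gMinus hp) hs.1
      have hρ : 0 < min ρ₁ ρ₂ := lt_min hρ₁ hρ₂
      refine ⟨min ρ₁ ρ₂ / 2, half_pos hρ, ?_⟩
      filter_upwards [near _ hρ, hne, h.zero] with lam n1 n2 n3
      have hself : α lam ∈ Metric.ball (α lam) (min ρ₁ ρ₂ / 2) := Metric.mem_ball_self (half_pos hρ)
      have m1 : ∀ x ∈ Metric.ball (α lam) (min ρ₁ ρ₂ / 2), x ∈ Metric.ball (α lam₀) ρ₁ := fun x hx =>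
        Metric.ball_subset_ball (min_le_left _ _) (n1 x hx)
      have m2 : ∀ x ∈ Metric.ball (α lam) (min ρ₁ ρ₂ / 2), gMinus A S lam x ≠ 0 := fun x hx =>
        n2 x (Metric.ball_subset_ball (min_le_right _ _) (n1 x hx))
      obtain ⟨i1, i2⟩ := hinj (gPlus A S lam) (fun x hx => hAS.hasDerivAt_gPlus lam hx)
      have z0 : gPlus A S lam (α lam) = 0 := by
        rw [V0_eq] at n3; exact (mul_eq_zero.1 n3).resolve_left (m2 _ hself)
      refine ⟨Or.inl ⟨rfl, z0⟩, fun x hx hxp => ?_, ?_⟩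
      · rw [V0_eq]
        exact mul_ne_zero (m2 x hx) fun h' => hxp (i1 (m1 x hx) (m1 _ hself) (h'.trans z0.symm))
      · rw [hV _ _ (hΩ₁ (m1 _ hself)), z0, mul_zero, zero_add]
        exact mul_ne_zero (m2 _ hself) (i2 _ (m1 _ hself))
    · rw [h0, zero_mul, add_zero, mul_ne_zero_iff] at hs
      obtain ⟨ρ₁, hρ₁, hΩ₁, hinj⟩ := exists_ball_injOn
        (g' := fun x => deriv (deriv S) x / 2 - I * deriv A x) hAS.isOpen hp
        ((c1.div_const 2).sub (c2.const_mul I)) hs.1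
      obtain ⟨ρ₂, hρ₂, hne⟩ := ev _ (hAS.continuousAt_gPlus hp) hs.2
      have hρ : 0 < min ρ₁ ρ₂ := lt_min hρ₁ hρ₂
      refine ⟨min ρ₁ ρ₂ / 2, half_pos hρ, ?_⟩
      filter_upwards [near _ hρ, hne, h.zero] with lam n1 n2 n3
      have hself : α lam ∈ Metric.ball (α lam) (min ρ₁ ρ₂ / 2) := Metric.mem_ball_self (half_pos hρ)
      have m1 : ∀ x ∈ Metric.ball (α lam) (min ρ₁ ρ₂ / 2), x ∈ Metric.ball (α lam₀) ρ₁ := fun x hx =>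
        Metric.ball_subset_ball (min_le_left _ _) (n1 x hx)
      have m2 : ∀ x ∈ Metric.ball (α lam) (min ρ₁ ρ₂ / 2), gPlus A S lam x ≠ 0 := fun x hx =>
        n2 x (Metric.ball_subset_ball (min_le_right _ _) (n1 x hx))
      obtain ⟨i1, i2⟩ := hinj (gMinus A S lam) (fun x hx => hAS.hasDerivAt_gMinus lam hx)
      have z0 : gMinus A S lam (α lam) = 0 := by
        rw [V0_eq] at n3; exact (mul_eq_zero.1 n3).resolve_right (m2 _ hself)
      refine ⟨Or.inr ⟨rfl, z0⟩, fun x hx hxp => ?_, ?_⟩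
      · rw [V0_eq]
        exact mul_ne_zero (fun h' => hxp (i1 (m1 x hx) (m1 _ hself) (h'.trans z0.symm))) (m2 x hx)
      · rw [hV _ _ (hΩ₁ (m1 _ hself)), z0, zero_mul, add_zero]
        exact mul_ne_zero (i2 _ (m1 _ hself)) (m2 _ hself)
  obtain ⟨ρ, hρ, hev⟩ := main
  have hρr : 0 < min ρ r := lt_min hρ h.pos_radius
  have ex : ∀ᶠ lam in 𝓝 lam₀, ∃ ZK : (ℂ → ℂ) × (ℂ → ℂ), Metric.ball (α lam) (min ρ r) ⊆ Ω ∧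
      IsUniformizer A S lam (α lam) d (min ρ r) σ ZK.1 ZK.2 ∧
      ∀ x ∈ slitBall (α lam) d (min ρ r) (θ + Real.pi), x ∈ F.D lam ∧
        F.z lam x = ZK.1 (exp (logBranch (θ + Real.pi) ((x - α lam) / d) / 2)) ∧
        F.H lam x = exp (-σ * logBranch (θ + Real.pi) ((x - α lam) / d) / 4) * ZK.2 x := by
    filter_upwards [hev, h.ball_subset, h.slit_subset, h.base, h.family.frame]
      with lam ⟨e1, e2, e3⟩ e4 e5 e6 e7
    have hb : Metric.ball (α lam) (min ρ r) ⊆ Ω :=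
      (Metric.ball_subset_ball (min_le_right _ _)).trans e4
    have hsub : slitBall (α lam) d (min ρ r) (θ + Real.pi) ⊆ F.D lam :=
      (slitBall_mono (min_le_right _ _)).trans e5
    obtain ⟨Z, K, hU⟩ := exists_isUniformizer hAS h.norm_dir hρr hb
      (fun x hx hxp => e2 x (Metric.ball_subset_ball (min_le_left _ _) hx) hxp) e3 e1
    obtain ⟨Z', K', hU', heq⟩ := hU.exists_eq hd0 hρr hb e7 hsub e6
    exact ⟨(Z', K'), hb, hU', fun x hx => ⟨hsub hx, heq x hx⟩⟩
  obtain ⟨f, hf⟩ := ex.choice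
  exact ⟨min ρ r, hρr, fun lam => (f lam).1, fun lam => (f lam).2, hf⟩

/-- The sheets form a family of frames: the branch of `z'` is continuous in the spectral parameter
because it coincides with that of `F` in some sector. -/
theorem isFamily_sheetFamily (hAS : IsPotential A S Ω) (hF : IsFamily A S Ω lam₀ F)
    (hα : ContinuousAt α lam₀) (hd : d ≠ 0)
    (h : ∀ᶠ lam in 𝓝 lam₀, Metric.ball (α lam) ρ ⊆ Ω ∧
      IsUniformizer A S lam (α lam) d ρ σ (Z lam) (K lam) ∧
      ∀ x ∈ slitBall (α lam) d ρ φ, x ∈ F.D lam ∧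
        F.z lam x = Z lam (exp (logBranch φ ((x - α lam) / d) / 2)) ∧
        F.H lam x = exp (-σ * logBranch φ ((x - α lam) / d) / 4) * K lam x)
    {x₀ : ℂ} (hx₀ : x₀ ∈ slitBall (α lam₀) d ρ φ)
    (h1 : φ' - Real.pi < (logBranch φ ((x₀ - α lam₀) / d)).im)
    (h2 : (logBranch φ ((x₀ - α lam₀) / d)).im < φ' + Real.pi) :
    IsFamily A S Ω lam₀ (sheetFamily α d ρ σ Z K φ') := by
  have hfr : ∀ᶠ lam in 𝓝 lam₀, IsFrame A S Ω lam ((sheetFamily α d ρ σ Z K φ').D lam)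
      ((sheetFamily α d ρ σ Z K φ').z lam) ((sheetFamily α d ρ σ Z K φ').H lam) := by
    filter_upwards [h] with lam hl using hl.2.1.isFrame hd hl.1 φ'
  have hmem : ∀ x ∈ (sheetFamily α d ρ σ Z K φ').D lam₀, ∀ᶠ q : ℂ × ℂ in 𝓝 (lam₀, x),
      q.2 ∈ (sheetFamily α d ρ σ Z K φ').D q.1 := fun x hx => eventually_mem_slitBall hα hx
  have hag : ∀ᶠ lam in 𝓝 lam₀, x₀ ∈ F.D lam ∧ x₀ ∈ slitBall (α lam) d ρ φ' ∧
      deriv (F.z lam) x₀ = deriv ((sheetFamily α d ρ σ Z K φ').z lam) x₀ := by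
    have := eventually_logBranch_eq hα hx₀ 0 (by simpa using h1) (by simpa using h2)
    filter_upwards [this, h, hfr, hF.frame] with lam ⟨a1, a2, a3⟩ b hf hf'
    obtain ⟨c1, -, c3⟩ := b.2.2 x₀ a1
    refine ⟨c1, a2, ?_⟩
    have e1 := hf.sq x₀ a2
    have e2 := hf'.sq x₀ c1
    have e3 := hf'.gPlus_ne c1
    have e4 : (sheetFamily α d ρ σ Z K φ').H lam x₀ = F.H lam x₀ := by
      rw [c3, sheetFamily]
      simp only [a3, Int.cast_zero, zero_mul, add_zero]
    rw [e4, e2, div_left_inj' e3] at e1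
    exact e1
  refine ⟨hfr, hmem, fun x hx => tendsto_deriv_of_tendsto hAS hfr hmem
    (isPreconnected_slitBall _ _ hd _ _) (x₀ := x₀) hag.self_of_nhds.2.1 ?_ hx⟩
  have h0 := (hF.cont x₀ hag.self_of_nhds.1).comp ((Continuous.prodMk_left x₀).tendsto lam₀)
  rw [← hag.self_of_nhds.2.2]
  refine h0.congr' ?_
  filter_upwards [hag] with lam hl using hl.2.2

end

/-! ### Passing a simple turning point -/

section
variable {A S : ℂ → ℂ} {Ω : Set ℂ} {lam₀ d σ : ℂ} {F : Family} {α : ℂ → ℂ} {θ r ρ φ φ' : ℝ}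
  {Z K : ℂ → ℂ → ℂ}

theorem im_cube (q : ℂ) : (q ^ 3).im = q.im * (3 * q.re ^ 2 - q.im ^ 2) := by
  simp [pow_succ]; ring

/-- On a sheet centred at the direction `φ`, with `o` the cube of `exp (φ I / 2)`, two points on
different sides of the level line `Re z = 0` that runs through the middle of the sheet are joined
progressively, by a path around the turning point on the side of the sheet. -/
theorem sheetFamily_leads (hAS : IsPotential A S Ω)
    (hfam : IsFamily A S Ω lam₀ (sheetFamily α d ρ σ Z K φ)) (hd : ‖d‖ = 1) (hρ : 0 < ρ)
    {o c₀ : ℝ} (ho : o = 1 ∨ o = -1) (hη : exp (φ * I / 2) ^ 3 = o) (hc₀ : 0 < c₀)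
    {G : ℂ → ℂ} (hG : AnalyticAt ℂ G 0) (hG0 : G 0 = -I * c₀)
    (hGe : ∀ᶠ y in 𝓝 0, Z lam₀ y = y ^ 3 * G y) :
    ∃ δ > 0, ∀ y y' : ℂ, ‖y‖ < δ → ‖y'‖ < δ →
      ‖y‖ / 2 ≤ y.re → o * y.im ≤ 0 → (Z lam₀ (exp (φ * I / 2) * y)).re < 0 →
      2 / 5 * ‖y'‖ ≤ y'.re → 4 / 5 * ‖y'‖ ≤ o * y'.im → 0 < (Z lam₀ (exp (φ * I / 2) * y')).re →
      Leads A S Ω lam₀ (sheetFamily α d ρ σ Z K φ) (α lam₀ + d * (exp (φ * I / 2) * y) ^ 2)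
        (sheetFamily α d ρ σ Z K φ) (α lam₀ + d * (exp (φ * I / 2) * y') ^ 2) := by
  set η := exp (φ * I / 2) with hηdef
  have hd0 : d ≠ 0 := by rintro rfl; simp at hd
  have hηn : ‖η‖ = 1 := by
    have := norm_exp_ofReal_mul_I (φ / 2)
    rw [hηdef, ← this]; congr 2; push_cast; ring
  have ho2 : o * o = 1 := by rcases ho with rfl | rfl <;> norm_num
  have hc₀' : (c₀ : ℂ) ≠ 0 := by exact_mod_cast hc₀.ne'
  have hG0' : G 0 ≠ 0 := by rw [hG0]; simp [hc₀.ne']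
  -- The coordinate `q` with `z = -i c₀ o q³`.
  have hG1 : AnalyticAt ℂ (fun y => G (η * y) / G 0) 0 := by
    have h1 : AnalyticAt ℂ (fun y => η * y) 0 := analyticAt_const.mul analyticAt_id
    have h2 : AnalyticAt ℂ G ((fun y => η * y) 0) := by simpa using hG
    exact (h2.comp h1).div_const
  obtain ⟨e, e0, e00, ecube, esm, esm'⟩ := exists_cube_coordinate hG1 (by simp [hG0'])
  have hZη : ∀ᶠ y in 𝓝 (0 : ℂ), (Z lam₀ (η * y)).re = c₀ * (o * (e y ^ 3).im) := by
    have hm : Tendsto (fun y => η * y) (𝓝 0) (𝓝 0) := by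
      have : Tendsto (fun y => η * y) (𝓝 0) (𝓝 (η * 0)) := Continuous.tendsto (by fun_prop) 0
      rwa [mul_zero] at this
    filter_upwards [hm.eventually hGe, ecube] with y h1 h2
    rw [h1, h2, mul_pow, hη]
    have : (o : ℂ) * y ^ 3 * G (η * y) =
        ((c₀ * o : ℝ) : ℂ) * (-I * (y ^ 3 * (G (η * y) / G 0))) := by
      rw [hG0]
      push_cast
      have := I_ne_zero
      field_simp
    rw [this, re_ofReal_mul]
    simp
    ring
  -- The set of admissible points in the coordinate `y`.
  have hgood : ∀ᶠ y in 𝓝 (0 : ℂ), (Z lam₀ (η * y)).re = c₀ * (o * (e y ^ 3).im) ∧ ‖y‖ ^ 2 < ρ := by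
    refine hZη.and ?_
    have : Tendsto (fun y : ℂ => ‖y‖ ^ 2) (𝓝 0) (𝓝 (‖(0 : ℂ)‖ ^ 2)) :=
      Continuous.tendsto (by fun_prop) 0
    simp only [norm_zero, ne_eq, OfNat.ofNat_ne_zero, not_false_eq_true, zero_pow] at this
    exact this.eventually_lt_const hρ
  have t0 : (0 : ℂ) ∈ e.target := by have := e.map_source e0; rwa [e00] at this
  have es0 : e.symm 0 = 0 := by have := e.left_inv e0; rwa [e00] at this
  have hsymm : Tendsto e.symm (𝓝 0) (𝓝 0) := by
    have := e.continuousAt_symm t0; rwa [ContinuousAt, es0] at this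
  have hq : ∀ᶠ q in 𝓝 (0 : ℂ), q ∈ e.target ∧ ‖e.symm q - q‖ ≤ ‖q‖ / 8 ∧
      (Z lam₀ (η * e.symm q)).re = c₀ * (o * (e (e.symm q) ^ 3).im) ∧ ‖e.symm q‖ ^ 2 < ρ :=
    (e.open_target.eventually_mem t0).and (esm'.and (hsymm.eventually hgood))
  obtain ⟨δ₁, hδ₁, hδ₁b⟩ := Metric.eventually_nhds_iff_ball.1 hq
  set Q : ℂ → ℂ := fun p => p ^ (3⁻¹ : ℂ) with hQ
  set X : ℂ → ℂ := fun q => α lam₀ + d * (η * e.symm q) ^ 2 with hX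
  have hQn : ∀ p : ℂ, ‖p‖ < δ₁ ^ 3 → Q p ∈ Metric.ball (0 : ℂ) δ₁ := by
    intro p hp
    have h1 : Q p ^ 3 = p := by
      simp [hQ]
    rw [mem_ball_zero_iff]
    refine lt_of_pow_lt_pow_left₀ 3 hδ₁.le ?_
    rwa [← norm_pow, h1]
  -- The points of the sheet, in terms of `q ^ 3`.
  have pt : ∀ p : ℂ, ‖p‖ < δ₁ ^ 3 → p ∈ slitPlane → X (Q p) ∈ slitBall (α lam₀) d ρ φ ∧
      ((sheetFamily α d ρ σ Z K φ).z lam₀ (X (Q p))).re = c₀ * (o * p.im) := by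
    intro p hp hps
    obtain ⟨h1, h2, h3, h4⟩ := hδ₁b _ (hQn p hp)
    have hp0 := slitPlane_ne_zero hps
    have hQ3 : Q p ^ 3 = p := by
      simp [hQ]
    have hQ0 : 0 < ‖Q p‖ := norm_pos_iff.2 (by rintro h; rw [h] at hQ3; simp at hQ3; exact hp0 hQ3.symm)
    have hre : 0 < (e.symm (Q p)).re := by
      have a1 := re_cpow_third hp0
      have a2 := (abs_le.1 ((abs_re_le_norm _).trans h2)).1
      rw [sub_re] at a2
      change ‖Q p‖ / 2 ≤ (Q p).re at a1
      linarith
    set y := e.symm (Q p) with hy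
    have hy0 : y ≠ 0 := by rintro h; rw [h] at hre; simp at hre
    set l : ℂ := 2 * log y + φ * I with hl
    have harg := abs_lt.1 (abs_arg_lt_pi_div_two_iff.2 (Or.inl hre))
    have hlim : l.im = 2 * arg y + φ := by simp [hl, log_im]
    have hel : exp l = (η * y) ^ 2 := by
      rw [hl, exp_add, mul_pow, hηdef, ← exp_nat_mul (φ * I / 2),
        show (2 : ℂ) * log y = ((2 : ℕ) : ℂ) * log y by norm_num, exp_nat_mul, exp_log hy0, mul_comm]
      congr 2; push_cast; ring
    have hel2 : exp (l / 2) = η * y := by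
      rw [hl, hηdef, show (2 * log y + φ * I) / 2 = φ * I / 2 + log y by ring, exp_add, exp_log hy0]
    obtain ⟨k1, k2⟩ := logBranch_exp (φ := φ) (l := l) (by rw [hlim]; linarith) (by rw [hlim]; linarith)
    have hξ : (X (Q p) - α lam₀) / d = exp l := by
      rw [hX, hel]; simp only [add_sub_cancel_left]; field_simp; rfl
    refine ⟨⟨?_, ?_⟩, ?_⟩
    · rw [mem_ball_iff_norm, hX]
      simp only [add_sub_cancel_left]
      rw [norm_mul, hd, one_mul, norm_pow, norm_mul, hηn, one_mul]
      exact h4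
    · rw [hξ]; exact k1
    · simp only [sheetFamily]
      rw [hξ, k2, hel2, h3, e.right_inv h1, hQ3]
  -- Segments in the coordinate `q ^ 3` are progressive.
  have seg : ∀ p p' : ℂ, ‖p‖ < δ₁ ^ 3 → ‖p'‖ < δ₁ ^ 3 →
      (∀ t ∈ Icc (0 : ℝ) 1, p + t * (p' - p) ∈ slitPlane) → o * p.im < o * p'.im →
      Leads A S Ω lam₀ (sheetFamily α d ρ σ Z K φ) (X (Q p))
        (sheetFamily α d ρ σ Z K φ) (X (Q p')) := by
    intro p p' hp hp' hs him
    have hb : ∀ t ∈ Icc (0 : ℝ) 1, ‖p + t * (p' - p)‖ < δ₁ ^ 3 := by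
      intro t ht
      have := (convex_ball (0 : ℂ) (δ₁ ^ 3)).add_smul_sub_mem (mem_ball_zero_iff.2 hp)
        (mem_ball_zero_iff.2 hp') ht
      simpa using this
    have key := hfam.leads_of_strictMonoOn hAS (γ := fun t : ℝ => X (Q (p + t * (p' - p))))
      zero_lt_one ?_ (fun t ht => (pt _ (hb t ht) (hs t ht)).1) ?_
    · simpa using key
    · intro t ht
      have c1 : ContinuousAt (fun t : ℝ => Q (p + t * (p' - p))) t := by
        have h0 : ContinuousAt (fun t : ℝ => p + t * (p' - p)) t := by fun_prop
        exact h0.cpow continuousAt_const (hs t ht)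
      have c2 := e.continuousAt_symm (hδ₁b _ (hQn _ (hb t ht))).1
      have c3 : ContinuousAt (fun t : ℝ => e.symm (Q (p + t * (p' - p)))) t :=
        ContinuousAt.comp (f := fun t : ℝ => Q (p + t * (p' - p))) c2 c1
      exact (continuousAt_const.add (continuousAt_const.mul
        ((continuousAt_const.mul c3).pow 2))).continuousWithinAt
    · intro t ht t' ht' htt
      simp only
      rw [(pt _ (hb t ht) (hs t ht)).2, (pt _ (hb t' ht') (hs t' ht')).2]
      simp only [add_im, im_ofReal_mul, sub_im]
      have : 0 < (t' - t) * (o * p'.im - o * p.im) := mul_pos (by linarith) (by linarith)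
      have := mul_pos hc₀ this
      nlinarith
  -- From the coordinate `y` to the coordinate `q ^ 3`.
  have hback : ∀ᶠ y in 𝓝 (0 : ℂ), y ∈ e.source ∧ ‖e y - y‖ ≤ ‖y‖ / 8 ∧
      (Z lam₀ (η * y)).re = c₀ * (o * (e y ^ 3).im) ∧ ‖e y ^ 3‖ < δ₁ ^ 3 := by
    refine (e.open_source.eventually_mem e0).and (esm.and (hZη.and ?_))
    have : Tendsto (fun y => ‖e y ^ 3‖) (𝓝 0) (𝓝 ‖e 0 ^ 3‖) :=
      Tendsto.norm (Tendsto.pow (e.continuousAt e0) 3)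
    rw [e00] at this
    simp only [ne_eq, OfNat.ofNat_ne_zero, not_false_eq_true, zero_pow, norm_zero] at this
    exact this.eventually_lt_const (by positivity)
  obtain ⟨δ, hδ, hδb⟩ := Metric.eventually_nhds_iff_ball.1 hback
  refine ⟨δ, hδ, fun y y' hy hy' hy1 hy2 hy3 hy1' hy2' hy3' => ?_⟩
  obtain ⟨a1, a2, a3, a4⟩ := hδb y (mem_ball_zero_iff.2 hy)
  obtain ⟨b1, b2, b3, b4⟩ := hδb y' (mem_ball_zero_iff.2 hy')
  set q := e y with hqy
  set q' := e y' with hqy'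
  have oabs : ∀ w : ℂ, o * w.im ≤ ‖w‖ ∧ -‖w‖ ≤ o * w.im := by
    intro w
    have := abs_le.1 (abs_im_le_norm w)
    rcases ho with rfl | rfl <;> constructor <;> linarith
  have hyn : 0 < ‖y‖ := by
    rw [norm_pos_iff]; rintro h
    have hz0 := hGe.self_of_nhds
    rw [h, mul_zero, hz0] at hy3; simp at hy3
  have hyn' : 0 < ‖y'‖ := by
    rw [norm_pos_iff]; rintro h
    have hz0 := hGe.self_of_nhds
    rw [h, mul_zero, hz0] at hy3'; simp at hy3'
  have imo : ∀ w : ℂ, o * (w ^ 3).im = (o * w.im) * (3 * w.re ^ 2 - (o * w.im) ^ 2) := by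
    intro w; rw [im_cube]; linear_combination (o * w.im ^ 3) * ho2
  have himq : o * (q ^ 3).im < 0 := by
    rw [a3] at hy3; by_contra! h; exact absurd hy3 (not_lt.2 (by positivity))
  have himq' : 0 < o * (q' ^ 3).im := by
    rw [b3] at hy3'; exact (mul_pos_iff_of_pos_left hc₀).1 hy3'
  have secq : 0 < q.re ∧ q.im ^ 2 < 3 * q.re ^ 2 := by
    have r1 := (abs_le.1 ((abs_re_le_norm _).trans a2)).1
    rw [sub_re] at r1
    have r2 := (oabs (q - y)).1
    rw [sub_im] at r2
    have r3 : 0 < q.re := by linarith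
    refine ⟨r3, ?_⟩
    have r4 : o * q.im < q.re := by nlinarith
    rw [imo] at himq
    have r5 : (o * q.im) ^ 2 < 3 * q.re ^ 2 := by
      by_contra! h
      have h1 : 0 < o * q.im := by
        by_contra! h2
        have := mul_nonneg (neg_nonneg.2 h2) (sub_nonneg.2 h)
        linarith
      nlinarith
    nlinarith
  have secq' : 0 < q'.re ∧ q'.im ^ 2 < 3 * q'.re ^ 2 := by
    have r1 := (abs_le.1 ((abs_re_le_norm _).trans b2)).1
    rw [sub_re] at r1
    have r2 := (oabs (q' - y')).2
    rw [sub_im] at r2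
    have r3 : 0 < q'.re := by linarith
    refine ⟨r3, ?_⟩
    have r4 : 0 < o * q'.im := by nlinarith
    rw [imo] at himq'
    have r5 : (o * q'.im) ^ 2 < 3 * q'.re ^ 2 := by
      have := (mul_pos_iff_of_pos_left r4).1 himq'
      linarith
    nlinarith
  obtain ⟨c1, c2⟩ := cube_cpow_of_sector secq.1 secq.2
  obtain ⟨c1', c2'⟩ := cube_cpow_of_sector secq'.1 secq'.2
  have hXq : X (Q (q ^ 3)) = α lam₀ + d * (η * y) ^ 2 := by
    rw [hX, hQ]; simp only; rw [c1, hqy, e.left_inv a1]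
  have hXq' : X (Q (q' ^ 3)) = α lam₀ + d * (η * y') ^ 2 := by
    rw [hX, hQ]; simp only; rw [c1', hqy', e.left_inv b1]
  rw [← hXq, ← hXq']
  set κ : ℝ := δ₁ ^ 3 / 2 with hκ
  have hκ0 : 0 < κ := by positivity
  have hκn : ‖(κ : ℂ)‖ < δ₁ ^ 3 := by
    rw [norm_real, Real.norm_of_nonneg hκ0.le, hκ]
    have : 0 < δ₁ ^ 3 := by positivity
    linarith
  have himne : ∀ w : ℂ, o * w.im ≠ 0 → w.im ≠ 0 := fun w h h' => h (by rw [h', mul_zero])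
  refine (seg (q ^ 3) κ a4 hκn ?_ ?_).trans (seg κ (q' ^ 3) hκn b4 ?_ ?_)
  · intro t ht
    rcases eq_or_lt_of_le ht.2 with rfl | ht1
    · simp [hκ0]
    · rw [mem_slitPlane_iff]; right
      simp only [add_im, im_ofReal_mul, sub_im, ofReal_im]
      have := himne _ himq.ne
      have e1 : (q ^ 3).im + t * (0 - (q ^ 3).im) = (1 - t) * (q ^ 3).im := by ring
      rw [e1]
      exact mul_ne_zero (by linarith) this
  · simpa using himq
  · intro t ht
    rcases eq_or_lt_of_le ht.1 with rfl | ht1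
    · simp [hκ0]
    · rw [mem_slitPlane_iff]; right
      simp only [add_im, im_ofReal_mul, sub_im, ofReal_im, zero_add, sub_zero]
      exact mul_ne_zero ht1.ne' (himne _ himq'.ne')
  · simpa using himq'

end

section
variable {A S : ℂ → ℂ} {Ω : Set ℂ} {lam₀ d σ : ℂ} {F : Family} {α : ℂ → ℂ} {θ r ρ : ℝ}
  {Z K : ℂ → ℂ → ℂ}

theorem slitBall_of_logBranch {p : ℂ} {φ : ℝ} {x l : ℂ} (hd : ‖d‖ = 1)
    (hξ : ‖(x - p) / d‖ < ρ) (hl : exp l = (x - p) / d)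
    (h1 : φ - Real.pi < l.im) (h2 : l.im < φ + Real.pi) :
    x ∈ slitBall p d ρ φ ∧ logBranch φ ((x - p) / d) = l := by
  obtain ⟨h3, h4⟩ := logBranch_exp h1 h2
  rw [hl] at h3 h4
  refine ⟨⟨?_, h3⟩, h4⟩
  rwa [norm_div, hd, div_one, ← mem_ball_iff_norm] at hξ

/-- Points close to the direction of the Stokes line. -/
theorem logBranch_of_arg {p x : ℂ} (hd : ‖d‖ = 1) (hθ : 0 < θ) (hθ' : θ ≤ 2 * Real.pi / 3)
    (hξ0 : (x - p) / d ≠ 0) (hξ : ‖(x - p) / d‖ < ρ) (h1 : |arg ((x - p) / d)| < θ) :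
    x ∈ slitBall p d ρ (θ + Real.pi) ∧
      logBranch (θ + Real.pi) ((x - p) / d) = log ((x - p) / d) + 2 * Real.pi * I := by
  have him : (log ((x - p) / d) + 2 * Real.pi * I).im = arg ((x - p) / d) + 2 * Real.pi := by
    simp [log_im]
  rw [abs_lt] at h1
  refine slitBall_of_logBranch hd hξ ?_ (by rw [him]; linarith) (by rw [him]; linarith)
  rw [exp_add, exp_two_pi_mul_I, mul_one, exp_log hξ0]

/-- Points in the sector opposite to the Stokes line. -/
theorem logBranch_of_re_neg {p x : ℂ} (hd : ‖d‖ = 1) (hθ : 0 < θ) (hθ' : θ ≤ 2 * Real.pi / 3)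
    (hξ : ‖(x - p) / d‖ < ρ) (h : ‖(x - p) / d‖ / 2 < (-((x - p) / d)).re) :
    x ∈ slitBall p d ρ (θ + Real.pi) ∧
      logBranch (θ + Real.pi) ((x - p) / d) = log (-((x - p) / d)) + Real.pi * I := by
  have hξ0 : -((x - p) / d) ≠ 0 := by
    intro h0; rw [h0, neg_eq_zero.1 h0] at h; simp at h
  have him : (log (-((x - p) / d)) + Real.pi * I).im = arg (-((x - p) / d)) + Real.pi := by
    simp [log_im]
  have harg := abs_lt.1 (abs_arg_lt_of_re (ξ := -((x - p) / d)) (by rwa [norm_neg]))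
  refine slitBall_of_logBranch hd hξ ?_ (by rw [him]; linarith) (by rw [him]; linarith)
  rw [exp_add, exp_pi_mul_I, exp_log hξ0]; ring

theorem norm_exp_half_sq {l ξ : ℂ} (h : exp l = ξ) : ‖exp (l / 2)‖ ^ 2 = ‖ξ‖ := by
  rw [← norm_pow, ← exp_nat_mul, ← h]; congr 2; push_cast; ring

/-- Points on the left of the turning point lead, on either sheet, to the points close to the
Stokes line beyond the turning point. Here `k = 0` and `k = -1` are the two sheets. -/
theorem sheet_crossing (hAS : IsPotential A S Ω) (h : IsTurningFamily A S Ω lam₀ F α d θ r)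
    (hρ : 0 < ρ)
    (hU : ∀ᶠ lam in 𝓝 lam₀, Metric.ball (α lam) ρ ⊆ Ω ∧
      IsUniformizer A S lam (α lam) d ρ σ (Z lam) (K lam) ∧
      ∀ x ∈ slitBall (α lam) d ρ (θ + Real.pi), x ∈ F.D lam ∧
        F.z lam x = Z lam (exp (logBranch (θ + Real.pi) ((x - α lam) / d) / 2)) ∧
        F.H lam x = exp (-σ * logBranch (θ + Real.pi) ((x - α lam) / d) / 4) * K lam x)
    {c₀ : ℝ} (hc₀ : 0 < c₀) {G : ℂ → ℂ} (hG : AnalyticAt ℂ G 0) (hG0 : G 0 = -I * c₀)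
    (hGe : ∀ᶠ y in 𝓝 0, Z lam₀ y = y ^ 3 * G y) {o : ℝ} {k : ℤ}
    (hok : o = 1 ∧ k = 0 ∨ o = -1 ∧ k = -1) {F' : Family}
    (hF' : ∀ᶠ lam in 𝓝 lam₀, ∀ x ∈ slitBall (α lam) d ρ (θ + Real.pi),
      F'.z lam x = Z lam (exp ((logBranch (θ + Real.pi) ((x - α lam) / d) +
        k * (2 * Real.pi * I)) / 2)) ∧
      F'.H lam x = exp (-σ * (logBranch (θ + Real.pi) ((x - α lam) / d) +
        k * (2 * Real.pi * I)) / 4) * K lam x) :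
    ∃ δ > 0, ∀ x x' : ℂ, ‖(x - α lam₀) / d‖ < δ → ‖(x' - α lam₀) / d‖ < δ →
      ‖(x - α lam₀) / d‖ / 2 < (-((x - α lam₀) / d)).re → (F.z lam₀ x).re < 0 →
      (x' - α lam₀) / d ≠ 0 → |arg ((x' - α lam₀) / d)| < δ → 0 < (F'.z lam₀ x').re →
      Leads A S Ω lam₀ F x F' x' := by
  have hd := h.norm_dir
  have hd0 : d ≠ 0 := by rintro rfl; simp at hd
  have hpi := Real.pi_pos
  set φ : ℝ := Real.pi + o * Real.pi / 3 with hφ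
  have ho : o = 1 ∨ o = -1 := hok.imp And.left And.left
  have hη : exp (φ * I / 2) ^ 3 = o := by
    rw [← exp_nat_mul, hφ]
    rcases ho with rfl | rfl
    · rw [ofReal_one, ← exp_two_pi_mul_I]; congr 1; push_cast; ring
    · rw [ofReal_neg, ofReal_one, ← exp_pi_mul_I]; congr 1; push_cast; ring
  have hfam : IsFamily A S Ω lam₀ (sheetFamily α d ρ σ Z K φ) := by
    have hx : (α lam₀ + d * (-(ρ / 2 : ℝ)) - α lam₀) / d = -((ρ / 2 : ℝ) : ℂ) := by
      rw [add_sub_cancel_left]; field_simp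
    have hn : ‖(((ρ / 2 : ℝ)) : ℂ)‖ = ρ / 2 := by
      rw [norm_real, Real.norm_of_nonneg (by positivity)]
    obtain ⟨h1, h2⟩ := logBranch_of_re_neg (x := α lam₀ + d * (-(ρ / 2 : ℝ))) (p := α lam₀) (ρ := ρ)
      hd h.pos_angle h.angle_le (by rw [hx, norm_neg, hn]; linarith)
      (by rw [hx, norm_neg, hn, neg_neg, ofReal_re]; linarith)
    have him : (logBranch (θ + Real.pi) ((α lam₀ + d * (-(ρ / 2 : ℝ)) - α lam₀) / d)).im =
        Real.pi := by
      rw [h2, hx, neg_neg]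
      simp only [add_im, log_im, im_ofReal_mul, I_im, mul_one]
      rw [arg_ofReal_of_nonneg (by positivity), zero_add]
    refine isFamily_sheetFamily hAS h.family h.cont hd0 hU h1 ?_ ?_
    · rw [him, hφ]; rcases ho with rfl | rfl <;> linarith
    · rw [him, hφ]; rcases ho with rfl | rfl <;> linarith
  obtain ⟨δ₁, hδ₁, key⟩ := sheetFamily_leads hAS hfam hd hρ ho hη hc₀ hG hG0 hGe
  -- The directions in which the cosine and the sine stay close to their values at `π / 3`.
  obtain ⟨δ₂, hδ₂, hδ₂b⟩ : ∃ δ > 0, ∀ s : ℝ, |s| < δ →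
      2 / 5 ≤ Real.cos (Real.pi / 3 + s) ∧ 4 / 5 ≤ Real.sin (Real.pi / 3 + s) := by
    have t1 : Tendsto (fun s : ℝ => Real.cos (Real.pi / 3 + s)) (𝓝 0)
      (𝓝 (Real.cos (Real.pi / 3 + 0))) := Continuous.tendsto (by fun_prop) 0
    have t2 : Tendsto (fun s : ℝ => Real.sin (Real.pi / 3 + s)) (𝓝 0)
      (𝓝 (Real.sin (Real.pi / 3 + 0))) := Continuous.tendsto (by fun_prop) 0
    rw [add_zero, Real.cos_pi_div_three] at t1
    rw [add_zero, Real.sin_pi_div_three] at t2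
    have s3 : (4 : ℝ) / 5 < √3 / 2 := by
      have : (8 : ℝ) / 5 < √3 := Real.lt_sqrt_of_sq_lt (by norm_num)
      linarith
    obtain ⟨δ, hδ, hb⟩ := Metric.eventually_nhds_iff.1
      ((t1.eventually_const_lt (show (2 : ℝ) / 5 < 1 / 2 by norm_num)).and
        (t2.eventually_const_lt s3))
    exact ⟨δ, hδ, fun s hs => ⟨(hb (by simpa using hs)).1.le, (hb (by simpa using hs)).2.le⟩⟩
  refine ⟨min (min ρ (δ₁ ^ 2)) (min δ₂ (min θ (Real.pi / 3))), by
    have := h.pos_angle; positivity, ?_⟩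
  intro x x' hx hx' hxl hxz hx0' hxa hxz'
  simp only [lt_min_iff] at hx hx' hxa
  -- the point on the left
  obtain ⟨p1, p2⟩ := logBranch_of_re_neg (p := α lam₀) hd h.pos_angle h.angle_le hx.1.1 hxl
  set ξ := (x - α lam₀) / d with hξ
  have hel : exp (log (-ξ) + Real.pi * I) = ξ := by rw [← p2, exp_logBranch (ne_zero_of_mem_slitAt p1.2)]
  have hargl := abs_lt.1 (abs_arg_lt_of_re (ξ := -ξ) (by rwa [norm_neg]))
  set y := exp ((log (-ξ) + Real.pi * I) / 2 - φ * I / 2) with hy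
  have hηy : exp (φ * I / 2) * y = exp ((log (-ξ) + Real.pi * I) / 2) := by
    rw [hy, ← exp_add]; congr 1; ring
  have hyim : ((log (-ξ) + Real.pi * I) / 2 - φ * I / 2).im = (arg (-ξ) - o * Real.pi / 3) / 2 := by
    have : (log (-ξ) + Real.pi * I) / 2 - φ * I / 2 =
      ((1 / 2 : ℝ) : ℂ) * (log (-ξ) + ((Real.pi - φ : ℝ) : ℂ) * I) := by push_cast; ring
    rw [this, im_ofReal_mul, add_im, log_im, im_ofReal_mul, I_im, hφ]; ring
  have hηn : ‖exp (φ * I / 2)‖ = 1 := by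
    have := norm_exp_ofReal_mul_I (φ / 2)
    rw [← this]; congr 2; push_cast; ring
  have hyn : ‖y‖ < δ₁ := by
    refine lt_of_pow_lt_pow_left₀ 2 hδ₁.le ?_
    have h1 := norm_exp_half_sq hel
    rw [← hηy, norm_mul, hηn, one_mul] at h1
    rw [h1]; exact hx.1.2
  have hx_eq : α lam₀ + d * (exp (φ * I / 2) * y) ^ 2 = x := by
    rw [hηy, ← exp_nat_mul, show ((2 : ℕ) : ℂ) * ((log (-ξ) + Real.pi * I) / 2) =
      log (-ξ) + Real.pi * I by push_cast; ring, hel, hξ]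
    field_simp; ring
  have hzx : F.z lam₀ x = Z lam₀ (exp (φ * I / 2) * y) := by
    rw [hηy, ← p2]; exact (hU.self_of_nhds.2.2 x p1).2.1
  -- the point on the right
  obtain ⟨q1, q2⟩ := logBranch_of_arg (p := α lam₀) (θ := θ) hd h.pos_angle h.angle_le hx0' hx'.1.1
    hxa.2.2.1
  set ξ' := (x' - α lam₀) / d with hξ'
  have hel' : exp (log ξ' + 2 * Real.pi * I + k * (2 * Real.pi * I)) = ξ' := by
    rw [exp_add, exp_int_mul_two_pi_mul_I, mul_one, ← q2, exp_logBranch hx0']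
  set y' := exp ((log ξ' + 2 * Real.pi * I + k * (2 * Real.pi * I)) / 2 - φ * I / 2) with hy'
  have hηy' : exp (φ * I / 2) * y' =
      exp ((log ξ' + 2 * Real.pi * I + k * (2 * Real.pi * I)) / 2) := by
    rw [hy', ← exp_add]; congr 1; ring
  have hyim' : ((log ξ' + 2 * Real.pi * I + k * (2 * Real.pi * I)) / 2 - φ * I / 2).im =
      o * (Real.pi / 3 + o * arg ξ' / 2) := by
    have : (log ξ' + 2 * Real.pi * I + k * (2 * Real.pi * I)) / 2 - φ * I / 2 =
      ((1 / 2 : ℝ) : ℂ) * (log ξ' + ((2 * Real.pi + k * (2 * Real.pi) - φ : ℝ) : ℂ) * I) := by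
        push_cast; ring
    rw [this, im_ofReal_mul, add_im, log_im, im_ofReal_mul, I_im, hφ]
    rcases hok with ⟨rfl, rfl⟩ | ⟨rfl, rfl⟩ <;> push_cast <;> ring
  have hyn' : ‖y'‖ < δ₁ := by
    refine lt_of_pow_lt_pow_left₀ 2 hδ₁.le ?_
    have h1 := norm_exp_half_sq hel'
    rw [← hηy', norm_mul, hηn, one_mul] at h1
    rw [h1]; exact hx'.1.2
  have hx_eq' : α lam₀ + d * (exp (φ * I / 2) * y') ^ 2 = x' := by
    rw [hηy', ← exp_nat_mul,
      show ((2 : ℕ) : ℂ) * ((log ξ' + 2 * Real.pi * I + k * (2 * Real.pi * I)) / 2) =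
      log ξ' + 2 * Real.pi * I + k * (2 * Real.pi * I) by push_cast; ring, hel', hξ']
    field_simp; ring
  have hzx' : F'.z lam₀ x' = Z lam₀ (exp (φ * I / 2) * y') := by
    rw [hηy', ← q2]; exact (hF'.self_of_nhds x' q1).1
  have lead := key y y' hyn hyn' ?_ ?_ (by rw [← hzx]; exact hxz) ?_ ?_ (by rw [← hzx']; exact hxz')
  · rw [hx_eq, hx_eq'] at lead
    have e1 := eventually_logBranch_eq (φ' := φ) h.cont p1 0
      (by rw [← hξ, p2]; simp only [add_im, log_im, im_ofReal_mul, I_im, mul_one, Int.cast_zero, mul_zero, add_zero, hφ]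
          rcases ho with rfl | rfl <;> linarith)
      (by rw [← hξ, p2]; simp only [add_im, log_im, im_ofReal_mul, I_im, mul_one, Int.cast_zero, mul_zero, add_zero, hφ]
          rcases ho with rfl | rfl <;> linarith)
    have him2 : (log ξ' + 2 * Real.pi * I).im = arg ξ' + 2 * Real.pi := by simp [log_im]
    have ha' := abs_lt.1 hxa.2.2.2
    have e2 := eventually_logBranch_eq (φ' := φ) h.cont q1 k
      (by rw [← hξ', q2, him2, hφ]
          rcases hok with ⟨rfl, rfl⟩ | ⟨rfl, rfl⟩ <;> push_cast <;> linarith)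
      (by rw [← hξ', q2, him2, hφ]
          rcases hok with ⟨rfl, rfl⟩ | ⟨rfl, rfl⟩ <;> push_cast <;> linarith)
    refine (lead.congr_left ?_).congr_right ?_
    · filter_upwards [e1, hU] with lam ⟨f1, _, f3⟩ f4
      obtain ⟨-, g1, g2⟩ := f4.2.2 x f1
      simp only [Int.cast_zero, zero_mul, add_zero] at f3
      rw [g1, g2, ← f3]
      exact ⟨rfl, rfl⟩
    · filter_upwards [e2, hF'] with lam ⟨f1, _, f3⟩ f4
      obtain ⟨g1, g2⟩ := f4 x' f1
      rw [g1, g2, ← f3]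
      exact ⟨rfl, rfl⟩
  · rw [hy, norm_exp, exp_re, hyim, div_eq_mul_one_div]
    gcongr
    rw [← Real.cos_pi_div_three, ← Real.cos_abs ((arg (-ξ) - o * Real.pi / 3) / 2)]
    apply Real.cos_le_cos_of_nonneg_of_le_pi (abs_nonneg _) (by linarith)
    rw [abs_le]
    rcases ho with rfl | rfl <;> constructor <;> linarith
  · rw [hy, exp_im, hyim]
    have hep := Real.exp_pos ((log (-ξ) + Real.pi * I) / 2 - φ * I / 2).re
    rcases ho with rfl | rfl
    · have := Real.sin_nonpos_of_nonpos_of_neg_pi_le (x := (arg (-ξ) - 1 * Real.pi / 3) / 2)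
        (by linarith) (by linarith)
      nlinarith
    · have := Real.sin_nonneg_of_nonneg_of_le_pi (x := (arg (-ξ) - -1 * Real.pi / 3) / 2)
        (by linarith) (by linarith)
      nlinarith
  · rw [hy', norm_exp, exp_re, hyim', mul_comm]
    gcongr
    have ho' : |o * arg ξ' / 2| < δ₂ := by
      rw [abs_div, abs_mul]
      have : |o| = 1 := by rcases ho with rfl | rfl <;> simp
      rw [this, one_mul, abs_two]
      linarith [hxa.2.1, abs_nonneg (arg ξ')]
    have := (hδ₂b _ ho').1
    rcases ho with rfl | rfl
    · rwa [one_mul]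
    · rwa [neg_one_mul (Real.pi / 3 + _), Real.cos_neg]
  · rw [hy', norm_exp, exp_im, hyim']
    have ho' : |o * arg ξ' / 2| < δ₂ := by
      rw [abs_div, abs_mul]
      have : |o| = 1 := by rcases ho with rfl | rfl <;> simp
      rw [this, one_mul, abs_two]
      linarith [hxa.2.1, abs_nonneg (arg ξ')]
    have := (hδ₂b _ ho').2
    have hep := Real.exp_pos
      ((log ξ' + 2 * Real.pi * I + k * (2 * Real.pi * I)) / 2 - φ * I / 2).re
    rcases ho with rfl | rfl
    · rw [one_mul (Real.pi / 3 + _)]; nlinarith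
    · rw [neg_one_mul (Real.pi / 3 + _), Real.sin_neg]; nlinarith

end

section
variable {A S : ℂ → ℂ} {Ω : Set ℂ} {lam₀ d σ : ℂ} {F : Family} {α : ℂ → ℂ} {θ r : ℝ}

theorem cube_exp_half (l : ℂ) :
    exp (l / 2) ^ 3 = ((‖exp (l / 2)‖ ^ 3 : ℝ) : ℂ) * exp ((3 * l.im / 2 : ℝ) * I) := by
  rw [norm_exp, ← Real.exp_nat_mul, ofReal_exp, ← exp_add, ← exp_nat_mul]
  congr 1
  refine Complex.ext ?_ ?_
  · simp
  · simp; ring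

/-- The Stokes line along which `C⁰` leaves the turning point and the sector through which `C⁻`
leaves it determine each other's signs: if `Re z < 0` on `C⁻`, then `Im z > 0` on `C⁰`, and
`C⁻` leads, on both sheets, to all points close to `C⁰` on the other side of the Stokes line. -/
theorem IsTurningFamily.crossing (hAS : IsPotential A S Ω)
    (h : IsTurningFamily A S Ω lam₀ F α d θ r)
    (hσ : σ = 1 ∧ gPlus A S lam₀ (α lam₀) = 0 ∨ σ = -1 ∧ gMinus A S lam₀ (α lam₀) = 0)
    {c : ℝ → ℂ} {a : ℝ} (hca : c a = α lam₀) (hcc : ContinuousAt c a)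
    (hne : ∀ t, t ≠ a → c t ≠ c a)
    (htan : Tendsto (fun t => (c t - c a) / (‖c t - c a‖ : ℂ)) (𝓝[>] a) (𝓝 d))
    (hsec : ∃ κ : ℝ, 1 / 2 < κ ∧ ∀ᶠ t in 𝓝[<] a, ((c t - c a) / d).re ≤ -κ * ‖c t - c a‖)
    (h0 : ∀ᶠ t in 𝓝[>] a, (F.z lam₀ (c t)).re = 0)
    (hneg : ∀ᶠ t in 𝓝[<] a, (F.z lam₀ (c t)).re < 0) :
    (∀ᶠ t in 𝓝[>] a, 0 < (F.z lam₀ (c t)).im) ∧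
      ∀ᶠ t in 𝓝[<] a, ∀ᶠ t' in 𝓝[>] a, LeadsNear A S Ω lam₀ F (c t) F (c t') ∧
        LeadsNear A S Ω lam₀ F (c t) (F.opposite (I * σ)) (c t') := by
  have hd := h.norm_dir
  have hd0 : d ≠ 0 := by rintro rfl; simp at hd
  have hpi := Real.pi_pos
  obtain ⟨ρ, hρ, Z, K, hU⟩ := h.exists_uniformizer hAS hσ
  obtain ⟨G, hG, hG0, hGe⟩ := hU.self_of_nhds.2.1.germ
  rw [hca] at htan hsec hne
  set ξ : ℝ → ℂ := fun t => (c t - α lam₀) / d with hξ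
  have hξn : ∀ t, ‖ξ t‖ = ‖c t - α lam₀‖ := fun t => by rw [hξ]; simp only; rw [norm_div, hd, div_one]
  have hξ0 : ∀ t, t ≠ a → ξ t ≠ 0 := fun t ht => div_ne_zero (sub_ne_zero.2 (hne t ht)) hd0
  have hξc : Tendsto ξ (𝓝 a) (𝓝 0) := by
    have : Tendsto ξ (𝓝 a) (𝓝 ((c a - α lam₀) / d)) := (hcc.sub_const _).div_const d
    rwa [hca, sub_self, zero_div] at this
  have hsmall : ∀ η > 0, ∀ᶠ t in 𝓝 a, ‖ξ t‖ < η := fun η hη => by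
    have := hξc.norm; rw [norm_zero] at this; exact this.eventually_lt_const hη
  -- the argument on `C⁰`
  have harg : Tendsto (fun t => arg (ξ t)) (𝓝[>] a) (𝓝 0) := by
    have h1 := htan.div_const d
    rw [div_self hd0] at h1
    have h2 := (continuousAt_arg one_mem_slitPlane).tendsto.comp h1
    rw [arg_one] at h2
    refine h2.congr' ?_
    filter_upwards [self_mem_nhdsWithin] with t ht
    have hpos : 0 < ‖c t - α lam₀‖⁻¹ := inv_pos.2 (norm_pos_iff.2 (sub_ne_zero.2 (hne t ht.ne')))
    have e : (c t - α lam₀) / (‖c t - α lam₀‖ : ℂ) / d = ((‖c t - α lam₀‖⁻¹ : ℝ) : ℂ) * ξ t := by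
      rw [hξ]; push_cast; field_simp
    simp only [Function.comp]
    rw [e, arg_real_mul _ hpos]
  have hargs : ∀ η > 0, ∀ᶠ t in 𝓝[>] a, |arg (ξ t)| < η := fun η hη => by
    have := harg.abs; rw [abs_zero] at this; exact this.eventually_lt_const hη
  have hexp0 : ∀ f : Filter ℝ, Tendsto ξ f (𝓝 0) → ∀ l : ℝ → ℂ, (∀ᶠ t in f, exp (l t) = ξ t) →
      Tendsto (fun t => exp (l t / 2)) f (𝓝 0) := by
    intro f hf l hl
    rw [tendsto_zero_iff_norm_tendsto_zero]
    have h1 : Tendsto (fun t => √‖ξ t‖) f (𝓝 (√‖(0 : ℂ)‖)) :=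
      (Real.continuous_sqrt.tendsto _).comp hf.norm
    rw [norm_zero, Real.sqrt_zero] at h1
    refine h1.congr' ?_
    filter_upwards [hl] with t ht
    rw [← norm_exp_half_sq ht, Real.sqrt_sq (norm_nonneg _)]
  -- the phase on `C⁰`
  have hright : ∀ᶠ t in 𝓝[>] a, c t ∈ slitBall (α lam₀) d ρ (θ + Real.pi) ∧
      exp (log (ξ t) + 2 * Real.pi * I) = ξ t ∧
      F.z lam₀ (c t) = Z lam₀ (exp ((log (ξ t) + 2 * Real.pi * I) / 2)) := by
    filter_upwards [nhdsWithin_le_nhds (hsmall ρ hρ), hargs θ h.pos_angle, self_mem_nhdsWithin]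
      with t h1 h2 h3
    obtain ⟨k1, k2⟩ := logBranch_of_arg hd h.pos_angle h.angle_le (hξ0 t (ne_of_gt h3)) h1 h2
    refine ⟨k1, ?_, ?_⟩
    · rw [exp_add, exp_two_pi_mul_I, mul_one, exp_log (hξ0 t (ne_of_gt h3))]
    · rw [(hU.self_of_nhds.2.2 _ k1).2.1, k2]
  have hyR := hexp0 (𝓝[>] a) (hξc.mono_left nhdsWithin_le_nhds) _ (hright.mono fun t ht => ht.2.1)
  have hpolR : ∀ᶠ t in 𝓝[>] a, 0 < ‖exp ((log (ξ t) + 2 * Real.pi * I) / 2)‖ ^ 3 ∧ F.z lam₀ (c t) =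
      ((‖exp ((log (ξ t) + 2 * Real.pi * I) / 2)‖ ^ 3 : ℝ) : ℂ) *
        (exp ((3 * (arg (ξ t) + 2 * Real.pi) / 2 : ℝ) * I) *
          G (exp ((log (ξ t) + 2 * Real.pi * I) / 2))) := by
    filter_upwards [hright, hyR.eventually hGe] with t h1 h2
    refine ⟨by have := norm_pos_iff.2 (exp_ne_zero ((log (ξ t) + 2 * Real.pi * I) / 2)); positivity, ?_⟩
    have him : (log (ξ t) + 2 * Real.pi * I).im = arg (ξ t) + 2 * Real.pi := by simp [log_im]
    rw [h1.2.2, h2, cube_exp_half, him, mul_assoc]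
  have hlimR : Tendsto (fun t => exp ((3 * (arg (ξ t) + 2 * Real.pi) / 2 : ℝ) * I) *
      G (exp ((log (ξ t) + 2 * Real.pi * I) / 2))) (𝓝[>] a) (𝓝 (-G 0)) := by
    have h1 : Tendsto (fun s : ℝ => exp ((3 * (s + 2 * Real.pi) / 2 : ℝ) * I)) (𝓝 0)
        (𝓝 (exp ((3 * (0 + 2 * Real.pi) / 2 : ℝ) * I))) := Continuous.tendsto (by fun_prop) 0
    have h2 : exp ((3 * (0 + 2 * Real.pi) / 2 : ℝ) * I) = -1 := by
      rw [show (((3 * (0 + 2 * Real.pi) / 2 : ℝ)) : ℂ) * I = Real.pi * I + 2 * Real.pi * I by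
        push_cast; ring, exp_add, exp_pi_mul_I, exp_two_pi_mul_I, mul_one]
    rw [h2] at h1
    have := (h1.comp harg).mul (hG.continuousAt.tendsto.comp hyR)
    rwa [neg_one_mul] at this
  have hGre : (G 0).re = 0 := by
    have h1 : Tendsto (fun _ : ℝ => (0 : ℝ)) (𝓝[>] a) (𝓝 (-G 0).re) := by
      refine ((continuous_re.tendsto _).comp hlimR).congr' ?_
      filter_upwards [hpolR, h0] with t ⟨h2, h3⟩ h4
      rw [h3, re_ofReal_mul] at h4
      exact (mul_eq_zero.1 h4).resolve_left h2.ne'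
    have := tendsto_nhds_unique h1 tendsto_const_nhds
    simpa using this
  -- the phase on `C⁻`
  obtain ⟨κ, hκ, hsec⟩ := hsec
  have hleft : ∀ᶠ t in 𝓝[<] a, ξ t ≠ 0 ∧ κ * ‖ξ t‖ ≤ (-ξ t).re := by
    filter_upwards [hsec, self_mem_nhdsWithin] with t h1 h2
    refine ⟨hξ0 t (ne_of_lt h2), ?_⟩
    rw [hξn, neg_re]
    linarith
  have hκ1 : κ ≤ 1 := by
    obtain ⟨t, h1, h2⟩ := hleft.exists
    have h3 := (h2.trans (re_le_norm _))
    rw [norm_neg] at h3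
    have := norm_pos_iff.2 h1
    nlinarith
  have hslitL : ∀ᶠ t in 𝓝[<] a, ‖ξ t‖ / 2 < (-ξ t).re := by
    filter_upwards [hleft] with t ⟨h1, h2⟩
    have := norm_pos_iff.2 h1
    nlinarith
  have hleftz : ∀ᶠ t in 𝓝[<] a, exp (log (-ξ t) + Real.pi * I) = ξ t ∧
      F.z lam₀ (c t) = Z lam₀ (exp ((log (-ξ t) + Real.pi * I) / 2)) := by
    filter_upwards [nhdsWithin_le_nhds (hsmall ρ hρ), hslitL, hleft] with t h1 h2 h3
    obtain ⟨k1, k2⟩ := logBranch_of_re_neg hd h.pos_angle h.angle_le h1 h2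
    refine ⟨?_, ?_⟩
    · rw [exp_add, exp_pi_mul_I, exp_log (neg_ne_zero.2 h3.1)]; ring
    · rw [(hU.self_of_nhds.2.2 _ k1).2.1, k2]
  have hyL := hexp0 (𝓝[<] a) (hξc.mono_left nhdsWithin_le_nhds) _ (hleftz.mono fun t ht => ht.1)
  set g := (G 0).im with hg
  have hGg : G 0 = I * g := by apply Complex.ext <;> simp [hGre, hg]
  have hg0 : g ≠ 0 := by rintro h; rw [hGg, h] at hG0; simp at hG0
  have hgneg : g < 0 := by
    by_contra! hcon
    have hgpos : 0 < g := lt_of_le_of_ne hcon hg0.symm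
    -- the sector condition keeps `Re` of the cube away from zero
    set m := Real.cos (3 / 2 * Real.arccos κ) with hm
    have hacos : Real.arccos κ < Real.pi / 3 := by
      rw [← Real.arccos_cos (x := Real.pi / 3) (by positivity) (by linarith), Real.cos_pi_div_three]
      exact Real.arccos_lt_arccos (by norm_num) hκ hκ1
    have hac0 := Real.arccos_nonneg κ
    have hmpos : 0 < m := Real.cos_pos_of_mem_Ioo ⟨by linarith, by linarith⟩
    have hGc : ∀ᶠ t in 𝓝[<] a, ‖G (exp ((log (-ξ t) + Real.pi * I) / 2)) - G 0‖ < g * m := by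
      have h1 := ((hG.continuousAt.tendsto.comp hyL).sub_const (G 0)).norm
      rw [sub_self, norm_zero] at h1
      exact h1.eventually_lt_const (by positivity)
    obtain ⟨t, ⟨⟨⟨h1, h2⟩, h3, h4⟩, h5⟩, h6⟩ :=
      (((hleftz.and hleft).and hneg).and (hGc.and (hyL.eventually hGe))).exists
    have him : (log (-ξ t) + Real.pi * I).im = arg (-ξ t) + Real.pi := by simp [log_im]
    rw [h2, h6.2, cube_exp_half, him, mul_assoc, re_ofReal_mul] at h5
    have hpos : 0 < ‖exp ((log (-ξ t) + Real.pi * I) / 2)‖ ^ 3 := by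
      have := norm_pos_iff.2 (exp_ne_zero ((log (-ξ t) + Real.pi * I) / 2)); positivity
    set w := G (exp ((log (-ξ t) + Real.pi * I) / 2)) with hw
    set e := exp ((3 * (arg (-ξ t) + Real.pi) / 2 : ℝ) * I) with he
    have hen : ‖e‖ = 1 := norm_exp_ofReal_mul_I _
    have h7 : (e * w).re = (e * (I * g)).re + (e * (w - G 0)).re := by
      rw [← add_re, hGg]; congr 1; ring
    have h8 : -‖w - G 0‖ ≤ (e * (w - G 0)).re := by
      have := (abs_le.1 (abs_re_le_norm (e * (w - G 0)))).1
      rwa [norm_mul, hen, one_mul] at this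
    have h9 : (e * (I * g)).re = g * Real.cos (3 / 2 * arg (-ξ t)) := by
      have : e * (I * g) = (g : ℂ) * exp ((3 / 2 * arg (-ξ t) : ℝ) * I) := by
        rw [he, show ((3 * (arg (-ξ t) + Real.pi) / 2 : ℝ) : ℂ) * I =
          (3 / 2 * arg (-ξ t) : ℝ) * I + (Real.pi * I + Real.pi / 2 * I) by push_cast; ring, exp_add,
          exp_add, exp_pi_mul_I, exp_pi_div_two_mul_I]
        linear_combination (-(g : ℂ) * exp ((3 / 2 * arg (-ξ t) : ℝ) * I)) * I_mul_I
      rw [this, re_ofReal_mul, exp_ofReal_mul_I_re]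
    have h10 : m ≤ Real.cos (3 / 2 * arg (-ξ t)) := by
      rw [hm, ← Real.cos_abs (3 / 2 * arg (-ξ t))]
      apply Real.cos_le_cos_of_nonneg_of_le_pi (abs_nonneg _) (by linarith)
      rw [abs_mul, abs_of_pos (by norm_num : (0 : ℝ) < 3 / 2)]
      gcongr
      rw [← Real.arccos_cos (abs_nonneg (arg (-ξ t))) (abs_arg_le_pi _), Real.cos_abs,
        cos_arg (neg_ne_zero.2 h3)]
      apply Real.arccos_le_arccos
      rw [norm_neg, le_div_iff₀ (norm_pos_iff.2 h3)]
      exact h4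
    have h11 : 0 < (e * w).re := by
      rw [h7, h9]
      have := mul_le_mul_of_nonneg_left h10 hgpos.le
      linarith [h6.1]
    exact absurd h5 (not_lt.2 (mul_pos hpos h11).le)
  refine ⟨?_, ?_⟩
  · have h1 : 0 < (-G 0).im := by rw [neg_im, ← hg]; linarith
    filter_upwards [hpolR, ((continuous_im.tendsto _).comp hlimR).eventually_const_lt h1]
      with t ⟨h2, h3⟩ h4
    rw [h3, im_ofReal_mul]
    exact mul_pos h2 h4
  · have hG0' : G 0 = -I * ((-g : ℝ) : ℂ) := by rw [hGg]; push_cast; ring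
    have hsame := sheet_crossing hAS h hρ hU (neg_pos.2 hgneg) hG hG0' hGe (Or.inl ⟨rfl, rfl⟩)
      (F' := F) (by
        filter_upwards [hU] with lam hl x hx
        simpa using (hl.2.2 x hx).2)
    have hopp := sheet_crossing hAS h hρ hU (neg_pos.2 hgneg) hG hG0' hGe (Or.inr ⟨rfl, rfl⟩)
      (F' := F.opposite (I * σ)) (by
        filter_upwards [hU] with lam hl x hx
        obtain ⟨-, h2, h3⟩ := hl.2.2 x hx
        constructor
        · simp only [Family.opposite]
          rw [h2, ← hl.2.1.odd]
          · congr 1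
            rw [show (logBranch (θ + Real.pi) ((x - α lam) / d) + (-1 : ℤ) * (2 * Real.pi * I)) / 2 =
              logBranch (θ + Real.pi) ((x - α lam) / d) / 2 - Real.pi * I by push_cast; ring,
              exp_sub, exp_pi_mul_I, div_neg, div_one]
          · rw [norm_exp_half_sq (exp_logBranch (ne_zero_of_mem_slitAt hx.2)), norm_div, hd, div_one]
            exact mem_ball_iff_norm.1 hx.1
        · simp only [Family.opposite]
          rw [h3, show -σ * (logBranch (θ + Real.pi) ((x - α lam) / d) +
            (-1 : ℤ) * (2 * Real.pi * I)) / 4 = -σ * logBranch (θ + Real.pi) ((x - α lam) / d) / 4 +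
            σ * (Real.pi / 2 * I) by push_cast; ring, exp_add]
          have : exp (σ * (Real.pi / 2 * I)) = I * σ := by
            rcases hσ with ⟨rfl, -⟩ | ⟨rfl, -⟩
            · rw [one_mul, exp_pi_div_two_mul_I, mul_one]
            · rw [neg_one_mul, exp_neg, exp_pi_div_two_mul_I, inv_I]; ring
          rw [this]; ring)
    obtain ⟨δ₁, hδ₁, k1⟩ := hsame
    obtain ⟨δ₂, hδ₂, k2⟩ := hopp
    have hδ : 0 < min δ₁ δ₂ := lt_min hδ₁ hδ₂
    filter_upwards [nhdsWithin_le_nhds (hsmall _ hδ), hslitL, hneg] with t l1 l2 l3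
    filter_upwards [nhdsWithin_le_nhds (hsmall _ hδ), hargs (min (min δ₁ δ₂) (Real.pi / 3))
      (lt_min hδ (by positivity)), self_mem_nhdsWithin] with t' r1 r2 r3
    have hcont : ContinuousAt (fun x => (x - α lam₀) / d) (c t') := by fun_prop
    have hsl : ξ t' ∈ slitPlane := by
      rw [mem_slitPlane_iff_arg]
      refine ⟨?_, hξ0 t' (ne_of_gt r3)⟩
      intro h'
      have := (lt_min_iff.1 r2).2
      rw [h', abs_of_pos hpi] at this
      linarith
    have ev1 : ∀ᶠ x in 𝓝 (c t'), ‖(x - α lam₀) / d‖ < min δ₁ δ₂ := hcont.norm.eventually_lt_const r1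
    have ev2 : ∀ᶠ x in 𝓝 (c t'), |arg ((x - α lam₀) / d)| < min δ₁ δ₂ := by
      have h1 : ContinuousAt (fun x => arg ((x - α lam₀) / d)) (c t') :=
        ContinuousAt.comp (f := fun x => (x - α lam₀) / d) (continuousAt_arg hsl) hcont
      exact h1.abs.eventually_lt_const (lt_min_iff.1 r2).1
    have ev3 : ∀ᶠ x in 𝓝 (c t'), (x - α lam₀) / d ≠ 0 :=
      hcont.eventually_ne (hξ0 t' (ne_of_gt r3))
    constructor
    · filter_upwards [ev1, ev2, ev3] with x h1 h2 h3 h4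
      exact k1 _ _ (l1.trans_le (min_le_left _ _)) (h1.trans_le (min_le_left _ _)) l2 l3 h3
        (h2.trans_le (min_le_left _ _)) h4
    · filter_upwards [ev1, ev2, ev3] with x h1 h2 h3 h4
      exact k2 _ _ (l1.trans_le (min_le_right _ _)) (h1.trans_le (min_le_right _ _)) l2 l3 h3
        (h2.trans_le (min_le_right _ _)) h4

end

/-! ### The connection at one turning point -/

/-- The part of the geometric data that concerns the left end of the contour `c`: the turning point
`α`, the progressive path `t < a` from `-∞` to `α`, and the Stokes line `a < t < b`. -/
structure IsLeftFrame (A S : ℂ → ℂ) (Ω : Set ℂ) (lam₀ : ℂ) (F : Family) (c : ℝ → ℂ) (a b : ℝ)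
    (α : ℂ → ℂ) (d : ℂ) (θ r : ℝ) : Prop where
  turning : IsTurningFamily A S Ω lam₀ F α d θ r
  increases : IncreasesAtBot lam₀ F
  lt : a < b
  continuous : Continuous c
  injective : Function.Injective c
  base : c a = α lam₀
  mem : ∀ t < b, t ≠ a → c t ∈ F.D lam₀
  real_left : ∀ᶠ t in atBot, c t = t
  tangent : Tendsto (fun t => (c t - c a) / (‖c t - c a‖ : ℂ)) (𝓝[>] a) (𝓝 d)
  sector : ∃ κ : ℝ, 1 / 2 < κ ∧ ∀ᶠ t in 𝓝[<] a, ((c t - c a) / d).re ≤ -κ * ‖c t - c a‖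
  level : ∀ t ∈ Ioo a b, (F.z lam₀ (c t)).re = 0
  mono : StrictMonoOn (fun t => (F.z lam₀ (c t)).re) (Iio a)

section
variable {A S : ℂ → ℂ} {Ω : Set ℂ} {lam₀ d σ : ℂ} {F : Family} {α : ℂ → ℂ} {θ r : ℝ}
  {c : ℝ → ℂ} {a b : ℝ}

/-- If `Re z` increases along the path to the turning point, where it vanishes in the limit, then
it is negative on the path. -/
theorem re_neg_of_strictMonoOn {f : ℝ → ℝ} {a : ℝ} (hm : StrictMonoOn f (Iio a))
    (hf : Tendsto f (𝓝[<] a) (𝓝 0)) : ∀ t < a, f t < 0 := by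
  intro t ht
  have hs : t < (t + a) / 2 ∧ (t + a) / 2 < a := ⟨by linarith, by linarith⟩
  refine lt_of_lt_of_le (hm ht hs.2 hs.1) (ge_of_tendsto hf ?_)
  filter_upwards [Ioo_mem_nhdsLT hs.2] with s hs'
  exact (hm hs.2 hs'.2 hs'.1).le

theorem IsLeftFrame.re_neg (h : IsLeftFrame A S Ω lam₀ F c a b α d θ r) :
    ∀ t < a, (F.z lam₀ (c t)).re < 0 := by
  refine re_neg_of_strictMonoOn h.mono ?_
  have h1 : Tendsto c (𝓝[<] a) (𝓝[F.D lam₀] (α lam₀)) := by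
    rw [← h.base]
    refine tendsto_nhdsWithin_iff.2 ⟨h.continuous.continuousAt.mono_left nhdsWithin_le_nhds, ?_⟩
    filter_upwards [self_mem_nhdsWithin] with t ht
    exact h.mem t (lt_trans ht h.lt) (ne_of_lt ht)
  have h2 := (continuous_re.tendsto 0).comp (h.turning.base.self_of_nhds.comp h1)
  simpa [Function.comp_def] using h2

theorem IsLeftFrame.crossing (hAS : IsPotential A S Ω)
    (h : IsLeftFrame A S Ω lam₀ F c a b α d θ r)
    (hσ : σ = 1 ∧ gPlus A S lam₀ (α lam₀) = 0 ∨ σ = -1 ∧ gMinus A S lam₀ (α lam₀) = 0) :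
    (∀ᶠ t in 𝓝[>] a, 0 < (F.z lam₀ (c t)).im) ∧
      ∀ᶠ t in 𝓝[<] a, ∀ᶠ t' in 𝓝[>] a, LeadsNear A S Ω lam₀ F (c t) F (c t') ∧
        LeadsNear A S Ω lam₀ F (c t) (F.opposite (I * σ)) (c t') := by
  refine h.turning.crossing hAS hσ h.base h.continuous.continuousAt
    (fun t ht => h.injective.ne ht) h.tangent h.sector ?_ ?_
  · filter_upwards [Ioo_mem_nhdsGT h.lt] with t ht using h.level t ht
  · filter_upwards [self_mem_nhdsWithin] with t ht using h.re_neg t ht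

/-- From a point far to the left one reaches all points close to the Stokes line, on the sheet of
`F` on the side `Re z > 0`, and on the other sheet on the side `Re z < 0`. -/
theorem IsLeftFrame.leadsNear (hAS : IsPotential A S Ω)
    (h : IsLeftFrame A S Ω lam₀ F c a b α d θ r)
    (hσ : σ = 1 ∧ gPlus A S lam₀ (α lam₀) = 0 ∨ σ = -1 ∧ gMinus A S lam₀ (α lam₀) = 0) :
    ∀ᶠ R : ℝ in atBot, ∀ t ∈ Ioo a b, LeadsNear A S Ω lam₀ F R F (c t) ∧
      LeadsNear A S Ω lam₀ F R (F.opposite (I * σ)) (c t) := by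
  have hs : (I * σ) ^ 2 = -1 := by
    rcases hσ with ⟨rfl, -⟩ | ⟨rfl, -⟩ <;> simp
  obtain ⟨t₀, h1, h2⟩ := ((h.crossing hAS hσ).2.and self_mem_nhdsWithin).exists
  obtain ⟨t', ⟨h3, h4⟩, h5⟩ := (h1.and (Ioo_mem_nhdsGT h.lt)).exists
  have hta : ∀ t ∈ Ioo a b, c t ∈ F.D lam₀ := fun t ht => h.mem t ht.2 ht.1.ne'
  filter_upwards [h.real_left, eventually_lt_atBot t₀] with R hR hRt t ht
  have key : Leads A S Ω lam₀ F R F (c t₀) := by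
    have := h.turning.family.leads_of_strictMonoOn hAS hRt h.continuous.continuousOn
      (fun s hs => h.mem s (lt_trans (lt_of_le_of_lt hs.2 h2) h.lt)
        (ne_of_lt (lt_of_le_of_lt hs.2 h2)))
      (h.mono.mono fun s hs => lt_of_le_of_lt hs.2 h2)
    rwa [hR] at this
  have step : ∀ G : Family, LeadsNear A S Ω lam₀ F (c t₀) G (c t') →
      LeadsNear A S Ω lam₀ F R G (c t') := fun G hG => hG.mono fun y hy hp => key.trans (hy hp)
  constructor
  · exact h.turning.family.leadsNear_of_level hAS isPreconnected_Ioo h.continuous.continuousOn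
      hta h.level h5 ht (step _ h3)
  · exact (h.turning.family.opposite hs).leadsNear_of_level hAS isPreconnected_Ioo
      h.continuous.continuousOn hta (fun t ht => by simp [Family.opposite, h.level t ht]) h5 ht
      (step _ h4)

/-- Two points on different sides of the Stokes line are joined by a progressive path. -/
theorem IsFamily.leads_of_mem_regions (hAS : IsPotential A S Ω) (hF : IsFamily A S Ω lam₀ F)
    {J : Set ℝ} (hJ : IsPreconnected J) (hc : ContinuousOn c J)
    (hD : ∀ t ∈ J, c t ∈ F.D lam₀) (h0 : ∀ t ∈ J, (F.z lam₀ (c t)).re = 0) {x₁ x₂ : ℂ}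
    (hx₁ : x₁ ∈ downRegion (F.D lam₀) (F.z lam₀) (c '' J))
    (hx₂ : x₂ ∈ upRegion (F.D lam₀) (F.z lam₀) (c '' J)) : Leads A S Ω lam₀ F x₂ F x₁ := by
  obtain ⟨γ, hγ, hγD, rfl, ⟨t, ht, hγt⟩, hγm⟩ := hx₁
  obtain ⟨δ, hδ, hδD, rfl, ⟨t', ht', hδt⟩, hδm⟩ := hx₂
  refine hF.leads_of_leadsNear hAS hγ hγD hγm (by rw [← hγt]; exact h0 t ht) ?_
  rw [← hγt]
  refine hF.leadsNear_of_level hAS hJ hc hD h0 ht' ht ?_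
  have h1 : (1 : ℝ) ∈ Icc (0 : ℝ) 1 := right_mem_Icc.2 zero_le_one
  rw [hδt]
  obtain ⟨N, hN, -, hNL⟩ := hF.eventually_leads hAS (hδD 1 h1)
  have h2 : 𝓝[<] (1 : ℝ) ≤ 𝓝[Icc 0 1] (1 : ℝ) := by
    rw [← nhdsWithin_Ioo_eq_nhdsLT (zero_lt_one' ℝ)]
    exact nhdsWithin_mono _ Ioo_subset_Icc_self
  obtain ⟨s, hs1, hs2⟩ := ((((hδ 1 h1).eventually (eventually_mem_nhds_iff.2 hN)).filter_mono
    h2).and (Ioo_mem_nhdsLT (zero_lt_one' ℝ))).exists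
  filter_upwards [hN] with y hy hpos
  have h3 : (F.z lam₀ (δ s)).re < 0 := by
    rw [← h0 t' ht', hδt]
    exact hδm (Ioo_subset_Icc_self hs2) h1 hs2.2
  exact (hF.leads_of_strictMonoOn hAS hs2.1 (hδ.mono (Icc_subset_Icc_right hs2.2.le))
    (fun u hu => hδD u ⟨hu.1, hu.2.trans hs2.2.le⟩)
    (hδm.mono (Icc_subset_Icc_right hs2.2.le))).trans
    (hNL _ (mem_of_mem_nhds hs1) _ hy (h3.trans hpos))

/-- Two quantities that agree with `E ≠ 0` up to a relative error have a quotient close to `1`. -/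
theorem norm_div_sub_one_le {E E₁ E₂ : ℂ} {δ : ℝ} (hE : E ≠ 0) (hδ : δ ≤ 1 / 2)
    (h₁ : ‖E₁ - E‖ ≤ δ * ‖E‖) (h₂ : ‖E₂ - E‖ ≤ δ * ‖E‖) :
    E₁ ≠ 0 ∧ E₂ ≠ 0 ∧ ‖E₁ / E₂ - 1‖ ≤ 4 * δ := by
  have hE' := norm_pos_iff.2 hE
  have ne : ∀ {E' : ℂ}, ‖E' - E‖ ≤ δ * ‖E‖ → ‖E‖ / 2 ≤ ‖E'‖ := by
    intro E' h
    have := norm_sub_norm_le E E'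
    rw [norm_sub_rev] at this
    nlinarith
  have n2 := ne h₂
  have h2 : E₂ ≠ 0 := norm_pos_iff.1 (by linarith)
  refine ⟨norm_pos_iff.1 (by linarith [ne h₁]), h2, ?_⟩
  rw [div_sub_one h2, norm_div, div_le_iff₀ (norm_pos_iff.2 h2)]
  have h3 : ‖E₁ - E₂‖ ≤ ‖E₁ - E‖ + ‖E₂ - E‖ := by
    rw [norm_sub_rev E₂ E]; exact norm_sub_le_norm_sub_add_norm_sub _ _ _
  have hδ0 : 0 ≤ δ := by
    by_contra! h; nlinarith [norm_nonneg (E₁ - E)]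
  nlinarith

/-- The connection formula at one turning point: the decaying solution `u₀` compared with the
solutions `u₁`, `u₂` on either side of the Stokes line. -/
theorem IsLeftFrame.connection (hAS : IsPotential A S Ω) (hlam₀ : lam₀.im ≠ 0)
    (h : IsLeftFrame A S Ω lam₀ F c a b α d θ r)
    (hσ : σ = 1 ∧ gPlus A S lam₀ (α lam₀) = 0 ∨ σ = -1 ∧ gMinus A S lam₀ (α lam₀) = 0)
    {x₁ x₂ : ℂ} (hx₁ : x₁ ∈ downRegion (F.D lam₀) (F.z lam₀) (c '' Ioo a b))
    (hx₂ : x₂ ∈ upRegion (F.D lam₀) (F.z lam₀) (c '' Ioo a b)) :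
    ∃ R C ε₀ : ℝ, 0 ≤ C ∧ 0 < ε₀ ∧ ∀ᶠ lam in 𝓝 lam₀, ∀ ε : ℝ, 0 < ε → ε < ε₀ →
      ∀ u₀ u₁ u₂ : ℂ → Fin 2 → ℂ,
        IsExactWKBAtInfinity A S Ω ε lam (F.z lam) (F.H lam) .plus atBot u₀ →
        IsSolution A S Ω ε lam u₁ → IsSolution A S Ω ε lam u₂ →
        u₁ x₁ = wkbVector S (F.z lam) (F.H lam) .minus ε 1 0 x₁ →
        u₂ x₂ = wkbVector S (F.z lam) (F.H lam) .plus ε 1 0 x₂ →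
        (∀ j, MemLp (fun x : ℝ => u₀ x j) 2 (volume.restrict (Iic R))) ∧
        ∀ x ∈ Ω, wronskian u₂ u₀ x ≠ 0 ∧ wronskian u₂ u₁ x ≠ 0 ∧
          ‖wronskian u₀ u₁ x / wronskian u₂ u₀ x - I * σ‖ ≤ C * ε := by
  have hs : (I * σ) ^ 2 = -1 := by
    rcases hσ with ⟨rfl, -⟩ | ⟨rfl, -⟩ <;> simp
  have hσ1 : σ ^ 2 = 1 := by rcases hσ with ⟨rfl, -⟩ | ⟨rfl, -⟩ <;> simp
  have hσn : ‖σ‖ = 1 := by rcases hσ with ⟨rfl, -⟩ | ⟨rfl, -⟩ <;> simp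
  have hfam := h.turning.family
  have hta : ∀ t ∈ Ioo a b, c t ∈ F.D lam₀ := fun t ht => h.mem t ht.2 ht.1.ne'
  obtain ⟨C₃, e₃, hC₃, he₃, L₃⟩ := hfam.leads_of_mem_regions hAS isPreconnected_Ioo
    h.continuous.continuousOn hta h.level hx₁ hx₂
  obtain ⟨R, hR1, hR2⟩ := ((h.leadsNear hAS hσ).and
    (h.increases.exactWKB hAS hlam₀ hfam.frame)).exists
  have mem0 : ∀ x ∈ F.D lam₀, ∀ᶠ lam in 𝓝 lam₀, x ∈ F.D lam := fun x hx =>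
    ((Continuous.prodMk_left x).tendsto lam₀).eventually (hfam.mem x hx)
  obtain ⟨γ, hγ, hγD, rfl, ⟨t, ht, hγt⟩, hγm⟩ := hx₁
  obtain ⟨δ, hδ, hδD, rfl, ⟨t', ht', hδt⟩, hδm⟩ := hx₂
  obtain ⟨C₁, e₁, hC₁, he₁, L₁⟩ := hfam.leads_of_leadsNear hAS hγ hγD hγm
    (by rw [← hγt]; exact h.level t ht) (by rw [← hγt]; exact (hR1 t ht).1)
  obtain ⟨C₂, e₂, hC₂, he₂, L₂⟩ := (hfam.opposite hs).leads_of_leadsNear hAS hδ hδD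
    (fun s hs s' hs' hss => by simpa [Family.opposite] using hδm hs hs' hss)
    (by rw [← hδt]; simpa [Family.opposite] using h.level t' ht')
    (by rw [← hδt]; exact (hR1 t' ht').2)
  set K := C₁ + C₂ + C₃ + 1 with hK
  refine ⟨R, 4 * K, min (min e₁ e₂) (min e₃ (1 / (2 * K))), by positivity, by positivity, ?_⟩
  have z01 : (0 : ℝ) ∈ Icc (0 : ℝ) 1 := left_mem_Icc.2 zero_le_one
  filter_upwards [hR2, L₁, L₂, L₃, hfam.frame, mem0 _ (hγD 0 z01), mem0 _ (hδD 0 z01)]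
    with lam h2 L₁ L₂ L₃ F0 hm₁ hm₂ ε hε hεe u₀ u₁ u₂ hu₀ hu₁ hu₂ b₁ b₂
  have hε1 : ε < e₁ := lt_of_lt_of_le hεe ((min_le_left _ _).trans (min_le_left _ _))
  have hε2 : ε < e₂ := lt_of_lt_of_le hεe ((min_le_left _ _).trans (min_le_right _ _))
  have hε3 : ε < e₃ := lt_of_lt_of_le hεe ((min_le_right _ _).trans (min_le_left _ _))
  have hεK : K * ε ≤ 1 / 2 := by
    have : ε < 1 / (2 * K) := lt_of_lt_of_le hεe ((min_le_right _ _).trans (min_le_right _ _))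
    rw [lt_div_iff₀ (by positivity)] at this
    linarith
  obtain ⟨o0, ne0, lp⟩ := h2 ε hε u₀ hu₀
  have k1 := (L₁ ε hε hε1 u₀ hu₀.1 o0).2
  have k2 := (L₂ ε hε hε2 u₀ hu₀.1 o0).2
  obtain ⟨s2, s2'⟩ := symbol_of_eq_wkbVector (F0.H_ne hm₂) b₂
  have k3 := (L₃ ε hε hε3 u₂ hu₂ (by rw [s2, s2']; simp)).2
  have le : ∀ C' : ℝ, 0 ≤ C' → C' ≤ K → ∀ X : ℝ, 0 ≤ X → C' * ε * X ≤ K * ε * X :=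
    fun C' _ hK' X hX => by gcongr
  set E := symbolEven S (F.z lam) (F.H lam) ε u₀ R
  obtain ⟨n1, n2, n3⟩ := norm_div_sub_one_le ne0 hεK
    (k1.trans (le _ hC₁ (by linarith) _ (norm_nonneg _)))
    (k2.trans (le _ hC₂ (by linarith) _ (norm_nonneg _)))
  obtain ⟨n4, -, -⟩ := norm_div_sub_one_le (E := symbolEven S (F.z lam) (F.H lam) ε u₂ (δ 0))
    (by rw [s2]; exact one_ne_zero) hεK
    (k3.trans (le _ hC₃ (by linarith) _ (norm_nonneg _)))
    (k3.trans (le _ hC₃ (by linarith) _ (norm_nonneg _)))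
  have hpre := hAS.isPreconnected
  have hε0 : ε ≠ 0 := hε.ne'
  refine ⟨lp, fun x hx => ?_⟩
  have w1 := wronskian_of_eq_wkbVector_minus (u := u₀) (F0.H_ne hm₁) b₁
  have w2 := wronskian_of_eq_wkbVector_plus (u := u₀) (F0.H_ne hm₂) hs b₂
  have w3 := wronskian_of_eq_wkbVector_minus (u := u₂) (F0.H_ne hm₁) b₁
  rw [hu₀.1.wronskian_eq hu₁ hAS.isOpen hpre hε0 (F0.subset hm₁) hx] at w1
  rw [hu₂.wronskian_eq hu₀.1 hAS.isOpen hpre hε0 (F0.subset hm₂) hx] at w2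
  rw [hu₂.wronskian_eq hu₁ hAS.isOpen hpre hε0 (F0.subset hm₁) hx] at w3
  have hσ0 : σ ≠ 0 := by rintro rfl; simp at hσ1
  have w2' : wronskian u₂ u₀ x = 4 * σ *
      symbolEven S ((F.opposite (I * σ)).z lam) ((F.opposite (I * σ)).H lam) ε u₀ (δ 0) := by
    rw [show -4 * I * (I * σ) = 4 * σ by linear_combination (-4 * σ) * I_sq] at w2
    exact w2
  set E₁ := symbolEven S (F.z lam) (F.H lam) ε u₀ (γ 0)
  set E₂ := symbolEven S ((F.opposite (I * σ)).z lam) ((F.opposite (I * σ)).H lam) ε u₀ (δ 0)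
  refine ⟨?_, ?_, ?_⟩
  · rw [w2']; exact mul_ne_zero (mul_ne_zero (by norm_num) hσ0) n2
  · rw [w3]; exact mul_ne_zero (mul_ne_zero (by norm_num) I_ne_zero) n4
  · have e : wronskian u₀ u₁ x / wronskian u₂ u₀ x - I * σ = I * σ * (E₁ / E₂ - 1) := by
      rw [w1, w2']
      field_simp
      linear_combination -E₁ * hσ1
    rw [e, norm_mul, norm_mul, norm_I, hσn, one_mul, one_mul]
    linarith

end

/-! ### Phases along the contour -/

/-- A continuous function on an interval that is locally injective is strictly monotone. -/
theorem strictMonoOn_or_strictAntiOn_of_locally_injOn {f : ℝ → ℝ} {s : Set ℝ} (hs : s.OrdConnected)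
    (hso : IsOpen s) (hne : s.Nonempty) (hf : ContinuousOn f s)
    (hloc : ∀ t ∈ s, ∃ N ∈ 𝓝 t, InjOn f N) : StrictMonoOn f s ∨ StrictAntiOn f s := by
  have noext : ∀ t ∈ s, ¬ IsLocalExtr f t := by
    intro t ht hext
    obtain ⟨N, hN, hinj⟩ := hloc t ht
    obtain ⟨δ, hδ, hb⟩ := Metric.mem_nhds_iff.1 (inter_mem hN (hso.mem_nhds ht))
    rw [Real.ball_eq_Ioo] at hb
    have h1 : t - δ < t + δ := by linarith
    have h2 := ContinuousOn.strictMonoOn_of_injOn_Ioo h1 (hf.mono fun x hx => (hb hx).2)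
      (hinj.mono fun x hx => (hb hx).1)
    have ht0 : t ∈ Ioo (t - δ) (t + δ) := ⟨by linarith, by linarith⟩
    have l1 : Ioo (t - δ) t ∈ 𝓝[<] t := Ioo_mem_nhdsLT (by linarith)
    have l2 : Ioo t (t + δ) ∈ 𝓝[>] t := Ioo_mem_nhdsGT (by linarith)
    have key : ∀ {g : ℝ → ℝ}, StrictMonoOn g (Ioo (t - δ) (t + δ)) → ¬ IsLocalExtr g t := by
      intro g hg he
      rcases he with he | he
      · obtain ⟨x, hx1, hx2⟩ := ((he.filter_mono nhdsWithin_le_nhds).and l1).exists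
        exact absurd (hg ⟨hx2.1, by linarith [hx2.2]⟩ ht0 hx2.2) (not_lt.2 hx1)
      · obtain ⟨x, hx1, hx2⟩ := ((he.filter_mono nhdsWithin_le_nhds).and l2).exists
        exact absurd (hg ht0 ⟨by linarith [hx2.1], hx2.2⟩ hx2.1) (not_lt.2 hx1)
    rcases h2 with h2 | h2
    · exact key h2 hext
    · refine key (g := fun x => -f x) (fun x hx y hy hxy => neg_lt_neg (h2 hx hy hxy)) ?_
      exact hext.elim (fun h => Or.inr h.neg) (fun h => Or.inl h.neg)
  have hinj : InjOn f s := by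
    have key : ∀ x ∈ s, ∀ y ∈ s, x < y → f x ≠ f y := by
      intro x hx y hy hxy h
      obtain ⟨t, ht, hext⟩ := exists_isLocalExtr_Ioo hxy (hf.mono (hs.out hx hy)) h
      exact noext t (hs.out hx hy (Ioo_subset_Icc_self ht)) hext
    intro x hx y hy hxy
    by_contra hne
    rcases lt_or_gt_of_ne hne with h | h
    · exact key x hx y hy h hxy
    · exact key y hy x hx h hxy.symm
  have : Inhabited s := Classical.inhabited_of_nonempty hne.to_subtype
  have h := Continuous.strictMono_of_inj (f := s.domRestrict f) hf.domRestrict hinj.injective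
  exact h.imp strictMono_domRestrict.mp strictAntiOn_iff_strictAnti.mpr

section
variable {A S : ℂ → ℂ} {Ω D : Set ℂ} {lam lam₀ : ℂ} {z H : ℂ → ℂ} {γ : ℝ → ℂ} {J : Set ℝ}
  {ζ : ℝ → ℂ}

/-- A phase along a path agrees locally, up to its sign and an additive constant, with a given
branch of the phase. -/
theorem IsPhaseAlong.eventually_eq (hF : IsFrame A S Ω lam D z H)
    (h : IsPhaseAlong (V0 A S lam) γ J ζ) {t : ℝ} (hJ : J ∈ 𝓝 t) (hγ : ContinuousAt γ t)
    (hD : γ t ∈ D) : ∃ s k : ℂ, (s = 1 ∨ s = -1) ∧ ∀ᶠ u in 𝓝 t, ζ u = s * z (γ u) + k := by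
  obtain ⟨G, hG, hGd, hGζ⟩ := h.2 t (mem_of_mem_nhds hJ) (hF.ne_zero _ hD)
  rw [nhdsWithin_eq_nhds.2 hJ] at hGζ
  obtain ⟨r, hr, hb⟩ := Metric.eventually_nhds_iff_ball.1
    ((hG.eventually_analyticAt.and hGd).and (hF.isOpen.eventually_mem hD))
  have hpre := (convex_ball (γ t) r).isPreconnected
  have key := hpre.eq_or_eq_neg_of_sq_eq (f := deriv G) (g := deriv z)
    (fun x hx => (hb x hx).1.1.deriv.continuousAt.continuousWithinAt)
    ((hF.holo_z.deriv hF.isOpen).continuousOn.mono fun x hx => (hb x hx).2)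
    (fun x hx => by
      simp only [Pi.pow_apply]
      rw [(hb x hx).1.2, hF.deriv_sq (hb x hx).2])
    (fun {x} hx => hF.deriv_ne (hb x hx).2)
  obtain ⟨s, hs, hsd⟩ : ∃ s : ℂ, (s = 1 ∨ s = -1) ∧
      ∀ x ∈ Metric.ball (γ t) r, deriv G x = s * deriv z x := by
    rcases key with h | h
    · exact ⟨1, Or.inl rfl, fun x hx => by rw [h hx, one_mul]⟩
    · exact ⟨-1, Or.inr rfl, fun x hx => by rw [h hx]; simp⟩
  have hd : ∀ x ∈ Metric.ball (γ t) r, HasDerivAt (fun x => G x - s * z x) 0 x := by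
    intro x hx
    have := (hb x hx).1.1.differentiableAt.hasDerivAt.sub
      ((hF.hasDerivAt_z (hb x hx).2).const_mul s)
    rwa [hsd x hx, sub_self] at this
  obtain ⟨k, hk⟩ := Metric.isOpen_ball.exists_is_const_of_deriv_eq_zero hpre
    (fun x hx => (hd x hx).differentiableAt.differentiableWithinAt) (fun x hx => (hd x hx).deriv)
  refine ⟨s, k, hs, ?_⟩
  filter_upwards [hGζ, hγ.eventually (Metric.ball_mem_nhds _ hr)] with u h1 h2
  rw [h1, ← hk _ h2]; ring

/-- `Re z` is strictly monotone on a progressive path. -/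
theorem IsProgressive.strictMonoOn_or_strictAntiOn (hF : IsFrame A S Ω lam D z H)
    (h : IsProgressive (V0 A S lam) γ J) (hs : J.OrdConnected) (hso : IsOpen J)
    (hne : J.Nonempty) (hγ : Continuous γ) (hD : ∀ t ∈ J, γ t ∈ D) :
    StrictMonoOn (fun t => (z (γ t)).re) J ∨ StrictAntiOn (fun t => (z (γ t)).re) J := by
  obtain ⟨-, ζ, hζ, hm⟩ := h
  refine strictMonoOn_or_strictAntiOn_of_locally_injOn hs hso hne (fun t ht => ?_) fun t ht => ?_
  · exact (continuous_re.continuousAt.comp (ContinuousAt.comp (f := γ)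
      (hF.hasDerivAt_z (hD t ht)).continuousAt hγ.continuousAt)).continuousWithinAt
  · obtain ⟨s, k, hsg, he⟩ := hζ.eventually_eq hF (hso.mem_nhds ht) hγ.continuousAt (hD t ht)
    refine ⟨_, inter_mem he (hso.mem_nhds ht), fun x hx y hy hxy => ?_⟩
    have hinj : InjOn (fun t => (ζ t).re) J := hm.elim (·.injOn) (·.injOn)
    apply hinj hx.2 hy.2
    have h1 : ζ x = s * z (γ x) + k := hx.1
    have h2 : ζ y = s * z (γ y) + k := hy.1
    have hxy' : (z (γ x)).re = (z (γ y)).re := hxy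
    simp only [h1, h2]
    rcases hsg with rfl | rfl <;> simp [hxy']

/-- `Re z` is constant on a Stokes line. -/
theorem IsStokesLine.re_eq (hF : IsFrame A S Ω lam D z H) {a b : ℝ}
    (h : IsStokesLine (V0 A S lam) γ (Icc a b)) (hγ : Continuous γ)
    (hD : ∀ t ∈ Ioo a b, γ t ∈ D) {t t' : ℝ} (ht : t ∈ Ioo a b) (ht' : t' ∈ Ioo a b) :
    (z (γ t)).re = (z (γ t')).re := by
  obtain ⟨ζ, hζ, h0⟩ := h
  refine isPreconnected_Ioo.induction₂ (fun t t' => (z (γ t)).re = (z (γ t')).re) ?_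
    (fun _ _ _ _ _ _ => Eq.trans) (fun _ _ _ _ => Eq.symm) ht ht'
  intro t ht
  have hJ : Icc a b ∈ 𝓝 t := Icc_mem_nhds ht.1 ht.2
  obtain ⟨s, k, hs, he⟩ := hζ.eventually_eq hF hJ hγ.continuousAt (hD t ht)
  have e0 := he.self_of_nhds
  filter_upwards [nhdsWithin_le_nhds he, nhdsWithin_le_nhds hJ] with u h1 h2
  have h3 := h0 t (Ioo_subset_Icc_self ht)
  have h4 := h0 u h2
  rw [e0] at h3
  rw [h1] at h4
  rcases hs with rfl | rfl <;> simp at h3 h4 <;> linarith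

/-- `Im z` is strictly monotone on an injective arc of a level line of `Re z`. -/
theorem IsFrame.im_strictMonoOn_or_strictAntiOn (hF : IsFrame A S Ω lam D z H) {a b : ℝ}
    (hab : a < b) (hγ : Continuous γ) (hinj : Function.Injective γ)
    (hD : ∀ t ∈ Ioo a b, γ t ∈ D) (h0 : ∀ t ∈ Ioo a b, (z (γ t)).re = 0) :
    StrictMonoOn (fun t => (z (γ t)).im) (Ioo a b) ∨
      StrictAntiOn (fun t => (z (γ t)).im) (Ioo a b) := by
  refine strictMonoOn_or_strictAntiOn_of_locally_injOn ordConnected_Ioo isOpen_Ioo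
    (nonempty_Ioo.2 hab) (fun t ht => ?_) fun t ht => ?_
  · exact (continuous_im.continuousAt.comp (ContinuousAt.comp (f := γ)
      (hF.hasDerivAt_z (hD t ht)).continuousAt hγ.continuousAt)).continuousWithinAt
  · obtain ⟨e, he1, -, he3⟩ := exists_openPartialHomeomorph hF.isOpen hF.holo_z (hD t ht)
      (hF.deriv_ne (hD t ht))
    refine ⟨_, inter_mem (hγ.continuousAt.preimage_mem_nhds (e.open_source.mem_nhds he1))
      (isOpen_Ioo.mem_nhds ht), fun x hx y hy hxy => ?_⟩
    apply hinj
    apply e.injOn hx.1 hy.1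
    rw [he3]
    exact Complex.ext ((h0 x hx.2).trans (h0 y hy.2).symm) hxy

end

/-! ### Cut domains -/

section
variable {A S : ℂ → ℂ} {Ω W : Set ℂ} {lam₀ : ℂ} {α β : ℂ → ℂ} {k l : ℂ}

theorem mem_segment_add_iff {x p k : ℂ} : x ∈ segment ℝ p (p + k) ↔ x - p ∈ segment ℝ 0 k := by
  have := mem_segment_translate ℝ p (x := x - p) (b := 0) (c := k)
  rwa [add_sub_cancel, add_zero] at this

theorem isClosed_segment_zero (k : ℂ) : IsClosed (segment ℝ 0 k) := by
  rw [← convexHull_pair]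
  exact ((Set.toFinite _).isCompact_convexHull ℝ).isClosed

/-- Translated segments depend continuously on the translation. -/
theorem eventually_notMem_segment (hα : ContinuousAt α lam₀) {x : ℂ}
    (hx : x ∉ segment ℝ (α lam₀) (α lam₀ + k)) :
    ∀ᶠ q : ℂ × ℂ in 𝓝 (lam₀, x), q.2 ∉ segment ℝ (α q.1) (α q.1 + k) := by
  simp only [mem_segment_add_iff] at hx ⊢
  have h0 : ContinuousAt (fun q : ℂ × ℂ => α q.1) (lam₀, x) :=
    ContinuousAt.comp (x := (lam₀, x)) (f := Prod.fst) hα continuousAt_fst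
  exact (continuousAt_snd.sub h0).eventually ((isClosed_segment_zero k).isOpen_compl.mem_nhds hx)

theorem eventually_mem_cutDomain (hW : IsOpen W) (hα : ContinuousAt α lam₀)
    (hβ : ContinuousAt β lam₀) {x : ℂ} (hx : x ∈ cutDomain W (α lam₀) k (β lam₀) l) :
    ∀ᶠ q : ℂ × ℂ in 𝓝 (lam₀, x), q.2 ∈ cutDomain W (α q.1) k (β q.1) l := by
  have hx2 := not_or.1 hx.2
  filter_upwards [continuousAt_snd.eventually (hW.mem_nhds hx.1), eventually_notMem_segment hα hx2.1,
    eventually_notMem_segment hβ hx2.2] with q h1 h2 h3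
  exact ⟨h1, not_or.2 ⟨h2, h3⟩⟩

theorem isOpen_cutDomain (hW : IsOpen W) (p q : ℂ) : IsOpen (cutDomain W p k q l) := by
  refine isOpen_iff_mem_nhds.2 fun x hx => ?_
  exact ((Continuous.prodMk_right (0 : ℂ)).tendsto x).eventually
    (eventually_mem_cutDomain (α := fun _ => p) (β := fun _ => q) (lam₀ := 0) hW
      continuousAt_const continuousAt_const hx)

theorem eventually_far_notMem_segment (hα : ContinuousAt α lam₀) {f : Filter ℝ}
    (hf : Tendsto (fun x : ℝ => |x|) f atTop) :
    ∀ᶠ q : ℂ × ℝ in 𝓝 lam₀ ×ˢ f, (q.2 : ℂ) ∉ segment ℝ (α q.1) (α q.1 + k) := by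
  have h1 : ∀ᶠ lam in 𝓝 lam₀, ‖α lam‖ < ‖α lam₀‖ + 1 :=
    hα.norm.eventually_lt_const (by linarith)
  filter_upwards [h1.prod_inl f, (hf.eventually_gt_atTop (‖α lam₀‖ + 1 + ‖k‖)).prod_inr _]
    with q h2 h3 h4
  rw [mem_segment_add_iff, segment_eq_image] at h4
  obtain ⟨s, hs, hq⟩ := h4
  have h5 : ‖(q.2 : ℂ) - α q.1‖ ≤ ‖k‖ := by
    rw [← hq]
    simp only [smul_zero, zero_add, norm_smul, Real.norm_eq_abs, abs_of_nonneg hs.1]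
    exact mul_le_of_le_one_left (norm_nonneg _) hs.2
  have h6 := norm_sub_norm_le (q.2 : ℂ) (α q.1)
  rw [norm_real, Real.norm_eq_abs] at h6
  linarith

/-- On a cut domain, a family of frames is a family around the turning point at which the first cut
begins. -/
theorem IsFamily.isTurningFamily {F : Family} {d : ℂ} {θ r₀ : ℝ} (hF : IsFamily A S Ω lam₀ F)
    (hα : ContinuousAt α lam₀) (hβ : ContinuousAt β lam₀)
    (hzero : ∀ᶠ lam in 𝓝 lam₀, V0 A S lam (α lam) = 0)
    (hsimple : deriv (V0 A S lam₀) (α lam₀) ≠ 0) (hd : ‖d‖ = 1) (hθ : 0 < θ)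
    (hθ' : θ ≤ 2 * Real.pi / 3) (hk : k = r₀ * d * exp (I * θ)) (hr₀ : 0 < r₀)
    (hW : IsOpen W) (hWΩ : W ⊆ Ω) (hαW : α lam₀ ∈ W)
    (hcut : ∀ᶠ lam in 𝓝 lam₀,
      W \ (segment ℝ (α lam) (α lam + k) ∪ segment ℝ (β lam) (β lam + l)) ⊆ F.D lam)
    (hdis : α lam₀ ∉ segment ℝ (β lam₀) (β lam₀ + l))
    (hbase : ∀ᶠ lam in 𝓝 lam₀, Tendsto (F.z lam) (𝓝[F.D lam] (α lam)) (𝓝 0)) :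
    ∃ r, IsTurningFamily A S Ω lam₀ F α d θ r := by
  have hd0 : d ≠ 0 := by rintro rfl; simp at hd
  have h1 := (continuousAt_snd (p := (lam₀, α lam₀))).eventually (hW.mem_nhds hαW)
  have h2 := h1.and (eventually_notMem_segment hβ hdis)
  rw [nhds_prod_eq, eventually_prod_iff] at h2
  obtain ⟨pa, ha, pb, hb, hab⟩ := h2
  obtain ⟨r, hr, hrb⟩ := Metric.eventually_nhds_iff_ball.1 hb
  have h3 : ∀ᶠ lam in 𝓝 lam₀, ∀ x ∈ Metric.ball (α lam) (r / 2),
      x ∈ W ∧ x ∉ segment ℝ (β lam) (β lam + l) := by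
    filter_upwards [ha, hα.eventually (Metric.ball_mem_nhds _ (half_pos hr))] with lam h3 h4 x hx
    refine hab h3 (hrb x ?_)
    have := dist_triangle x (α lam) (α lam₀)
    rw [Metric.mem_ball] at hx ⊢
    linarith [show dist (α lam) (α lam₀) < r / 2 from h4]
  refine ⟨r / 2, hF, hα, hzero, hsimple, hd, hθ, hθ', half_pos hr,
    h3.mono fun lam h x hx => hWΩ (h x hx).1, ?_, hbase⟩
  filter_upwards [h3, hcut] with lam h4 h5 x hx
  refine h5 ⟨(h4 x hx.1).1, not_or.2 ⟨fun hs => ?_, (h4 x hx.1).2⟩⟩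
  rw [mem_segment_add_iff, segment_eq_image] at hs
  obtain ⟨s, hs, hq⟩ := hs
  have e1 : x - α lam = s * k := by rw [← hq]; simp
  have h6 := hx.2
  have e2 : (x - α lam) / d * exp (-(((θ + Real.pi : ℝ) : ℂ) * I)) = ((-(s * r₀) : ℝ) : ℂ) := by
    have : exp (I * θ) * exp (-(((θ + Real.pi : ℝ) : ℂ) * I)) = -1 := by
      rw [← exp_add, show I * θ + -(((θ + Real.pi : ℝ) : ℂ) * I) = -(Real.pi * I) by
        push_cast; ring, exp_neg, exp_pi_mul_I]
      norm_num
    rw [e1, hk, show (s : ℂ) * (r₀ * d * exp (I * θ)) / d = s * r₀ * exp (I * θ) by field_simp,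
      mul_assoc, this]
    push_cast
    ring
  rw [slitAt, mem_ofPred_eq, e2, ofReal_mem_slitPlane] at h6
  nlinarith [hs.1]

end

/-! ### Reflection of the plane -/

/-- The composition with the reflection `x ↦ -x`. -/
def mirror {X Y : Type*} [Neg X] (f : X → Y) : X → Y := fun x => f (-x)

/-- The conjugation with the reflection `x ↦ -x`. -/
def oddMirror {X Y : Type*} [Neg X] [Neg Y] (f : X → Y) : X → Y := fun x => -f (-x)

/-- The solution of the reflected system that corresponds to the solution `u`. -/
def mirrorSolution (u : ℂ → Fin 2 → ℂ) : ℂ → Fin 2 → ℂ := fun x => ![-u (-x) 1, -u (-x) 0]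

/-- The opposite superscript. -/
def WKBSign.opp : WKBSign → WKBSign
  | .plus => .minus
  | .minus => .plus

/-- The family of frames that belongs to the reflected system; its phase is the negative of the
reflected phase, so that the superscripts of WKB solutions change. -/
def Family.mirror (F : Family) : Family :=
  ⟨fun lam => Neg.neg ⁻¹' F.D lam, fun lam => oddMirror (F.z lam),
    fun lam => ZakharovShabat.mirror (F.H lam)⟩

theorem deriv_oddMirror (f : ℂ → ℂ) (x : ℂ) : deriv (oddMirror f) x = deriv f (-x) := by
  unfold oddMirror
  rw [deriv.fun_neg, deriv_comp_neg, neg_neg]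

section
variable {A S : ℂ → ℂ} {Ω D : Set ℂ} {lam lam₀ : ℂ} {z H : ℂ → ℂ} {F : Family} {ε : ℝ}
  {u v : ℂ → Fin 2 → ℂ}

theorem gPlus_mirror (lam x : ℂ) : gPlus (mirror A) (oddMirror S) lam x = gPlus A S lam (-x) := by
  simp only [gPlus, deriv_oddMirror, mirror]

theorem gMinus_mirror (lam x : ℂ) :
    gMinus (mirror A) (oddMirror S) lam x = gMinus A S lam (-x) := by
  simp only [gMinus, deriv_oddMirror, mirror]

theorem V0_mirror (lam x : ℂ) : V0 (mirror A) (oddMirror S) lam x = V0 A S lam (-x) := by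
  simp only [V0, deriv_oddMirror, mirror]

theorem tendsto_neg_cocompact : Tendsto (fun x : ℝ => -x) (cocompact ℝ) (cocompact ℝ) :=
  (Homeomorph.neg ℝ).isClosedEmbedding.tendsto_cocompact

theorem DifferentiableOn.mirror {f : ℂ → ℂ} (hf : DifferentiableOn ℂ f D) :
    DifferentiableOn ℂ (mirror f) (Neg.neg ⁻¹' D) :=
  hf.comp differentiable_neg.differentiableOn fun _ hx => hx

theorem IsPotential.mirror (hAS : IsPotential A S Ω) :
    IsPotential (mirror A) (oddMirror S) (Neg.neg ⁻¹' Ω) where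
  isOpen := hAS.isOpen.preimage continuous_neg
  simplyConnected := by
    have := hAS.simplyConnected
    exact ((Homeomorph.neg ℂ).subtype (p := (· ∈ Neg.neg ⁻¹' Ω)) (q := (· ∈ Ω))
      (fun _ => Iff.rfl)).toHomotopyEquiv.simplyConnectedSpace
  real_mem x := by simpa using hAS.real_mem (-x)
  holo_A := DifferentiableOn.mirror hAS.holo_A
  holo_S := (DifferentiableOn.mirror hAS.holo_S).neg
  real_A x := by simpa [ZakharovShabat.mirror] using hAS.real_A (-x)
  real_S x := by simpa [oddMirror] using hAS.real_S (-x)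
  int_A := by simpa [ZakharovShabat.mirror] using hAS.int_A.comp_neg
  int_S := by simpa [oddMirror] using hAS.int_S.comp_neg.neg
  int_S' := by simpa [deriv_oddMirror] using hAS.int_S'.comp_neg
  zero_A := by
    simpa [ZakharovShabat.mirror, Function.comp_def] using hAS.zero_A.comp tendsto_neg_cocompact
  zero_S' := by
    simpa [deriv_oddMirror, Function.comp_def] using hAS.zero_S'.comp tendsto_neg_cocompact

theorem IsFrame.mirror (h : IsFrame A S Ω lam D z H) :
    IsFrame (mirror A) (oddMirror S) (Neg.neg ⁻¹' Ω) lam (Neg.neg ⁻¹' D) (oddMirror z)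
      (mirror H) where
  isOpen := h.isOpen.preimage continuous_neg
  subset _ hx := h.subset hx
  ne_zero x hx := by rw [V0_mirror]; exact h.ne_zero _ hx
  holo_z := (DifferentiableOn.mirror h.holo_z).neg
  holo_H := DifferentiableOn.mirror h.holo_H
  pow_four x hx := by rw [gPlus_mirror, gMinus_mirror]; exact h.pow_four _ hx
  sq x hx := by rw [gPlus_mirror, deriv_oddMirror]; exact h.sq _ hx

theorem tendsto_prod_neg (lam₀ x : ℂ) :
    Tendsto (fun q : ℂ × ℂ => (q.1, -q.2)) (𝓝 (lam₀, x)) (𝓝 (lam₀, -x)) :=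
  Continuous.tendsto (by fun_prop) _

theorem IsFamily.mirror (h : IsFamily A S Ω lam₀ F) :
    IsFamily (mirror A) (oddMirror S) (Neg.neg ⁻¹' Ω) lam₀ F.mirror where
  frame := h.frame.mono fun _ hl => hl.mirror
  mem x hx := (tendsto_prod_neg lam₀ x).eventually (h.mem (-x) hx)
  cont x hx := by
    simpa only [Family.mirror, deriv_oddMirror, Function.comp_def] using
      (h.cont (-x) hx).comp (tendsto_prod_neg lam₀ x)

theorem IsTurningFamily.mirror {α : ℂ → ℂ} {d : ℂ} {θ r : ℝ}
    (h : IsTurningFamily A S Ω lam₀ F α d θ r) :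
    IsTurningFamily (mirror A) (oddMirror S) (Neg.neg ⁻¹' Ω) lam₀ F.mirror (fun lam => -α lam) (-d)
      θ r where
  family := h.family.mirror
  cont := h.cont.neg
  zero := h.zero.mono fun lam hl => by rwa [V0_mirror, neg_neg]
  simple := by
    rw [show V0 (ZakharovShabat.mirror A) (oddMirror S) lam₀ = fun x => V0 A S lam₀ (-x) from
      funext (V0_mirror lam₀), deriv_comp_neg, neg_neg]
    exact neg_ne_zero.2 h.simple
  norm_dir := by rw [norm_neg]; exact h.norm_dir
  pos_angle := h.pos_angle
  angle_le := h.angle_le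
  pos_radius := h.pos_radius
  ball_subset := h.ball_subset.mono fun lam hl x hx => hl <| by
    rw [mem_ball_iff_norm] at hx ⊢
    rwa [← norm_neg, show -(-x - α lam) = x - -α lam by ring]
  slit_subset := h.slit_subset.mono fun lam hl x hx => hl <| by
    obtain ⟨h1, h2⟩ := hx
    rw [mem_ball_iff_norm] at h1
    refine ⟨?_, ?_⟩
    · rwa [mem_ball_iff_norm, ← norm_neg, show -(-x - α lam) = x - -α lam by ring]
    · rwa [show (x - -α lam) / -d = (-x - α lam) / d by rw [div_neg, ← neg_div]; ring] at h2
  base := h.base.mono fun lam hl => by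
    have h1 : Tendsto (fun x : ℂ => -x) (𝓝[Neg.neg ⁻¹' F.D lam] (-α lam)) (𝓝[F.D lam] (α lam)) := by
      refine tendsto_nhdsWithin_iff.2 ⟨?_, self_mem_nhdsWithin⟩
      have : Tendsto (fun x : ℂ => -x) (𝓝 (-α lam)) (𝓝 (-(-α lam))) := continuous_neg.tendsto _
      rw [neg_neg] at this
      exact this.mono_left nhdsWithin_le_nhds
    have h2 := (hl.comp h1).neg
    rwa [neg_zero] at h2

theorem wronskian_mirrorSolution (u v : ℂ → Fin 2 → ℂ) (x : ℂ) :
    wronskian (mirrorSolution u) (mirrorSolution v) x = -wronskian u v (-x) := by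
  simp only [wronskian_apply, mirrorSolution, Matrix.cons_val_zero, Matrix.cons_val_one]
  ring

theorem IsSolution.mirror (hΩ : IsOpen Ω) (hε : ε ≠ 0) (hu : IsSolution A S Ω ε lam u) :
    IsSolution (mirror A) (oddMirror S) (Neg.neg ⁻¹' Ω) ε lam (mirrorSolution u) := by
  have hε' : (ε : ℂ) ≠ 0 := by exact_mod_cast hε
  have key : ∀ x ∈ Neg.neg ⁻¹' Ω, HasDerivAt (mirrorSolution u)
      ![I / ε * (potentialConj A S ε (-x) * u (-x) 0 + lam * u (-x) 1),
        I / ε * (-lam * u (-x) 0 + potential A S ε (-x) * u (-x) 1)] x := by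
    intro x hx
    have hn : HasDerivAt (fun x : ℂ => -x) (-1) x := hasDerivAt_neg' x
    have h0 := ((hu.hasDerivAt_zero hΩ hε hx).comp x hn).neg
    have h1 := ((hu.hasDerivAt_one hΩ hε hx).comp x hn).neg
    rw [mul_neg_one, neg_neg] at h0 h1
    refine hasDerivAt_pi.2 fun j => ?_
    fin_cases j
    · exact h1
    · exact h0
  refine ⟨fun x hx => (key x hx).differentiableAt.differentiableWithinAt, fun x hx => ?_⟩
  rw [(key x hx).deriv]
  ext j
  fin_cases j
  · simp [systemMatrix, mirrorSolution, potential, ZakharovShabat.mirror, oddMirror,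
      potentialConj]
    field_simp
    linear_combination (-(lam * u (-x) 1) - I * A (-x) * exp (-(I * S (-x) / ε)) * u (-x) 0) * I_sq
  · simp [systemMatrix, mirrorSolution, potential, ZakharovShabat.mirror, oddMirror,
      potentialConj]
    field_simp
    linear_combination (lam * u (-x) 0 + I * A (-x) * exp (I * S (-x) / ε) * u (-x) 1) * I_sq

theorem wkbVector_mirror (S z H : ℂ → ℂ) (σ : WKBSign) (ε : ℝ) (we wo x : ℂ) :
    wkbVector (oddMirror S) (oddMirror z) (mirror H) σ.opp ε we wo x =
      ![-wkbVector S z H σ ε we wo (-x) 1, -wkbVector S z H σ ε we wo (-x) 0] := by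
  ext j
  cases σ <;> fin_cases j <;>
    simp [wkbVector, matrixQ, WKBSign.opp, WKBSign.swap, WKBSign.val, ZakharovShabat.mirror,
      oddMirror] <;> ring

theorem mirrorSolution_of_eq_wkbVector {S z H : ℂ → ℂ} {σ : WKBSign} {we wo x : ℂ}
    (h : u (-x) = wkbVector S z H σ ε we wo (-x)) :
    mirrorSolution u x = wkbVector (oddMirror S) (oddMirror z) (mirror H) σ.opp ε we wo x := by
  rw [wkbVector_mirror, mirrorSolution, h]

theorem IsExactWKBAtInfinity.mirror (hΩ : IsOpen Ω) (hε : ε ≠ 0)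
    (h : IsExactWKBAtInfinity A S Ω ε lam z H .minus atTop u) :
    IsExactWKBAtInfinity (mirror A) (oddMirror S) (Neg.neg ⁻¹' Ω) ε lam (oddMirror z) (mirror H)
      .plus atBot (mirrorSolution u) := by
  obtain ⟨h1, we, wo, h2, h3, h4⟩ := h
  refine ⟨h1.mirror hΩ hε, fun x => we (-x), fun x => wo (-x), h2.comp tendsto_neg_atBot_atTop,
    h3.comp tendsto_neg_atBot_atTop, ?_⟩
  filter_upwards [tendsto_neg_atBot_atTop.eventually h4] with x hx
  refine mirrorSolution_of_eq_wkbVector (σ := .minus) ?_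
  simpa using hx

theorem mem_downRegion_mirror {c : ℝ → ℂ} {a b : ℝ} {x : ℂ}
    (h : x ∈ upRegion D z (c '' Ioo a b)) :
    -x ∈ downRegion (Neg.neg ⁻¹' D) (oddMirror z) (oddMirror c '' Ioo (-b) (-a)) := by
  obtain ⟨γ, h1, h2, rfl, ⟨t, ht, h3⟩, h4⟩ := h
  refine ⟨fun s => -γ s, h1.neg, fun s hs => by simpa using h2 s hs, rfl,
    ⟨-t, ⟨by linarith [ht.2], by linarith [ht.1]⟩, by simp [oddMirror, h3]⟩, fun s hs s' hs' hss => ?_⟩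
  simpa [oddMirror] using h4 hs hs' hss

theorem mem_upRegion_mirror {c : ℝ → ℂ} {a b : ℝ} {x : ℂ}
    (h : x ∈ downRegion D z (c '' Ioo a b)) :
    -x ∈ upRegion (Neg.neg ⁻¹' D) (oddMirror z) (oddMirror c '' Ioo (-b) (-a)) := by
  obtain ⟨γ, h1, h2, rfl, ⟨t, ht, h3⟩, h4⟩ := h
  refine ⟨fun s => -γ s, h1.neg, fun s hs => by simpa using h2 s hs, rfl,
    ⟨-t, ⟨by linarith [ht.2], by linarith [ht.1]⟩, by simp [oddMirror, h3]⟩, fun s hs s' hs' hss => ?_⟩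
  simpa [oddMirror] using h4 hs hs' hss

theorem memLp_of_mirrorSolution {R : ℝ}
    (h : ∀ j, MemLp (fun x : ℝ => mirrorSolution u x j) 2 (volume.restrict (Iic R))) :
    ∀ j, MemLp (fun x : ℝ => u x j) 2 (volume.restrict (Ici (-R))) := by
  have hp : MeasurePreserving (fun x : ℝ => -x) (volume.restrict (Ici (-R)))
      (volume.restrict (Iic R)) := by
    have := (Measure.measurePreserving_neg (volume : Measure ℝ)).restrict_preimage
      (s := Iic R) measurableSet_Iic
    simpa using this
  have h0 := ((h 1).comp_measurePreserving hp).neg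
  have h1 := ((h 0).comp_measurePreserving hp).neg
  intro j
  fin_cases j
  · simpa [mirrorSolution, Function.comp_def, Pi.neg_def] using h0
  · simpa [mirrorSolution, Function.comp_def, Pi.neg_def] using h1

theorem IsFamily.increasesAtBot_of_strictMonoOn (hAS : IsPotential A S Ω) (hlam₀ : lam₀.im ≠ 0)
    (hF : IsFamily A S Ω lam₀ F)
    (hfar : ∀ᶠ q : ℂ × ℝ in 𝓝 lam₀ ×ˢ atBot, (q.2 : ℂ) ∈ F.D q.1) {c : ℝ → ℂ} {a : ℝ}
    (hc : ∀ᶠ t in atBot, c t = t) (hm : StrictMonoOn (fun t => (F.z lam₀ (c t)).re) (Iio a)) :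
    IncreasesAtBot lam₀ F := by
  refine hF.increasesAtBot_of_frequently hAS hlam₀ hfar fun h => ?_
  obtain ⟨pa, ha, pb, hb, hab⟩ := eventually_prod_iff.1 hfar
  obtain ⟨R, hR⟩ := eventually_atBot.1 ((h.and hb).and (hc.and (eventually_lt_atBot a)))
  have F0 := hF.frame.self_of_nhds
  have h1 : R - 1 ≤ R := by linarith
  have key := le_of_hasDerivAt_nonpos h1
    (fun r hr => F0.hasDerivAt_re (hab ha.self_of_nhds (hR r hr.2).1.2))
    (fun r hr => (not_le.1 (hR r hr.2).1.1).le)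
  have h2 := hm (hR (R - 1) h1).2.2 (hR R le_rfl).2.2 (by linarith)
  simp only [(hR (R - 1) h1).2.1, (hR R le_rfl).2.1] at h2
  linarith

end

/-! ### The frames at both ends of the contour -/

/-- The family with the phase normalised at another point. -/
def Family.shift (F : Family) (τ : ℂ → ℂ) : Family :=
  ⟨F.D, fun lam x => F.z lam x - τ lam, F.H⟩

/-- The family on the neighbourhood `W` of the contour, with cuts from both turning points. -/
def cutFamily (W : Set ℂ) (α : ℂ → ℂ) (kα : ℂ) (β : ℂ → ℂ) (kβ : ℂ) (z H : ℂ → ℂ → ℂ) : Family :=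
  ⟨fun lam => cutDomain W (α lam) kα (β lam) kβ, z, H⟩

section
variable {A S : ℂ → ℂ} {Ω D W : Set ℂ} {lam lam₀ d kα kβ dα dβ : ℂ} {z H : ℂ → ℂ → ℂ}
  {F : Family} {c : ℝ → ℂ} {a b θ r : ℝ} {α β τ : ℂ → ℂ}

theorem IsFamily.shift (h : IsFamily A S Ω lam₀ F) (τ : ℂ → ℂ) :
    IsFamily A S Ω lam₀ (F.shift τ) where
  frame := h.frame.mono fun lam hl =>
    ⟨hl.isOpen, hl.subset, hl.ne_zero, hl.holo_z.sub_const _, hl.holo_H, hl.pow_four,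
      fun x hx => by
        simp only [Family.shift, deriv_sub_const]
        exact hl.sq x hx⟩
  mem := h.mem
  cont x hx := by
    simpa only [Family.shift, deriv_sub_const] using h.cont x hx

theorem IsTurningFamily.opposite (h : IsTurningFamily A S Ω lam₀ F α d θ r) {s : ℂ}
    (hs : s ^ 2 = -1) : IsTurningFamily A S Ω lam₀ (F.opposite s) α d θ r :=
  { h with
    family := h.family.opposite hs
    base := h.base.mono fun lam hl => by simpa [Family.opposite] using hl.neg }

/-- At a turning point one of the functions `g₊`, `g₋` vanishes. -/
theorem exists_sign {p : ℂ} (h : V0 A S lam p = 0) :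
    ∃ σ : ℂ, σ = 1 ∧ gPlus A S lam p = 0 ∨ σ = -1 ∧ gMinus A S lam p = 0 := by
  rw [V0_eq, mul_eq_zero] at h
  rcases h with h | h
  · exact ⟨-1, Or.inr ⟨rfl, h⟩⟩
  · exact ⟨1, Or.inl ⟨rfl, h⟩⟩

theorem norm_tangent (hinj : Function.Injective c) {f : Filter ℝ} [f.NeBot] (hf : ∀ᶠ t in f, t ≠ a)
    (h : Tendsto (fun t => (c t - c a) / (‖c t - c a‖ : ℂ)) f (𝓝 d)) : ‖d‖ = 1 := by
  refine tendsto_nhds_unique h.norm (tendsto_const_nhds.congr' ?_)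
  filter_upwards [hf] with t ht
  rw [norm_div, norm_real, norm_norm, div_self (norm_ne_zero_iff.2 (sub_ne_zero.2 (hinj.ne ht)))]

theorem tangent_mirror
    (h : Tendsto (fun t => (c t - c b) / (‖c t - c b‖ : ℂ)) (𝓝[<] b) (𝓝 d)) :
    Tendsto (fun t => (oddMirror c t - oddMirror c (-b)) /
      (‖oddMirror c t - oddMirror c (-b)‖ : ℂ)) (𝓝[>] (-b)) (𝓝 (-d)) := by
  refine ((h.comp tendsto_neg_nhdsGT_neg).neg).congr fun t => ?_
  have e : oddMirror c t - oddMirror c (-b) = -(c (-t) - c b) := by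
    simp only [oddMirror, neg_neg]; ring
  rw [e, norm_neg, neg_div]
  rfl

theorem sector_mirror (h : ∃ κ : ℝ, 1 / 2 < κ ∧
      ∀ᶠ t in 𝓝[>] b, ((c t - c b) / d).re ≤ -κ * ‖c t - c b‖) :
    ∃ κ : ℝ, 1 / 2 < κ ∧ ∀ᶠ t in 𝓝[<] (-b),
      ((oddMirror c t - oddMirror c (-b)) / -d).re ≤ -κ * ‖oddMirror c t - oddMirror c (-b)‖ := by
  obtain ⟨κ, hκ, h⟩ := h
  refine ⟨κ, hκ, (tendsto_neg_nhdsLT_neg.eventually h).mono fun t ht => ?_⟩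
  have e : oddMirror c t - oddMirror c (-b) = -(c (-t) - c b) := by
    simp only [oddMirror, neg_neg]; ring
  rwa [e, norm_neg, neg_div_neg_eq]

theorem IsWKBFrame.mem (hF : IsWKBFrame A S Ω lam₀ c a b α β W dα dβ kα kβ z H τ) {t : ℝ}
    (ha : t ≠ a) (hb : t ≠ b) : c t ∈ (cutFamily W α kα β kβ z H).D lam₀ := by
  have := hF.contour_cut t ha hb
  rwa [← hF.α_base, ← hF.β_base] at this

theorem IsWKBFrame.far (hF : IsWKBFrame A S Ω lam₀ c a b α β W dα dβ kα kβ z H τ) {f : Filter ℝ}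
    (hf : Tendsto (fun x : ℝ => |x|) f atTop) (hc : ∀ᶠ t in f, c t = t) :
    ∀ᶠ q : ℂ × ℝ in 𝓝 lam₀ ×ˢ f, (q.2 : ℂ) ∈ (cutFamily W α kα β kβ z H).D q.1 := by
  filter_upwards [hc.prod_inr (𝓝 lam₀), eventually_far_notMem_segment hF.α_cont (k := kα) hf,
    eventually_far_notMem_segment hF.β_cont (k := kβ) hf] with q h1 h2 h3
  exact ⟨h1 ▸ hF.contour_mem q.2, not_or.2 ⟨h2, h3⟩⟩

theorem IsWKBFrame.frame (hF : IsWKBFrame A S Ω lam₀ c a b α β W dα dβ kα kβ z H τ) :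
    ∀ᶠ lam in 𝓝 lam₀, IsFrame A S Ω lam ((cutFamily W α kα β kβ z H).D lam)
      ((cutFamily W α kα β kβ z H).z lam) ((cutFamily W α kα β kβ z H).H lam) := by
  filter_upwards [hF.phase, hF.amplitude] with lam h1 h2
  exact ⟨isOpen_cutDomain hF.isOpen _ _, fun x hx => hF.subset hx.1, h1.ne_zero, h1.holo, h2.holo,
    h2.pow_four, h2.sq⟩

theorem IsWKBFrame.increasesAtBot (hAS : IsPotential A S Ω) (hlam₀ : lam₀.im ≠ 0)
    (hc : IsAdmissibleContour A S Ω lam₀ c a b)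
    (hF : IsWKBFrame A S Ω lam₀ c a b α β W dα dβ kα kβ z H τ) :
    IncreasesAtBot lam₀ (cutFamily W α kα β kβ z H) :=
  increasesAtBot_of_tendsto hAS hlam₀ hF.frame (hF.far tendsto_abs_atBot_atTop hc.real_left)
    hF.phase_branch

theorem IsWKBFrame.isFamily (hAS : IsPotential A S Ω) (hlam₀ : lam₀.im ≠ 0)
    (hc : IsAdmissibleContour A S Ω lam₀ c a b)
    (hF : IsWKBFrame A S Ω lam₀ c a b α β W dα dβ kα kβ z H τ) :
    IsFamily A S Ω lam₀ (cutFamily W α kα β kβ z H) := by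
  have hmem : ∀ x ∈ (cutFamily W α kα β kβ z H).D lam₀, ∀ᶠ q : ℂ × ℂ in 𝓝 (lam₀, x),
      q.2 ∈ (cutFamily W α kα β kβ z H).D q.1 := fun x hx =>
    eventually_mem_cutDomain hF.isOpen hF.α_cont hF.β_cont hx
  obtain ⟨R, hR⟩ := (hF.increasesAtBot hAS hlam₀ hc).exists
  have hR' := hR.mono fun lam h => h R le_rfl
  exact ⟨hF.frame, hmem, fun x hx => tendsto_deriv_of_tendsto hAS hF.frame hmem
    hF.connected.self_of_nhds hR'.self_of_nhds.1
    (IncreasesAtBot.tendsto_deriv_point hAS hF.frame hR') hx⟩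

/-- The contour approaches a point in a punctured neighbourhood of which it lies in `D`. -/
theorem tendsto_contour (hc : Continuous c) {p : ℂ} (ha : c a = p) {f : Filter ℝ} (hf : f ≤ 𝓝 a)
    (hD : ∀ᶠ t in f, c t ∈ D) : Tendsto c f (𝓝[D] p) :=
  tendsto_nhdsWithin_iff.2 ⟨ha ▸ hc.continuousAt.mono_left hf, hD⟩

theorem IsWKBFrame.eventually_mem_left (hab : a < b)
    (hF : IsWKBFrame A S Ω lam₀ c a b α β W dα dβ kα kβ z H τ) :
    ∀ᶠ t in 𝓝[≠] a, c t ∈ (cutFamily W α kα β kβ z H).D lam₀ := by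
  filter_upwards [self_mem_nhdsWithin, nhdsWithin_le_nhds (Iio_mem_nhds hab)] with t h1 h2
  exact hF.mem h1 (ne_of_lt h2)

theorem IsWKBFrame.eventually_mem_right (hab : a < b)
    (hF : IsWKBFrame A S Ω lam₀ c a b α β W dα dβ kα kβ z H τ) :
    ∀ᶠ t in 𝓝[≠] b, c t ∈ (cutFamily W α kα β kβ z H).D lam₀ := by
  filter_upwards [self_mem_nhdsWithin, nhdsWithin_le_nhds (Ioi_mem_nhds hab)] with t h1 h2
  exact hF.mem (ne_of_gt h2) h1

theorem IsWKBFrame.tendsto_right (hc : IsAdmissibleContour A S Ω lam₀ c a b)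
    (hF : IsWKBFrame A S Ω lam₀ c a b α β W dα dβ kα kβ z H τ) :
    Tendsto (fun t => z lam₀ (c t)) (𝓝[≠] b) (𝓝 (τ lam₀)) :=
  hF.action.self_of_nhds.comp (tendsto_contour hc.continuous hF.β_base.symm nhdsWithin_le_nhds
    (hF.eventually_mem_right hc.lt))

theorem IsWKBFrame.tendsto_left (hc : IsAdmissibleContour A S Ω lam₀ c a b)
    (hF : IsWKBFrame A S Ω lam₀ c a b α β W dα dβ kα kβ z H τ) :
    Tendsto (fun t => z lam₀ (c t)) (𝓝[≠] a) (𝓝 0) :=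
  hF.phase.self_of_nhds.base.comp (tendsto_contour hc.continuous hF.α_base.symm nhdsWithin_le_nhds
    (hF.eventually_mem_left hc.lt))

theorem nhdsGT_le_nhdsNE (a : ℝ) : 𝓝[>] a ≤ 𝓝[≠] a := nhdsWithin_mono _ fun _ h => ne_of_gt h

theorem nhdsLT_le_nhdsNE (a : ℝ) : 𝓝[<] a ≤ 𝓝[≠] a := nhdsWithin_mono _ fun _ h => ne_of_lt h

theorem IsWKBFrame.level (hc : IsAdmissibleContour A S Ω lam₀ c a b)
    (hF : IsWKBFrame A S Ω lam₀ c a b α β W dα dβ kα kβ z H τ) :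
    ∀ t ∈ Ioo a b, (z lam₀ (c t)).re = 0 := by
  intro t ht
  have h1 := (continuous_re.tendsto _).comp ((hF.tendsto_left hc).mono_left (nhdsGT_le_nhdsNE a))
  rw [zero_re] at h1
  refine tendsto_nhds_unique (tendsto_const_nhds.congr' ?_) h1
  filter_upwards [Ioo_mem_nhdsGT hc.lt] with t' ht'
  exact hc.stokes.re_eq hF.frame.self_of_nhds hc.continuous
    (fun s hs => hF.mem hs.1.ne' hs.2.ne) ht ht'

theorem IsWKBFrame.re_action (hc : IsAdmissibleContour A S Ω lam₀ c a b)
    (hF : IsWKBFrame A S Ω lam₀ c a b α β W dα dβ kα kβ z H τ) : (τ lam₀).re = 0 := by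
  have h1 := (continuous_re.tendsto _).comp ((hF.tendsto_right hc).mono_left (nhdsLT_le_nhdsNE b))
  refine (tendsto_nhds_unique (tendsto_const_nhds.congr' ?_) h1).symm
  filter_upwards [Ioo_mem_nhdsLT hc.lt] with t ht using (hF.level hc t ht).symm

theorem IsWKBFrame.leftFrame (hAS : IsPotential A S Ω) (hlam₀ : lam₀.im ≠ 0)
    (hc : IsAdmissibleContour A S Ω lam₀ c a b)
    (hF : IsWKBFrame A S Ω lam₀ c a b α β W dα dβ kα kβ z H τ) :
    ∃ θ r, IsLeftFrame A S Ω lam₀ (cutFamily W α kα β kβ z H) c a b α dα θ r := by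
  obtain ⟨r₀, θ, hr₀, hθ, hθ', hk⟩ := hF.cut_left
  have hd : ‖dα‖ = 1 := norm_tangent hc.injective
    (by filter_upwards [self_mem_nhdsWithin] with t ht using ne_of_gt ht) hF.tangent_left
  obtain ⟨r, hr⟩ := (hF.isFamily hAS hlam₀ hc).isTurningFamily (l := kβ) hF.α_cont hF.β_cont
    hF.α_turning (by rw [hF.α_base]; exact hc.turning_left.2) hd hθ hθ' hk hr₀ hF.isOpen hF.subset
    (by rw [hF.α_base]; exact hF.contour_mem a) (Eventually.of_forall fun lam x hx => hx)
    (by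
      rw [hF.α_base, hF.β_base]
      exact disjoint_left.1 hF.cut_disjoint (left_mem_segment ℝ _ _))
    (hF.phase.mono fun lam h => h.base)
  refine ⟨θ, r, hr, hF.increasesAtBot hAS hlam₀ hc, hc.lt, hc.continuous, hc.injective,
    hF.α_base.symm, fun t hb ha => hF.mem ha hb.ne, hc.real_left, hF.tangent_left, hF.sector_left,
    hF.level hc, ?_⟩
  refine (hc.progressive_left.strictMonoOn_or_strictAntiOn hF.frame.self_of_nhds ordConnected_Iio
    isOpen_Iio nonempty_Iio hc.continuous
    fun t ht => hF.mem (ne_of_lt ht) (ne_of_lt (lt_trans ht hc.lt))).resolve_right fun hanti => ?_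
  obtain ⟨t₀, ht₀, ht₀'⟩ := (hc.real_left.and (eventually_lt_atBot a)).exists
  obtain ⟨t, ⟨h1, h2⟩, h3⟩ := (((hF.phase_branch.self_of_nhds.eventually
    (eventually_lt_atBot (z lam₀ (c t₀)).re)).and hc.real_left).and (eventually_lt_atBot t₀)).exists
  have h4 := hanti (show t ∈ Iio a from lt_trans h3 ht₀') ht₀' h3
  simp only [cutFamily] at h4
  rw [h2] at h4
  linarith

/-- `Im z` increases along the Stokes line, to the imaginary part of the action. -/
theorem IsWKBFrame.im_lt (hAS : IsPotential A S Ω) (hlam₀ : lam₀.im ≠ 0)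
    (hc : IsAdmissibleContour A S Ω lam₀ c a b)
    (hF : IsWKBFrame A S Ω lam₀ c a b α β W dα dβ kα kβ z H τ) :
    ∀ t ∈ Ioo a b, (z lam₀ (c t)).im < (τ lam₀).im := by
  obtain ⟨θ, r, hL⟩ := hF.leftFrame hAS hlam₀ hc
  obtain ⟨σ, hσ⟩ := exists_sign hF.α_turning.self_of_nhds
  have hpos := (hL.crossing hAS hσ).1
  have hmono : StrictMonoOn (fun t => (z lam₀ (c t)).im) (Ioo a b) := by
    refine (hF.frame.self_of_nhds.im_strictMonoOn_or_strictAntiOn hc.lt hc.continuous hc.injective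
      (fun s hs => hF.mem hs.1.ne' hs.2.ne) (hF.level hc)).resolve_right fun hanti => ?_
    obtain ⟨t, ht, ht'⟩ := (hpos.and (Ioo_mem_nhdsGT hc.lt)).exists
    have h1 := (continuous_im.tendsto _).comp ((hF.tendsto_left hc).mono_left (nhdsGT_le_nhdsNE a))
    rw [zero_im] at h1
    refine absurd (show 0 < (z lam₀ (c t)).im from ht) (not_lt.2 (ge_of_tendsto h1 ?_))
    filter_upwards [Ioo_mem_nhdsGT ht'.1] with s hs
    exact (hanti ⟨hs.1, hs.2.trans ht'.2⟩ ht' hs.2).le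
  intro t ht
  have h1 := (continuous_im.tendsto _).comp ((hF.tendsto_right hc).mono_left (nhdsLT_le_nhdsNE b))
  have hs : (t + b) / 2 ∈ Ioo a b := ⟨by linarith [ht.1, ht.2], by linarith [ht.2]⟩
  refine lt_of_lt_of_le (hmono ht hs (by linarith [ht.2])) (ge_of_tendsto h1 ?_)
  filter_upwards [Ioo_mem_nhdsLT hs.2] with s hs'
  exact (hmono hs ⟨hs.1.trans hs'.1, hs'.2⟩ hs'.1).le

theorem IsWKBFrame.rightFrame (hAS : IsPotential A S Ω) (hlam₀ : lam₀.im ≠ 0)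
    (hc : IsAdmissibleContour A S Ω lam₀ c a b)
    (hF : IsWKBFrame A S Ω lam₀ c a b α β W dα dβ kα kβ z H τ) :
    ∃ θ r, IsLeftFrame (mirror A) (oddMirror S) (Neg.neg ⁻¹' Ω) lam₀
      ((cutFamily W α kα β kβ z H).shift τ).mirror (oddMirror c) (-b) (-a) (fun lam => -β lam) (-dβ)
      θ r := by
  obtain ⟨r₀, θ, hr₀, hθ, hθ', hk⟩ := hF.cut_right
  have hd : ‖dβ‖ = 1 := norm_tangent hc.injective
    (by filter_upwards [self_mem_nhdsWithin] with t ht using ne_of_lt ht) hF.tangent_right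
  have hfam := (hF.isFamily hAS hlam₀ hc).shift τ
  obtain ⟨r, hr⟩ := hfam.isTurningFamily (l := kα) hF.β_cont hF.α_cont
    hF.β_turning (by rw [hF.β_base]; exact hc.turning_right.2) hd hθ hθ' hk hr₀ hF.isOpen hF.subset
    (by rw [hF.β_base]; exact hF.contour_mem b)
    (Eventually.of_forall fun lam x hx => ⟨hx.1, fun h => hx.2 h.symm⟩)
    (by
      rw [hF.α_base, hF.β_base]
      exact disjoint_right.1 hF.cut_disjoint (left_mem_segment ℝ _ _))
    (hF.action.mono fun lam h => by
      have := h.sub_const (τ lam)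
      rwa [sub_self] at this)
  have hre := hF.re_action hc
  have hlev : ∀ t ∈ Ioo (-b) (-a), (z lam₀ (c (-t)) - τ lam₀).re = 0 := fun t ht => by
    rw [sub_re, hre, sub_zero]
    exact hF.level hc (-t) ⟨by linarith [ht.2], by linarith [ht.1]⟩
  have hcc : Continuous (oddMirror c) := (hc.continuous.comp continuous_neg).neg
  have hci : Function.Injective (oddMirror c) := fun s t h => by
    simpa using hc.injective (neg_injective h)
  have hbase : oddMirror c (-b) = -β lam₀ := by simp [oddMirror, hF.β_base]
  have hreal : ∀ᶠ t : ℝ in atBot, oddMirror c t = t := by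
    filter_upwards [tendsto_neg_atBot_atTop.eventually hc.real_right] with t ht
    simp [oddMirror, ht]
  have hI : ∀ {s : ℝ}, s ∈ Iio (-b) → -s ∈ Ioi b := fun {s} (hs : s < -b) =>
    (lt_neg.1 hs : b < -s)
  -- If `Re z` decreased along the path from `β` to `+∞`, the other sheet would qualify at `β`, and
  -- `Im z` would have to increase towards `β` from both ends of the Stokes line.
  have hmono : StrictMonoOn (fun t => (z lam₀ (c t)).re) (Ioi b) := by
    refine (hc.progressive_right.strictMonoOn_or_strictAntiOn hF.frame.self_of_nhds
      ordConnected_Ioi isOpen_Ioi nonempty_Ioi hc.continuous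
      fun t ht => hF.mem (ne_of_gt (lt_trans hc.lt ht)) (ne_of_gt ht)).resolve_right
      fun hanti => ?_
    obtain ⟨σ, hσ⟩ := exists_sign (A := mirror A) (S := oddMirror S) (lam := lam₀) (p := -β lam₀)
      (by rw [V0_mirror, neg_neg]; exact hF.β_turning.self_of_nhds)
    have hneg : ∀ t < -b, (z lam₀ (c (-t))).re < 0 := by
      refine re_neg_of_strictMonoOn (fun s hs t ht hst => hanti (hI ht) (hI hs)
        (neg_lt_neg hst)) ?_
      have := (continuous_re.tendsto _).comp (((hF.tendsto_right hc).mono_left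
        (nhdsGT_le_nhdsNE b)).comp tendsto_neg_nhdsLT_neg)
      rwa [hre] at this
    have key := ((hr.mirror).opposite I_sq).crossing hAS.mirror hσ hbase hcc.continuousAt
      (fun t ht => hci.ne ht) (tangent_mirror hF.tangent_right) (sector_mirror hF.sector_right)
      (by
        filter_upwards [Ioo_mem_nhdsGT (neg_lt_neg hc.lt)] with t ht
        simpa [Family.opposite, Family.mirror, Family.shift, oddMirror, cutFamily, hre]
          using hlev t ht)
      (by
        filter_upwards [self_mem_nhdsWithin] with t ht
        simpa [Family.opposite, Family.mirror, Family.shift, oddMirror, cutFamily, hre]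
          using hneg t ht)
    obtain ⟨t, h1, ht⟩ := (key.1.and (Ioo_mem_nhdsGT (neg_lt_neg hc.lt))).exists
    have h2 := hF.im_lt hAS hlam₀ hc (-t) ⟨by linarith [ht.2], by linarith [ht.1]⟩
    simp [Family.opposite, Family.mirror, Family.shift, oddMirror, cutFamily] at h1
    linarith
  have hmono' : StrictMonoOn (fun t => ((((cutFamily W α kα β kβ z H).shift τ).mirror.z lam₀)
      (oddMirror c t)).re) (Iio (-b)) := fun s hs t ht hst => by
    simpa [Family.mirror, Family.shift, oddMirror, cutFamily] using
      hmono (hI ht) (hI hs) (neg_lt_neg hst)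
  have hfar : ∀ᶠ q : ℂ × ℝ in 𝓝 lam₀ ×ˢ atBot,
      (q.2 : ℂ) ∈ ((cutFamily W α kα β kβ z H).shift τ).mirror.D q.1 := by
    have := (tendsto_id.prodMap tendsto_neg_atBot_atTop).eventually
      (hF.far tendsto_abs_atTop_atTop hc.real_right)
    filter_upwards [this] with q hq
    simpa [Family.mirror, Family.shift] using hq
  refine ⟨θ, r, hr.mirror, hfam.mirror.increasesAtBot_of_strictMonoOn hAS.mirror hlam₀ hfar hreal
    hmono', neg_lt_neg hc.lt, hcc, hci, hbase, fun t h1 h2 => ?_, hreal,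
    tangent_mirror hF.tangent_right, sector_mirror hF.sector_right, fun t ht => ?_, hmono'⟩
  · have := hF.mem (t := -t) (ne_of_gt (lt_neg.1 h1)) (fun h => h2 (by rw [← h, neg_neg]))
    simpa [Family.mirror, Family.shift, oddMirror] using this
  · have := hlev t ht
    simp only [Family.mirror, Family.shift, oddMirror, cutFamily, neg_neg, neg_re]
    rw [this, neg_zero]

end

/-! ### The quantization condition -/

section
variable {A S : ℂ → ℂ} {Ω : Set ℂ} {lam lam₀ : ℂ} {ε : ℝ}

theorem not_gPlus_and_gMinus (hAS : IsPotential A S Ω) {p : ℂ} (hp : p ∈ Ω)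
    (h : IsSimpleTurningPoint (V0 A S lam) p) : ¬(gPlus A S lam p = 0 ∧ gMinus A S lam p = 0) := by
  rintro ⟨h1, h2⟩
  apply h.2
  have h3 := ((hAS.hasDerivAt_gMinus lam hp).mul (hAS.hasDerivAt_gPlus lam hp)).deriv
  rw [h1, h2, mul_zero, zero_mul, add_zero] at h3
  rw [show V0 A S lam = fun x => gMinus A S lam x * gPlus A S lam x from funext (V0_eq A S lam)]
  exact h3

theorem deltaIndex_eq (hAS : IsPotential A S Ω) {p q σ ρ : ℂ} (hp : p ∈ Ω) (hq : q ∈ Ω)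
    (hp' : IsSimpleTurningPoint (V0 A S lam) p) (hq' : IsSimpleTurningPoint (V0 A S lam) q)
    (hσ : σ = 1 ∧ gPlus A S lam p = 0 ∨ σ = -1 ∧ gMinus A S lam p = 0)
    (hρ : ρ = 1 ∧ gPlus A S lam q = 0 ∨ ρ = -1 ∧ gMinus A S lam q = 0) :
    deltaIndex A S lam p q = I * σ * (I * ρ) := by
  have h1 := not_gPlus_and_gMinus hAS hp hp'
  have h2 := not_gPlus_and_gMinus hAS hq hq'
  have e : I * σ * (I * ρ) = -(σ * ρ) := by linear_combination σ * ρ * I_sq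
  rw [e, deltaIndex]
  rcases hσ with ⟨rfl, h3⟩ | ⟨rfl, h3⟩ <;> rcases hρ with ⟨rfl, h4⟩ | ⟨rfl, h4⟩
  · rw [if_pos (Or.inl ⟨h3, h4⟩)]; norm_num
  · rw [if_neg (by tauto)]; norm_num
  · rw [if_neg (by tauto)]; norm_num
  · rw [if_pos (Or.inr ⟨h3, h4⟩)]; norm_num

theorem wkbVector_sub_const (S z H : ℂ → ℂ) (σ : WKBSign) (ε : ℝ) (we wo x t : ℂ) :
    wkbVector S (fun y => z y - t) H σ ε we wo x =
      exp (-σ.val * t / ε) • wkbVector S z H σ ε we wo x := by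
  rw [wkbVector, wkbVector, smul_smul, ← exp_add]
  congr 2
  ring

theorem norm_mul_sub_mul_le {X Y p q : ℂ} {C C' ε : ℝ} (hC : 0 ≤ C) (hC' : 0 ≤ C') (hε : 0 ≤ ε)
    (hε1 : ε ≤ 1) (hp : ‖p‖ = 1) (hq : ‖q‖ = 1) (h1 : ‖X - p‖ ≤ C * ε) (h2 : ‖Y - q‖ ≤ C' * ε) :
    ‖X * Y - p * q‖ ≤ (C * (1 + C') + C') * ε := by
  have h3 : ‖Y‖ ≤ 1 + C' := by
    calc ‖Y‖ = ‖q + (Y - q)‖ := by rw [add_sub_cancel]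
      _ ≤ ‖q‖ + ‖Y - q‖ := norm_add_le _ _
      _ ≤ 1 + C' * 1 := by rw [hq]; gcongr; exact h2.trans (by gcongr)
      _ = _ := by ring
  calc ‖X * Y - p * q‖ = ‖(X - p) * Y + p * (Y - q)‖ := by congr 1; ring
    _ ≤ ‖X - p‖ * ‖Y‖ + ‖p‖ * ‖Y - q‖ := by
      rw [← norm_mul, ← norm_mul]; exact norm_add_le _ _
    _ ≤ C * ε * (1 + C') + 1 * (C' * ε) := by rw [hp]; gcongr
    _ = _ := by ring

/-- The quantization condition in terms of the Wronskian of the two decaying solutions: this is the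
Plücker relation between the four solutions involved, the phases `z(·, α)` and `z(·, β)` differing
by the action `t`. -/
theorem wronskianRatio_mul_exp_eq_one_iff (hAS : IsPotential A S Ω) (hε : 0 < ε) {z H : ℂ → ℂ}
    {t x₁ x₂ : ℂ} {u₀ u₁ u₂ v₀ v₁ v₂ : ℂ → Fin 2 → ℂ} (hx₁ : x₁ ∈ Ω) (hx₂ : x₂ ∈ Ω)
    (hu₁ : IsSolution A S Ω ε lam u₁) (hu₂ : IsSolution A S Ω ε lam u₂)
    (hv₀ : IsSolution A S Ω ε lam v₀) (hv₁ : IsSolution A S Ω ε lam v₁)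
    (hv₂ : IsSolution A S Ω ε lam v₂)
    (e₁ : u₁ x₁ = wkbVector S z H .minus ε 1 0 x₁) (e₂ : u₂ x₂ = wkbVector S z H .plus ε 1 0 x₂)
    (f₁ : v₁ x₁ = wkbVector S (fun x => z x - t) H .minus ε 1 0 x₁)
    (f₂ : v₂ x₂ = wkbVector S (fun x => z x - t) H .plus ε 1 0 x₂) {x : ℂ} (hx : x ∈ Ω)
    (n1 : wronskian u₂ u₀ x ≠ 0) (n2 : wronskian v₀ v₁ x ≠ 0) (n3 : wronskian u₂ u₁ x ≠ 0) :
    wronskianRatio u₀ u₁ u₂ v₀ v₁ v₂ x * exp (2 * t / ε) = 1 ↔ wronskian u₀ v₀ x = 0 := by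
  have hpre := hAS.isPreconnected
  have E0 := exp_ne_zero (t / ε)
  have k1 : wronskian v₀ v₁ x = exp (t / ε) * wronskian v₀ u₁ x := by
    rw [hv₀.wronskian_eq hv₁ hAS.isOpen hpre hε.ne' hx hx₁,
      hv₀.wronskian_eq hu₁ hAS.isOpen hpre hε.ne' hx hx₁]
    rw [wkbVector_sub_const, ← e₁] at f₁
    simp only [wronskian_apply, f₁, WKBSign.val, neg_neg, one_mul, Pi.smul_apply, smul_eq_mul]
    ring
  have k2 : exp (t / ε) * wronskian v₂ v₀ x = wronskian u₂ v₀ x := by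
    rw [hv₂.wronskian_eq hv₀ hAS.isOpen hpre hε.ne' hx hx₂,
      hu₂.wronskian_eq hv₀ hAS.isOpen hpre hε.ne' hx hx₂]
    rw [wkbVector_sub_const, ← e₂] at f₂
    have : exp (t / ε) * exp (-1 * t / ε) = 1 := by
      rw [← exp_add, show (t / ε + -1 * t / ε : ℂ) = 0 by ring, exp_zero]
    simp only [wronskian_apply, f₂, WKBSign.val, Pi.smul_apply, smul_eq_mul]
    linear_combination (u₂ x₂ 0 * v₀ x₂ 1 - v₀ x₂ 0 * u₂ x₂ 1) * this
  have n4 : wronskian v₀ u₁ x ≠ 0 := fun h => n2 (by rw [k1, h, mul_zero])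
  have hexp : exp (2 * t / ε) = exp (t / ε) ^ 2 := by rw [← exp_nat_mul]; congr 1; push_cast; ring
  have e : wronskianRatio u₀ u₁ u₂ v₀ v₁ v₂ x * exp (2 * t / ε) =
      wronskian u₀ u₁ x * wronskian u₂ v₀ x / (wronskian u₂ u₀ x * wronskian v₀ u₁ x) := by
    rw [wronskianRatio, hexp, k1, ← k2]
    field_simp
  have plucker : wronskian u₀ u₁ x * wronskian u₂ v₀ x - wronskian u₂ u₀ x * wronskian v₀ u₁ x =
      wronskian u₀ v₀ x * wronskian u₂ u₁ x := by
    simp only [wronskian_apply]; ring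
  rw [e, div_eq_one_iff_eq (mul_ne_zero n1 n4), ← sub_eq_zero, plucker, mul_eq_zero,
    or_iff_left n3]

end

end ZakharovShabat

open ZakharovShabat in
theorem mainTheorem1
    (A S : ℂ → ℂ) (Ω : Set ℂ) (hAS : IsPotential A S Ω)
    (lam₀ : ℂ) (hlam₀ : lam₀.im ≠ 0)
    (c : ℝ → ℂ) (a b : ℝ) (hc : IsAdmissibleContour A S Ω lam₀ c a b)
    (H1 : ∀ t ∈ Set.Ioo a b, V0 A S lam₀ (c t) ≠ 0)
    (α β : ℂ → ℂ) (W : Set ℂ) (dα dβ kα kβ : ℂ) (z H : ℂ → ℂ → ℂ) (τ : ℂ → ℂ)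
    (hF : IsWKBFrame A S Ω lam₀ c a b α β W dα dβ kα kβ z H τ)
    (x₁ x₂ : ℂ)
    (hx₁ : x₁ ∈ downRegion (cutDomain W (c a) kα (c b) kβ) (z lam₀) (c '' Set.Ioo a b))
    (hx₂ : x₂ ∈ upRegion (cutDomain W (c a) kα (c b) kβ) (z lam₀) (c '' Set.Ioo a b)) :
    ∃ U ∈ 𝓝 lam₀, ∃ ε₀ : ℝ, 0 < ε₀ ∧ ∃ M : ℝ, ∀ lam ∈ U, ∀ ε : ℝ, 0 < ε → ε < ε₀ →
      ∀ u₀α u₁α u₂α u₀β u₁β u₂β : ℂ → Fin 2 → ℂ,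
        IsExactWKBAtInfinity A S Ω ε lam (z lam) (H lam) .plus atBot u₀α →
        IsExactWKB A S Ω ε lam (z lam) (H lam) .minus x₁ u₁α →
        IsExactWKB A S Ω ε lam (z lam) (H lam) .plus x₂ u₂α →
        IsExactWKBAtInfinity A S Ω ε lam (fun x => z lam x - τ lam) (H lam) .minus atTop u₀β →
        IsExactWKB A S Ω ε lam (fun x => z lam x - τ lam) (H lam) .minus x₁ u₁β →
        IsExactWKB A S Ω ε lam (fun x => z lam x - τ lam) (H lam) .plus x₂ u₂β →
        ∀ x ∈ Ω,
          wronskian u₂α u₀α x ≠ 0 ∧ wronskian u₀β u₁β x ≠ 0 ∧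
          (IsEigenvalue A S ε lam ↔
            wronskianRatio u₀α u₁α u₂α u₀β u₁β u₂β x * Complex.exp (2 * τ lam / ε) = 1) ∧
          ‖wronskianRatio u₀α u₁α u₂α u₀β u₁β u₂β x - deltaIndex A S lam₀ (c a) (c b)‖ ≤ M * ε := by
  have hx₁Ω : x₁ ∈ Ω := by
    obtain ⟨γ, -, h, rfl, -⟩ := hx₁
    exact hF.subset (h 0 (left_mem_Icc.2 zero_le_one)).1
  have hx₂Ω : x₂ ∈ Ω := by
    obtain ⟨γ, -, h, rfl, -⟩ := hx₂
    exact hF.subset (h 0 (left_mem_Icc.2 zero_le_one)).1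
  obtain ⟨θ, r, hL⟩ := hF.leftFrame hAS hlam₀ hc
  obtain ⟨θ', r', hR⟩ := hF.rightFrame hAS hlam₀ hc
  obtain ⟨σ, hσ⟩ := exists_sign hc.turning_left.1
  obtain ⟨ρ, hρ⟩ := exists_sign hc.turning_right.1
  have hσ' := hσ
  have hρ' := hρ
  rw [← hF.α_base] at hσ'
  rw [← hF.β_base, ← neg_neg (β lam₀), ← gPlus_mirror, ← gMinus_mirror] at hρ'
  rw [← hF.α_base, ← hF.β_base] at hx₁ hx₂
  -- On the right the phase is `z - τ`, which has the same real part at `lam₀`.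
  have hre : ∀ w : ℂ, (w - τ lam₀).re = w.re := fun w => by rw [sub_re, hF.re_action hc, sub_zero]
  have hx₁' : x₁ ∈ downRegion (((cutFamily W α kα β kβ z H).shift τ).D lam₀)
      (((cutFamily W α kα β kβ z H).shift τ).z lam₀) (c '' Set.Ioo a b) := by
    simpa only [downRegion, Family.shift, cutFamily, hre] using hx₁
  have hx₂' : x₂ ∈ upRegion (((cutFamily W α kα β kβ z H).shift τ).D lam₀)
      (((cutFamily W α kα β kβ z H).shift τ).z lam₀) (c '' Set.Ioo a b) := by
    simpa only [upRegion, Family.shift, cutFamily, hre] using hx₂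
  obtain ⟨R, C, e, hC, he, conn⟩ := hL.connection hAS hlam₀ hσ' hx₁ hx₂
  obtain ⟨R', C', e', hC', he', conn'⟩ := hR.connection hAS.mirror hlam₀ hρ'
    (mem_downRegion_mirror hx₂') (mem_upRegion_mirror hx₁')
  refine ⟨_, conn.and conn', min 1 (min e e'), by positivity, C * (1 + C') + C', ?_⟩
  rintro lam ⟨h, h'⟩ ε hε hεe u₀ u₁ u₂ v₀ v₁ v₂ hu₀ hu₁ hu₂ hv₀ hv₁ hv₂ x hx
  have hε1 : ε < 1 := lt_of_lt_of_le hεe (min_le_left _ _)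
  have hε2 : ε < e := lt_of_lt_of_le hεe ((min_le_right _ _).trans (min_le_left _ _))
  have hε3 : ε < e' := lt_of_lt_of_le hεe ((min_le_right _ _).trans (min_le_right _ _))
  obtain ⟨lp, hW⟩ := h ε hε hε2 u₀ u₁ u₂ hu₀ hu₁.1 hu₂.1 hu₁.eq_at_base hu₂.eq_at_base
  obtain ⟨lp', hW'⟩ := h' ε hε hε3 (mirrorSolution v₀) (mirrorSolution v₂) (mirrorSolution v₁)
    (hv₀.mirror hAS.isOpen hε.ne') (hv₂.1.mirror hAS.isOpen hε.ne')
    (hv₁.1.mirror hAS.isOpen hε.ne')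
    (mirrorSolution_of_eq_wkbVector (σ := .plus) (by rw [neg_neg]; exact hv₂.eq_at_base))
    (mirrorSolution_of_eq_wkbVector (σ := .minus) (by rw [neg_neg]; exact hv₁.eq_at_base))
  obtain ⟨n1, n3, b1⟩ := hW x hx
  obtain ⟨n2, -, b2⟩ := hW' (-x) (by simpa using hx)
  simp only [wronskian_mirrorSolution, neg_neg] at n2 b2
  rw [wronskian_swap v₁ v₀, neg_neg] at n2 b2
  rw [wronskian_swap v₀ v₂, neg_neg] at b2
  have hp0 : ∀ y ∈ Ω, u₀ y ≠ 0 := fun y hy h0 => (hW y hy).1 (by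
    simp [wronskian_apply, h0])
  refine ⟨n1, n2, ?_, ?_⟩
  · rw [isEigenvalue_iff_wronskian hAS hε.ne' hu₀.1 hv₀.1 hv₁.1 lp (memLp_of_mirrorSolution lp') hp0
      hx n2]
    exact (wronskianRatio_mul_exp_eq_one_iff hAS hε hx₁Ω hx₂Ω hu₁.1 hu₂.1 hv₀.1 hv₁.1 hv₂.1
      hu₁.eq_at_base hu₂.eq_at_base hv₁.eq_at_base hv₂.eq_at_base hx n1 n2 n3).symm
  · rw [deltaIndex_eq hAS (hc.mem a) (hc.mem b) hc.turning_left hc.turning_right hσ hρ,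
      wronskianRatio, mul_div_mul_comm]
    have nI : ∀ {s : ℂ} {P Q : Prop}, s = 1 ∧ P ∨ s = -1 ∧ Q → ‖I * s‖ = 1 := by
      rintro s P Q (⟨rfl, -⟩ | ⟨rfl, -⟩) <;> simp
    exact norm_mul_sub_mul_le hC hC' hε.le hε1.le (nI hσ) (nI hρ) b1 b2
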